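/- Let $d\ge 1$, let $\mathcal S_d=\{x\in[0,1]^d:\ |x_1|+\dots+|x_d|\le 1\}$ and $[d]=\{1,\dots,d\}$. Let $X_1,X_2,\dots$ be i.i.d. random vectors in $\mathbb R^d$ with joint c.d.f. $F(x)=\mathbb P(X_1\in(-\infty,x])$, let $F_n(x)=n^{-1}\sum_{i=1}^n \mathbf 1_{(-\infty,x]}(X_i)$, and for $n,m\ge 1$, $x\in\mathcal S_d$ let $$F^\star_{n,m}(x)=\sum_{k\in\mathbb N_0^d,\ |k|\le m}F_n(k/m)\,P_{k,m}(x),\qquad P_{k,m}(x)=\frac{m!}{(m-|k|)!\prod_i k_i!}\Bigl(1-\sum_i x_i\Bigr)^{m-|k|}\prod_i x_i^{k_i},\quad |k|=\sum_i k_i,$$ be the Bernstein c.d.f. estimator, with $\mathrm{MSE}(F^\star_{n,m}(x))=\mathbb E[(F^\star_{n,m}(x)-F(x))^2]$. Assume that $F$ is three times continuously differentiable on $\mathcal S_d$ (up to the boundary). Let $\mathcal J\subseteq[d]$ and assume that $F(x)=0$ for every $x\in\mathcal S_d$ with $x_i=0$ for some $i\in\mathcal J$. Let $I_\nu(z)=\sum_{k\ge0}\frac{(z/2)^{2k+\nu}}{k!(k+\nu)!}$.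 **(1)** Fix $\lambda_i>0$ for $i\in\mathcal J$. For $m\ge 1$ and $x_i\in(0,1)$ ($i\in[d]\setminus\mathcal J$) not depending on $m$, put $x_i=\lambda_i/m$ for $i\in\mathcal J$, and suppose $x\in\mathcal S_d$. Then, as $m\to\infty$, uniformly in $n\ge1$ (in particular as $n\to\infty$ along any $m=m(n)\to\infty$), $$\begin{aligned}\mathrm{MSE}(F^\star_{n,m}(x))={}&\frac1{nm}\sum_{i\in[d]}\partial_iF(x)\big|_{x_{\mathcal J}=0}\Bigl\{\lambda_i\bigl(1-e^{-2\lambda_i}(I_0(2\lambda_i)+I_1(2\lambda_i))\bigr)\mathbf 1_{\{i\in\mathcal J\}}-m^{1/2}\sqrt{\pi^{-1}x_i(1-x_i)}\,\mathbf 1_{\{i\notin\mathcal J\}}\Bigr\}\\&+\frac1nF(x)(1-F(x))\mathbf 1_{\{\mathcal J=\emptyset\}}\\&+\Bigl\{\frac1{2m}\sum_{i,j\in[d]\setminus\mathcal J}(x_i\mathbf 1_{\{i=j\}}-x_ix_j)\,\partial_i\partial_jF(x)\big|_{x_{\mathcal J}=0}+\frac1{2m^2}\sum_{i\in\mathcal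 J}\lambda_i\,\partial_i^2F(0)\Bigr\}^2\\&+O_{\lambda}(n^{-1}m^{-2})+o_{\lambda,x}(n^{-1}m^{-1/2})\mathbf 1_{\{\mathcal J\ne[d]\}}+O_{\lambda}(m^{-4})+o_{\lambda}(m^{-5/2})\mathbf 1_{\{\mathcal J\ne[d]\}},\end{aligned}$$ where the error terms may depend on $F$, $d$, $\mathcal J$ and on the subscripts; $O_\lambda$ and $o_\lambda$ are uniform in $(x_i)_{i\notin\mathcal J}$, while $o_{\lambda,x}$ may also depend on $(x_i)_{i\notin\mathcal J}$. **(2)** If $x\in\mathcal S_d$ has $x_i=0$ for some $i\in\mathcal J$, then for all $n,m\ge1$, $F^\star_{n,m}(x)=0$ almost surely and $\mathrm{MSE}(F^\star_{n,m}(x))=0$. **(3)** There is no optimal $m$ when $\mathcal J\neq\emptyset$. Precisely, let $\mathcal J\ne\emptyset$, let $F$ be not identically zero on $\mathcal S_d$, fix $\lambda_i>0$ ($i\in\mathcal J$) and $x_i\in(0,1)$ ($i\notin\mathcal J$) with $\sum_{i\notin\mathcal J}x_i<1$, and let $\mathrm{MSE}_n(m)$ be the MSE of $F^\star_{n,m}$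 at the point $x=x(m)$ of (1). Then there is $M$ such that for all $n\ge1$ and $m\ge M$ some $m'>m$ satisfies $\mathrm{MSE}_n(m')<\mathrm{MSE}_n(m)$; and for every sequence $m(n)\to\infty$ one has $\mathrm{MSE}_n(m(n))>0$ for all large $n$, and there is a sequence $m'(n)\to\infty$ with $\mathrm{MSE}_n(m'(n))=o(\mathrm{MSE}_n(m(n)))$ as $n\to\infty$. -/

import Mathlib

open MeasureTheory ProbabilityTheory Filter

namespace BernsteinSimplex

noncomputable section

/-- The unit simplex `S_d` in `ℝ^d`. -/
def simplex (d : ℕ) : Set (Fin d → ℝ) :=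
  {x | (∀ i, x i ∈ Set.Icc (0 : ℝ) 1) ∧ ∑ i, |x i| ≤ 1}

/-- The joint cumulative distribution function `x ↦ μ ((-∞, x])` of a measure on `ℝ^d`
(the order on `Fin d → ℝ` is the componentwise one). -/
def jointCDF {d : ℕ} (μ : Measure (Fin d → ℝ)) (x : Fin d → ℝ) : ℝ :=
  μ.real (Set.Iic x)

/-- The multi-indices `ℕ₀^d ∩ m S_d`, that is, those with `k_1 + ⋯ + k_d ≤ m`. -/
def multiIndices (d m : ℕ) : Finset (Fin d → ℕ) :=
  {k ∈ Fintype.piFinset fun _ : Fin d => Finset.range (m + 1) | ∑ i, k i ≤ m}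

/-- The multinomial weight `P_{k,m}(x)`. -/
def multinomialWeight {d : ℕ} (k : Fin d → ℕ) (m : ℕ) (x : Fin d → ℝ) : ℝ :=
  (m.factorial : ℝ) / (((m - ∑ i, k i).factorial : ℝ) * ∏ i, ((k i).factorial : ℝ)) *
    (1 - ∑ i, |x i|) ^ (m - ∑ i, k i) * ∏ i, x i ^ k i

/-- The Bernstein polynomial of order `m` of a function `G` on the simplex. -/
def bernsteinPoly {d : ℕ} (G : (Fin d → ℝ) → ℝ) (m : ℕ) (x : Fin d → ℝ) : ℝ :=
  ∑ k ∈ multiIndices d m, G (fun i => (k i : ℝ) / (m : ℝ)) * multinomialWeight k m x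

/-- The empirical c.d.f. of the first `n` observations. -/
def empiricalCDF {d : ℕ} (obs : ℕ → Fin d → ℝ) (n : ℕ) (x : Fin d → ℝ) : ℝ :=
  (n : ℝ)⁻¹ * ∑ i ∈ Finset.range n, (Set.Iic x).indicator (fun _ => (1 : ℝ)) (obs i)

/-- The Bernstein c.d.f. estimator `F*_{n,m}(x)`. -/
def bernsteinEstimator {d : ℕ} (obs : ℕ → Fin d → ℝ) (n m : ℕ) (x : Fin d → ℝ) : ℝ :=
  bernsteinPoly (empiricalCDF obs n) m x

/-- The mean squared error `E[(F*_{n,m}(x) - F(x))^2]`. -/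
def mse {d : ℕ} {Ω : Type*} [MeasurableSpace Ω] (P : Measure Ω) (X : ℕ → Ω → Fin d → ℝ)
    (F : (Fin d → ℝ) → ℝ) (n m : ℕ) (x : Fin d → ℝ) : ℝ :=
  ∫ ω, (bernsteinEstimator (fun i => X i ω) n m x - F x) ^ 2 ∂P

/-- The `i`-th partial derivative of a function on the simplex (boundary points included;
derivatives within the simplex are unique, since it is convex with non-empty interior). -/
def pderiv {d : ℕ} (i : Fin d) (G : (Fin d → ℝ) → ℝ) (x : Fin d → ℝ) : ℝ :=
  fderivWithin ℝ G (simplex d) x (Pi.single i 1)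

/-- The modified Bessel function of the first kind of integer order `ν`. -/
def besselI (ν : ℕ) (z : ℝ) : ℝ :=
  ∑' k : ℕ, (z / 2) ^ (2 * k + ν) / ((k.factorial : ℝ) * ((k + ν).factorial : ℝ))

/-- The point with coordinates `lam i / m` for `i ∈ J` and `y i` for `i ∉ J`. -/
def boundaryPoint {d : ℕ} (J : Finset (Fin d)) (lam y : Fin d → ℝ) (m : ℕ) : Fin d → ℝ :=
  fun i => if i ∈ J then lam i / (m : ℝ) else y i

/-- The point with the coordinates in `J` replaced by `0`. -/
def zeroOn {d : ℕ} (J : Finset (Fin d)) (x : Fin d → ℝ) : Fin d → ℝ :=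
  fun i => if i ∈ J then 0 else x i

/-- `m ≥ 1`, the coordinates outside `J` lie in `(0,1)`, and the point is in the simplex. -/
def Admissible {d : ℕ} (J : Finset (Fin d)) (lam y : Fin d → ℝ) (m : ℕ) : Prop :=
  1 ≤ m ∧ (∀ i, i ∉ J → y i ∈ Set.Ioo (0 : ℝ) 1) ∧ boundaryPoint J lam y m ∈ simplex d

/-- The explicit part of the variance at the point `x`, where `x i = lam i / m` for `i ∈ J`. -/
def varianceTerm {d : ℕ} (F : (Fin d → ℝ) → ℝ) (J : Finset (Fin d)) (lam x : Fin d → ℝ)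
    (n m : ℕ) : ℝ :=
  (n : ℝ)⁻¹ * (m : ℝ)⁻¹ *
      ∑ i, pderiv i F (zeroOn J x) *
        ((if i ∈ J then
            lam i * (1 - Real.exp (-2 * lam i) * (besselI 0 (2 * lam i) + besselI 1 (2 * lam i)))
          else 0) -
          (if i ∉ J then
            (m : ℝ) ^ (1 / 2 : ℝ) * Real.sqrt (Real.pi⁻¹ * (x i * (1 - x i)))
          else 0)) +
    (if J = ∅ then (n : ℝ)⁻¹ * (F x * (1 - F x)) else 0)

/-- The explicit part of the bias at the point `x`, where `x i = lam i / m` for `i ∈ J`. -/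
def biasTerm {d : ℕ} (F : (Fin d → ℝ) → ℝ) (J : Finset (Fin d)) (lam x : Fin d → ℝ)
    (m : ℕ) : ℝ :=
  1 / (2 * (m : ℝ)) *
      (∑ i ∈ Jᶜ, ∑ j ∈ Jᶜ,
        ((if i = j then x i else 0) - x i * x j) * pderiv i (pderiv j F) (zeroOn J x)) +
    1 / (2 * (m : ℝ) ^ 2) * ∑ i ∈ J, lam i * pderiv i (pderiv i F) 0

end

end BernsteinSimplex

namespace BernsteinSimplex

noncomputable section

variable {d : ℕ}

/-! ### The multinomial expectation -/

/-- The expectation of `G` under the multinomial weights. -/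
def mexp (x : Fin d → ℝ) (m : ℕ) (G : (Fin d → ℕ) → ℝ) : ℝ :=
  ∑ k ∈ multiIndices d m, G k * multinomialWeight k m x

/-- The mean of `G` after one further multinomial trial from the state `k`. -/
def trialMean (x : Fin d → ℝ) (G : (Fin d → ℕ) → ℝ) (k : Fin d → ℕ) : ℝ :=
  (1 - ∑ i, |x i|) * G k + ∑ i, x i * G (k + Pi.single i 1)

lemma mem_multiIndices {m : ℕ} {k : Fin d → ℕ} : k ∈ multiIndices d m ↔ ∑ i, k i ≤ m := by
  simp only [multiIndices, Finset.mem_filter, Fintype.mem_piFinset, Finset.mem_range,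
    and_iff_right_iff_imp]
  intro h i
  have := Finset.single_le_sum (f := k) (fun j _ => Nat.zero_le _) (Finset.mem_univ i)
  omega

lemma sum_add_single (k : Fin d → ℕ) (i : Fin d) :
    ∑ j, (k + Pi.single i 1 : Fin d → ℕ) j = ∑ j, k j + 1 := by
  simp [Finset.sum_add_distrib]

lemma weight_slack {m : ℕ} {k : Fin d → ℕ} (x : Fin d → ℝ) (hk : ∑ i, k i ≤ m) :
    ((m + 1 - ∑ i, k i : ℕ) : ℝ) * multinomialWeight k (m + 1) x =
      (m + 1) * ((1 - ∑ i, |x i|) * multinomialWeight k m x) := by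
  have h : m + 1 - ∑ i, k i = (m - ∑ i, k i) + 1 := by omega
  have hp : (∏ i, ((k i).factorial : ℝ)) ≠ 0 :=
    Finset.prod_ne_zero_iff.2 fun i _ => by positivity
  simp only [multinomialWeight, h, Nat.factorial_succ, pow_succ]
  push_cast
  field_simp

lemma weight_add_single {m : ℕ} {k : Fin d → ℕ} (x : Fin d → ℝ) (i : Fin d) :
    ((k i + 1 : ℕ) : ℝ) * multinomialWeight (k + Pi.single i 1) (m + 1) x =
      (m + 1) * (x i * multinomialWeight k m x) := by
  have hp : (∏ j ∈ Finset.univ.erase i, ((k j).factorial : ℝ)) ≠ 0 :=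
    Finset.prod_ne_zero_iff.2 fun i _ => by positivity
  have e1 : ∏ j, (((k + Pi.single i 1 : Fin d → ℕ) j).factorial : ℝ) =
      ((k i + 1).factorial : ℝ) * ∏ j ∈ Finset.univ.erase i, ((k j).factorial : ℝ) := by
    rw [← Finset.mul_prod_erase _ _ (Finset.mem_univ i)]
    congr 1
    · simp
    · refine Finset.prod_congr rfl fun j hj => ?_
      simp [Finset.ne_of_mem_erase hj]
  have e2 : ∏ j, x j ^ (k + Pi.single i 1 : Fin d → ℕ) j =
      x i ^ (k i + 1) * ∏ j ∈ Finset.univ.erase i, x j ^ k j := by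
    rw [← Finset.mul_prod_erase _ _ (Finset.mem_univ i)]
    congr 1
    · simp
    · refine Finset.prod_congr rfl fun j hj => ?_
      simp [Finset.ne_of_mem_erase hj]
  have e3 := Finset.mul_prod_erase Finset.univ (fun j => ((k j).factorial : ℝ)) (Finset.mem_univ i)
  have e4 := Finset.mul_prod_erase Finset.univ (fun j => x j ^ k j) (Finset.mem_univ i)
  simp only [multinomialWeight, sum_add_single, e1, e2, ← e3, ← e4, Nat.factorial_succ, pow_succ,
    Nat.add_sub_add_right]
  push_cast
  field_simp

lemma mexp_succ (x : Fin d → ℝ) (m : ℕ) (G : (Fin d → ℕ) → ℝ) :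
    mexp x (m + 1) G = mexp x m (trialMean x G) := by
  have h0 : ((m : ℝ) + 1) ≠ 0 := by positivity
  apply mul_left_cancel₀ h0
  have split : ((m : ℝ) + 1) * mexp x (m + 1) G =
      ∑ k ∈ multiIndices d (m + 1),
        G k * (((m + 1 - ∑ i, k i : ℕ) : ℝ) * multinomialWeight k (m + 1) x) +
      ∑ i, ∑ k ∈ multiIndices d (m + 1), G k * ((k i : ℝ) * multinomialWeight k (m + 1) x) := by
    rw [Finset.sum_comm, ← Finset.sum_add_distrib, mexp, Finset.mul_sum]
    refine Finset.sum_congr rfl fun k hk => ?_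
    rw [mem_multiIndices] at hk
    rw [← Finset.mul_sum, ← Finset.sum_mul, Nat.cast_sub hk]
    push_cast
    ring
  have hA : ∑ k ∈ multiIndices d (m + 1),
        G k * (((m + 1 - ∑ i, k i : ℕ) : ℝ) * multinomialWeight k (m + 1) x) =
      ∑ k ∈ multiIndices d m,
        G k * ((m + 1) * ((1 - ∑ i, |x i|) * multinomialWeight k m x)) := by
    have hsub : multiIndices d m ⊆ multiIndices d (m + 1) := fun k hk => by
      rw [mem_multiIndices] at *
      omega
    rw [← Finset.sum_subset hsub]
    · refine Finset.sum_congr rfl fun k hk => ?_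
      rw [weight_slack x (mem_multiIndices.1 hk)]
    · intro k hk hk'
      rw [mem_multiIndices] at *
      have : m + 1 - ∑ i, k i = 0 := by omega
      simp [this]
  have hB (i : Fin d) : ∑ k ∈ multiIndices d (m + 1),
        G k * ((k i : ℝ) * multinomialWeight k (m + 1) x) =
      ∑ k ∈ multiIndices d m,
        G (k + Pi.single i 1) * ((m + 1) * (x i * multinomialWeight k m x)) := by
    symm
    refine Finset.sum_of_injOn (fun k => k + Pi.single i 1) ?_ ?_ ?_ ?_
    · exact fun a _ b _ h => add_right_cancel h
    · intro k hk
      simp only [Finset.mem_coe, mem_multiIndices] at *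
      rw [sum_add_single]
      omega
    · intro k hk hk'
      have : k i = 0 := by
        by_contra h
        apply hk'
        refine ⟨k - Pi.single i 1, ?_, ?_⟩
        · have e : k = (k - Pi.single i 1) + Pi.single i 1 := by
            ext j
            by_cases hj : j = i
            · subst hj; simp; omega
            · simp [hj]
          rw [mem_multiIndices, e, sum_add_single] at hk
          simp only [Finset.mem_coe, mem_multiIndices]
          omega
        · ext j
          by_cases hj : j = i
          · subst hj; simp; omega
          · simp [hj]
      simp [this]
    · intro k hk
      rw [← weight_add_single]
      simp
  rw [split, hA]
  simp_rw [hB]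
  rw [Finset.sum_comm, ← Finset.sum_add_distrib, mexp, Finset.mul_sum]
  refine Finset.sum_congr rfl fun k _ => ?_
  rw [trialMean, add_mul (_ * _), mul_add ((m : ℝ) + 1), Finset.sum_mul, Finset.mul_sum]
  congr 1
  · ring
  · exact Finset.sum_congr rfl fun i _ => by ring

lemma mexp_zero (x : Fin d → ℝ) (G : (Fin d → ℕ) → ℝ) : mexp x 0 G = G 0 := by
  have : multiIndices d 0 = {0} := by
    ext k
    rw [mem_multiIndices]
    simp [funext_iff]
  simp [mexp, this, multinomialWeight]

lemma mexp_add (x : Fin d → ℝ) (m : ℕ) (G H : (Fin d → ℕ) → ℝ) :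
    mexp x m (fun k => G k + H k) = mexp x m G + mexp x m H := by
  simp [mexp, add_mul, Finset.sum_add_distrib]

lemma mexp_sub (x : Fin d → ℝ) (m : ℕ) (G H : (Fin d → ℕ) → ℝ) :
    mexp x m (fun k => G k - H k) = mexp x m G - mexp x m H := by
  simp [mexp, sub_mul, Finset.sum_sub_distrib]

lemma mexp_const_mul (x : Fin d → ℝ) (m : ℕ) (c : ℝ) (G : (Fin d → ℕ) → ℝ) :
    mexp x m (fun k => c * G k) = c * mexp x m G := by
  simp [mexp, Finset.mul_sum, mul_assoc]

lemma mexp_mul_const (x : Fin d → ℝ) (m : ℕ) (c : ℝ) (G : (Fin d → ℕ) → ℝ) :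
    mexp x m (fun k => G k * c) = mexp x m G * c := by
  simp [mexp, Finset.sum_mul, mul_right_comm]

lemma mexp_sum {ι : Type*} (s : Finset ι) (x : Fin d → ℝ) (m : ℕ)
    (G : ι → (Fin d → ℕ) → ℝ) :
    mexp x m (fun k => ∑ a ∈ s, G a k) = ∑ a ∈ s, mexp x m (G a) := by
  simp only [mexp, Finset.sum_mul]
  exact Finset.sum_comm

lemma mexp_congr {x : Fin d → ℝ} {m : ℕ} {G H : (Fin d → ℕ) → ℝ}
    (h : ∀ k, ∑ i, k i ≤ m → G k = H k) : mexp x m G = mexp x m H :=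
  Finset.sum_congr rfl fun k hk => by rw [h k (mem_multiIndices.1 hk)]

lemma mexp_one (x : Fin d → ℝ) (hx : ∀ i, 0 ≤ x i) (m : ℕ) : mexp x m (fun _ => 1) = 1 := by
  induction m with
  | zero => rw [mexp_zero]
  | succ m ih =>
    rw [mexp_succ]
    convert! ih using 2
    ext k
    simp [trialMean, abs_of_nonneg (hx _)]

lemma mexp_const (x : Fin d → ℝ) (hx : ∀ i, 0 ≤ x i) (m : ℕ) (c : ℝ) :
    mexp x m (fun _ => c) = c := by
  have := mexp_const_mul x m c (fun _ => 1)
  simpa [mexp_one x hx] using this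

lemma nonneg_of_mem_simplex {x : Fin d → ℝ} (hx : x ∈ simplex d) (i : Fin d) : 0 ≤ x i :=
  (hx.1 i).1

lemma multinomialWeight_nonneg {x : Fin d → ℝ} (hx : x ∈ simplex d) (k : Fin d → ℕ) (m : ℕ) :
    0 ≤ multinomialWeight k m x := by
  have h1 : 0 ≤ 1 - ∑ i, |x i| := by linarith [hx.2]
  have h2 : 0 ≤ ∏ i, x i ^ k i :=
    Finset.prod_nonneg fun i _ => pow_nonneg (nonneg_of_mem_simplex hx i) _
  unfold multinomialWeight
  positivity

lemma mexp_mono {x : Fin d → ℝ} (hx : x ∈ simplex d) {m : ℕ} {G H : (Fin d → ℕ) → ℝ}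
    (h : ∀ k, ∑ i, k i ≤ m → G k ≤ H k) : mexp x m G ≤ mexp x m H :=
  Finset.sum_le_sum fun k hk =>
    mul_le_mul_of_nonneg_right (h k (mem_multiIndices.1 hk)) (multinomialWeight_nonneg hx k m)

lemma mexp_nonneg {x : Fin d → ℝ} (hx : x ∈ simplex d) {m : ℕ} {G : (Fin d → ℕ) → ℝ}
    (h : ∀ k, ∑ i, k i ≤ m → 0 ≤ G k) : 0 ≤ mexp x m G :=
  Finset.sum_nonneg fun k hk =>
    mul_nonneg (h k (mem_multiIndices.1 hk)) (multinomialWeight_nonneg hx k m)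

lemma abs_mexp_le {x : Fin d → ℝ} (hx : x ∈ simplex d) {m : ℕ} {G H : (Fin d → ℕ) → ℝ}
    (h : ∀ k, ∑ i, k i ≤ m → |G k| ≤ H k) : |mexp x m G| ≤ mexp x m H := by
  refine (Finset.abs_sum_le_sum_abs _ _).trans (Finset.sum_le_sum fun k hk => ?_)
  rw [abs_mul, abs_of_nonneg (multinomialWeight_nonneg hx k m)]
  exact mul_le_mul_of_nonneg_right (h k (mem_multiIndices.1 hk)) (multinomialWeight_nonneg hx k m)

/-! ### Moments of the multinomial law -/

/-- The probability of each outcome of one trial; `none` means that no coordinate increases. -/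
def cellProb (x : Fin d → ℝ) : Option (Fin d) → ℝ
  | none => 1 - ∑ i, |x i|
  | some i => x i

/-- The centred increment of the `i`-th coordinate in one trial. -/
def increment (x : Fin d → ℝ) (i : Fin d) : Option (Fin d) → ℝ
  | none => -x i
  | some j => (if j = i then 1 else 0) - x i

/-- The mean of a function of the outcome of one trial. -/
def cellMean (x : Fin d → ℝ) (f : Option (Fin d) → ℝ) : ℝ := ∑ o, cellProb x o * f o

/-- The state after the outcome `o`. -/
def advance (k : Fin d → ℕ) : Option (Fin d) → Fin d → ℕ
  | none => k
  | some i => k + Pi.single i 1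

lemma trialMean_eq_cellMean (x : Fin d → ℝ) (G : (Fin d → ℕ) → ℝ) (k : Fin d → ℕ) :
    trialMean x G k = cellMean x (fun o => G (advance k o)) := by
  simp [trialMean, cellMean, Fintype.sum_option, cellProb, advance]

/-- The centred coordinate `k i - m x i`. -/
def centred (x : Fin d → ℝ) (m : ℕ) (i : Fin d) (k : Fin d → ℕ) : ℝ := k i - m * x i

lemma centred_advance (x : Fin d → ℝ) (m : ℕ) (i : Fin d) (k : Fin d → ℕ)
    (o : Option (Fin d)) :
    centred x (m + 1) i (advance k o) = centred x m i k + increment x i o := by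
  cases o with
  | none => simp [centred, advance, increment]; ring
  | some j =>
    simp only [centred, advance, increment, Pi.add_apply, Pi.single_apply, eq_comm (a := j)]
    split_ifs <;> push_cast <;> ring

lemma cellMean_add (x : Fin d → ℝ) (f g : Option (Fin d) → ℝ) :
    cellMean x (fun o => f o + g o) = cellMean x f + cellMean x g := by
  simp [cellMean, mul_add, Finset.sum_add_distrib]

lemma cellMean_const_mul (x : Fin d → ℝ) (c : ℝ) (f : Option (Fin d) → ℝ) :
    cellMean x (fun o => c * f o) = c * cellMean x f := by
  simp only [cellMean, Finset.mul_sum, mul_left_comm]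

lemma cellMean_const {x : Fin d → ℝ} (hx : ∀ i, 0 ≤ x i) (c : ℝ) :
    cellMean x (fun _ => c) = c := by
  simp only [cellMean, Fintype.sum_option, cellProb, abs_of_nonneg (hx _), ← Finset.sum_mul]
  ring

lemma cellMean_increment {x : Fin d → ℝ} (hx : ∀ i, 0 ≤ x i) (i : Fin d) :
    cellMean x (increment x i) = 0 := by
  simp only [cellMean, Fintype.sum_option, cellProb, increment, abs_of_nonneg (hx _), mul_sub,
    Finset.sum_sub_distrib, ← Finset.sum_mul]
  simp
  ring

lemma cellMean_increment_mul {x : Fin d → ℝ} (hx : ∀ i, 0 ≤ x i) (i j : Fin d) :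
    cellMean x (fun o => increment x i o * increment x j o) =
      (if i = j then x i else 0) - x i * x j := by
  have h (a : Fin d) : x a * (((if a = i then (1 : ℝ) else 0) - x i) *
      ((if a = j then (1 : ℝ) else 0) - x j)) =
      (if a = i then (if i = j then x i else 0) - x i * x j else 0) +
        (if a = j then - (x i * x j) else 0) + x a * (x i * x j) := by
    split_ifs <;> subst_vars <;> simp_all <;> ring
  simp only [cellMean, Fintype.sum_option, cellProb, increment, abs_of_nonneg (hx _), h,
    Finset.sum_add_distrib, ← Finset.sum_mul]
  simp
  ring

lemma abs_increment_le {x : Fin d → ℝ} (hx : x ∈ simplex d) (i : Fin d) (o : Option (Fin d)) :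
    |increment x i o| ≤ 1 := by
  have := hx.1 i
  simp only [Set.mem_Icc] at this
  cases o with
  | none => rw [increment, abs_le]; constructor <;> linarith
  | some j => rw [increment, abs_le]; split_ifs <;> constructor <;> linarith

lemma cellProb_nonneg {x : Fin d → ℝ} (hx : x ∈ simplex d) (o : Option (Fin d)) :
    0 ≤ cellProb x o := by
  cases o with
  | none => simpa [cellProb] using hx.2
  | some j => exact nonneg_of_mem_simplex hx j

lemma abs_cellMean_le {x : Fin d → ℝ} (hx : x ∈ simplex d) {f : Option (Fin d) → ℝ} {c : ℝ}
    (h : ∀ o, |f o| ≤ c) : |cellMean x f| ≤ c := by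
  rw [← cellMean_const (nonneg_of_mem_simplex hx) c]
  refine (Finset.abs_sum_le_sum_abs _ _).trans (Finset.sum_le_sum fun o _ => ?_)
  rw [abs_mul, abs_of_nonneg (cellProb_nonneg hx o)]
  exact mul_le_mul_of_nonneg_left (h o) (cellProb_nonneg hx o)

lemma mexp_centred {x : Fin d → ℝ} (hx : ∀ i, 0 ≤ x i) (m : ℕ) (i : Fin d) :
    mexp x m (centred x m i) = 0 := by
  induction m with
  | zero => simp [mexp_zero, centred]
  | succ m ih =>
    rw [mexp_succ, ← ih]
    congr 1
    ext k
    simp only [trialMean_eq_cellMean, centred_advance]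
    rw [cellMean_add, cellMean_const hx, cellMean_increment hx, add_zero]

lemma mexp_centred_mul {x : Fin d → ℝ} (hx : ∀ i, 0 ≤ x i) (m : ℕ) (i j : Fin d) :
    mexp x m (fun k => centred x m i k * centred x m j k) =
      m * ((if i = j then x i else 0) - x i * x j) := by
  induction m with
  | zero => simp [mexp_zero, centred]
  | succ m ih =>
    rw [mexp_succ]
    have (k : Fin d → ℕ) : trialMean x (fun k => centred x (m + 1) i k * centred x (m + 1) j k) k =
        centred x m i k * centred x m j k + ((if i = j then x i else 0) - x i * x j) := by
      simp only [trialMean_eq_cellMean, centred_advance]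
      have (o : Option (Fin d)) : (centred x m i k + increment x i o) *
          (centred x m j k + increment x j o) = centred x m i k * centred x m j k +
            (centred x m i k * increment x j o + (centred x m j k * increment x i o +
              increment x i o * increment x j o)) := by ring
      simp only [this, cellMean_add, cellMean_const_mul, cellMean_const hx, cellMean_increment hx,
        cellMean_increment_mul hx]
      ring
    rw [funext this, mexp_add, ih, mexp_const x hx]
    push_cast
    ring

lemma mexp_centred_mul_mul {x : Fin d → ℝ} (hx : ∀ i, 0 ≤ x i) (m : ℕ) (i j l : Fin d) :
    mexp x m (fun k => centred x m i k * centred x m j k * centred x m l k) =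
      m * cellMean x (fun o => increment x i o * increment x j o * increment x l o) := by
  induction m with
  | zero => simp [mexp_zero, centred]
  | succ m ih =>
    rw [mexp_succ]
    set c := cellMean x (fun o => increment x i o * increment x j o * increment x l o) with hc
    have (k : Fin d → ℕ) : trialMean x (fun k => centred x (m + 1) i k * centred x (m + 1) j k *
          centred x (m + 1) l k) k =
        centred x m i k * centred x m j k * centred x m l k +
          (((if j = l then x j else 0) - x j * x l) * centred x m i k +
          (((if i = l then x i else 0) - x i * x l) * centred x m j k +
          (((if i = j then x i else 0) - x i * x j) * centred x m l k + c))) := by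
      simp only [trialMean_eq_cellMean, centred_advance]
      have (o : Option (Fin d)) : (centred x m i k + increment x i o) *
          (centred x m j k + increment x j o) * (centred x m l k + increment x l o) =
          centred x m i k * centred x m j k * centred x m l k +
            (centred x m i k * centred x m j k * increment x l o +
            (centred x m i k * centred x m l k * increment x j o +
            (centred x m j k * centred x m l k * increment x i o +
            (centred x m i k * (increment x j o * increment x l o) +
            (centred x m j k * (increment x i o * increment x l o) +
            (centred x m l k * (increment x i o * increment x j o) +
              increment x i o * increment x j o * increment x l o)))))) := by ring
      simp only [this, cellMean_add, cellMean_const_mul, cellMean_const hx, cellMean_increment hx,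
        cellMean_increment_mul hx, ← hc]
      ring
    rw [funext this]
    simp only [mexp_add, ih, mexp_const x hx, mexp_const_mul, mexp_centred hx]
    push_cast
    ring

lemma abs_mexp_centred_mul_mul_le {x : Fin d → ℝ} (hx : x ∈ simplex d) (m : ℕ) (i j l : Fin d) :
    |mexp x m (fun k => centred x m i k * centred x m j k * centred x m l k)| ≤ m := by
  rw [mexp_centred_mul_mul (nonneg_of_mem_simplex hx), abs_mul, Nat.abs_cast]
  refine mul_le_of_le_one_right (by positivity) (abs_cellMean_le hx fun o => ?_)
  rw [abs_mul, abs_mul]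
  exact mul_le_one₀ (mul_le_one₀ (abs_increment_le hx i o) (abs_nonneg _) (abs_increment_le hx j o))
    (abs_nonneg _) (abs_increment_le hx l o)

lemma mexp_centred_pow_four_le {x : Fin d → ℝ} (hx : x ∈ simplex d) (m : ℕ) (i : Fin d) :
    mexp x m (fun k => centred x m i k ^ 4) ≤ 3 * (m : ℝ) ^ 2 := by
  have hx0 := nonneg_of_mem_simplex hx
  induction m with
  | zero => simp [mexp_zero, centred]
  | succ m ih =>
    rw [mexp_succ]
    set c := cellMean x (fun o => increment x i o * increment x i o * increment x i o) with hc
    set c4 := cellMean x (fun o => increment x i o ^ 4) with hc4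
    have (k : Fin d → ℕ) : trialMean x (fun k => centred x (m + 1) i k ^ 4) k =
        centred x m i k ^ 4 + (6 * (x i - x i * x i) * (centred x m i k * centred x m i k) +
          (4 * c * centred x m i k + c4)) := by
      simp only [trialMean_eq_cellMean, centred_advance]
      have (o : Option (Fin d)) : (centred x m i k + increment x i o) ^ 4 =
          centred x m i k ^ 4 + (4 * centred x m i k ^ 3 * increment x i o +
            (6 * centred x m i k ^ 2 * (increment x i o * increment x i o) +
            (4 * centred x m i k * (increment x i o * increment x i o * increment x i o) +
              increment x i o ^ 4))) := by ring
      simp only [this, cellMean_add, cellMean_const_mul, cellMean_const hx0,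
        cellMean_increment hx0, cellMean_increment_mul hx0, ← hc, ← hc4]
      simp
      ring
    rw [funext this]
    simp only [mexp_add, mexp_const x hx0, mexp_const_mul, mexp_centred hx0, mexp_centred_mul hx0]
    have h4 : c4 ≤ 1 := (le_abs_self _).trans <| abs_cellMean_le hx fun o => by
      rw [abs_pow]; exact pow_le_one₀ (abs_nonneg _) (abs_increment_le hx i o)
    have hs : (x i - x i * x i) * (x i - x i * x i) ≤ 1 := by
      have := hx.1 i
      simp only [Set.mem_Icc] at this
      have a : 0 ≤ x i - x i * x i := by nlinarith
      have b : x i - x i * x i ≤ 1 := by nlinarith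
      nlinarith
    have hm : (0 : ℝ) ≤ m := by positivity
    simp only [if_true]
    push_cast
    nlinarith [mul_le_mul_of_nonneg_left hs hm]

/-- The characteristic function of the difference of two independent binomial variables. -/
lemma mexp_mexp_cos {x : Fin d → ℝ} (hx : ∀ i, 0 ≤ x i) (m : ℕ) (i : Fin d) (t : ℝ) :
    mexp x m (fun k => mexp x m fun l => Real.cos (((k i : ℝ) - l i) * t)) =
      (1 - 2 * x i * (1 - x i) * (1 - Real.cos t)) ^ m := by
  set C : ℕ → ℝ := fun m => mexp x m fun k => Real.cos (k i * t) with hC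
  set S : ℕ → ℝ := fun m => mexp x m fun k => Real.sin (k i * t) with hS
  have key (G H : (Fin d → ℕ) → ℝ) (u v : ℝ)
      (h : ∀ k j, G (k + Pi.single j 1) = if j = i then u * G k + v * H k else G k) (m : ℕ) :
      mexp x (m + 1) G = (1 - x i + x i * u) * mexp x m G + x i * v * mexp x m H := by
    rw [mexp_succ, ← mexp_const_mul, ← mexp_const_mul, ← mexp_add]
    congr 1
    ext k
    simp only [trialMean, abs_of_nonneg (hx _), h]
    have (j : Fin d) : x j * (if j = i then u * G k + v * H k else G k) =
        (if j = i then x i * (u * G k + v * H k - G k) else 0) + x j * G k := by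
      split_ifs with hj
      · subst hj; ring
      · ring
    simp only [this, Finset.sum_add_distrib, ← Finset.sum_mul]
    simp
    ring
  have hCs (m : ℕ) : C (m + 1) = (1 - x i + x i * Real.cos t) * C m + x i * (-Real.sin t) * S m := by
    refine key _ _ _ _ (fun k j => ?_) m
    split_ifs with hj
    · subst hj
      simp [add_mul, Real.cos_add]; ring
    · simp [Ne.symm hj]
  have hSs (m : ℕ) : S (m + 1) = (1 - x i + x i * Real.cos t) * S m + x i * Real.sin t * C m := by
    refine key _ _ _ _ (fun k j => ?_) m
    split_ifs with hj
    · subst hj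
      simp [add_mul, Real.sin_add]; ring
    · simp [Ne.symm hj]
  have hsq (m : ℕ) : C m ^ 2 + S m ^ 2 = (1 - 2 * x i * (1 - x i) * (1 - Real.cos t)) ^ m := by
    induction m with
    | zero => simp [hC, hS, mexp_zero]
    | succ m ih =>
      rw [hCs, hSs, pow_succ (1 - _), ← ih]
      linear_combination (C m ^ 2 + S m ^ 2) * x i ^ 2 * Real.sin_sq_add_cos_sq t
  rw [← hsq, pow_two, pow_two]
  simp only [hC, hS]
  rw [← mexp_mul_const, ← mexp_mul_const, ← mexp_add]
  congr 1
  ext k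
  rw [← mexp_const_mul, ← mexp_const_mul, ← mexp_add]
  congr 1
  ext l
  rw [sub_mul, Real.cos_sub]

/-! ### The mean distance of two independent binomial variables -/

/-- The trigonometric polynomial `(1 - cos (n t)) / (1 - cos t)`. -/
def fejer : ℕ → ℝ → ℝ
  | 0, _ => 0
  | 1, _ => 1
  | n + 2, t => 2 * fejer (n + 1) t - fejer n t + 2 * Real.cos ((n + 1) * t)

lemma one_sub_cos_mul_fejer (t : ℝ) :
    ∀ n : ℕ, (1 - Real.cos t) * fejer n t = 1 - Real.cos (n * t)
  | 0 => by simp [fejer]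
  | 1 => by simp [fejer]
  | n + 2 => by
    have h1 := one_sub_cos_mul_fejer t (n + 1)
    have h0 := one_sub_cos_mul_fejer t n
    have e2 : Real.cos (((n + 2 : ℕ) : ℝ) * t) + Real.cos (n * t) =
        2 * Real.cos ((n + 1) * t) * Real.cos t := by
      have a : ((n + 2 : ℕ) : ℝ) * t = (n + 1) * t + t := by push_cast; ring
      have b : (n : ℝ) * t = (n + 1) * t - t := by ring
      rw [a, b, Real.cos_add, Real.cos_sub]
      ring
    rw [fejer]
    push_cast at h1 h0 e2 ⊢
    linear_combination 2 * h1 - h0 + e2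

lemma continuous_fejer : ∀ n : ℕ, Continuous (fejer n)
  | 0 => continuous_const
  | 1 => continuous_const
  | n + 2 => by
    have h1 := continuous_fejer (n + 1)
    have h0 := continuous_fejer n
    change Continuous fun t => 2 * fejer (n + 1) t - fejer n t + 2 * Real.cos ((n + 1) * t)
    fun_prop

lemma integral_fejer : ∀ n : ℕ, ∫ t in (0 : ℝ)..Real.pi, fejer n t = n * Real.pi
  | 0 => by simp [fejer]
  | 1 => by simp [fejer]
  | n + 2 => by
    have h1 := integral_fejer (n + 1)
    have h0 := integral_fejer n
    have i1 : IntervalIntegrable (fejer (n + 1)) volume 0 Real.pi :=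
      (continuous_fejer (n + 1)).intervalIntegrable _ _
    have i0 : IntervalIntegrable (fejer n) volume 0 Real.pi :=
      (continuous_fejer n).intervalIntegrable _ _
    have hc : ∫ t in (0 : ℝ)..Real.pi, Real.cos (((n : ℝ) + 1) * t) = 0 := by
      have hn : ((n : ℝ) + 1) ≠ 0 := by positivity
      rw [intervalIntegral.integral_comp_mul_left (fun t => Real.cos t) hn]
      have : Real.sin (((n : ℝ) + 1) * Real.pi) = 0 := by exact_mod_cast Real.sin_nat_mul_pi (n + 1)
      simp [this]
    simp only [fejer]
    rw [intervalIntegral.integral_add ((i1.const_mul 2).sub i0), intervalIntegral.integral_sub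
      (i1.const_mul 2) i0, intervalIntegral.integral_const_mul, intervalIntegral.integral_const_mul,
      h1, h0, hc]
    · push_cast; ring
    · exact Continuous.intervalIntegrable (by fun_prop) _ _

lemma integral_pow_eq (q : ℝ) (m : ℕ) :
    ∑ j ∈ Finset.range m, ∫ t in (0 : ℝ)..Real.pi, (1 - q * (1 - Real.cos t)) ^ j =
      m * ∫ t in (0 : ℝ)..Real.pi, (1 - q * (1 - Real.cos t)) ^ (m - 1) * (1 + Real.cos t) := by
  induction m with
  | zero => simp
  | succ m ih =>
    rw [Finset.sum_range_succ, ih]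
    set a : ℝ → ℝ := fun t => 1 - q * (1 - Real.cos t) with ha
    have hcont : Continuous a := by fun_prop
    have hderiv (t : ℝ) : HasDerivAt (fun t => Real.sin t * a t ^ m)
        ((m + 1) * (a t ^ m * (1 + Real.cos t)) - a t ^ m -
          m * (a t ^ (m - 1) * (1 + Real.cos t))) t := by
      have h1 : HasDerivAt a (-(q * Real.sin t)) t := by
        have := ((Real.hasDerivAt_cos t).const_sub 1).const_mul q |>.const_sub 1
        simpa using this
      convert! (Real.hasDerivAt_sin t).mul (h1.pow m) using 1
      rcases m with _ | m
      · simp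
      · have : Real.sin t ^ 2 = (1 - Real.cos t) * (1 + Real.cos t) := by
          rw [Real.sin_sq]; ring
        simp only [Nat.add_sub_cancel, Pi.pow_apply, pow_succ (a t) m]
        push_cast
        have hq : a t = 1 - q * (1 - Real.cos t) := rfl
        have : q * Real.sin t ^ 2 = (1 - a t) * (1 + Real.cos t) := by rw [this, hq]; ring
        linear_combination ((m + 1) * a t ^ m) * this
    have hint : ∫ t in (0 : ℝ)..Real.pi, ((m + 1) * (a t ^ m * (1 + Real.cos t)) - a t ^ m -
          m * (a t ^ (m - 1) * (1 + Real.cos t))) = 0 := by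
      rw [intervalIntegral.integral_eq_sub_of_hasDerivAt (fun t _ => hderiv t)
        (Continuous.intervalIntegrable (by fun_prop) _ _)]
      simp
    rw [intervalIntegral.integral_sub, intervalIntegral.integral_sub,
      intervalIntegral.integral_const_mul, intervalIntegral.integral_const_mul] at hint
    · push_cast
      linarith
    all_goals exact Continuous.intervalIntegrable (by fun_prop) _ _

lemma integral_mexp {x : Fin d → ℝ} {m : ℕ} {f : (Fin d → ℕ) → ℝ → ℝ}
    (hf : ∀ k, Continuous (f k)) (a b : ℝ) :
    ∫ t in a..b, mexp x m (fun k => f k t) = mexp x m (fun k => ∫ t in a..b, f k t) := by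
  simp only [mexp]
  rw [intervalIntegral.integral_finsetSum]
  · simp
  · exact fun k _ => ((hf k).mul continuous_const).intervalIntegrable _ _

lemma continuous_mexp {x : Fin d → ℝ} {m : ℕ} {f : (Fin d → ℕ) → ℝ → ℝ}
    (hf : ∀ k, Continuous (f k)) : Continuous fun t => mexp x m (fun k => f k t) :=
  continuous_finsetSum _ fun k _ => (hf k).mul continuous_const

/-- The mean distance of two independent binomial variables as an integral. -/
lemma mexp_mexp_abs_sub {x : Fin d → ℝ} (hx : ∀ i, 0 ≤ x i) (m : ℕ) (i : Fin d) :
    mexp x m (fun k => mexp x m fun l => |(k i : ℝ) - l i|) =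
      Real.pi⁻¹ * (m * (2 * x i * (1 - x i)) * ∫ t in (0 : ℝ)..Real.pi,
        (1 - 2 * x i * (1 - x i) * (1 - Real.cos t)) ^ (m - 1) * (1 + Real.cos t)) := by
  set q := 2 * x i * (1 - x i) with hq
  have hpi := Real.pi_ne_zero
  have habs (k l : Fin d → ℕ) : |(k i : ℝ) - l i| = ((k i - l i : ℤ).natAbs : ℝ) := by
    rw [Nat.cast_natAbs]; push_cast; rfl
  have h1 (k l : Fin d → ℕ) : |(k i : ℝ) - l i| = Real.pi⁻¹ *
      ∫ t in (0 : ℝ)..Real.pi, fejer (k i - l i : ℤ).natAbs t := by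
    rw [integral_fejer, habs]; field_simp
  simp only [h1, mexp_const_mul]
  congr 1
  have hinner (k : Fin d → ℕ) := integral_mexp (x := x) (m := m)
    (f := fun l t => fejer (k i - l i : ℤ).natAbs t) (fun l => continuous_fejer _) 0 Real.pi
  have houter := integral_mexp (x := x) (m := m)
    (f := fun k t => mexp x m fun l => fejer (k i - l i : ℤ).natAbs t)
    (fun k => continuous_mexp fun l => continuous_fejer _) 0 Real.pi
  simp only [← hinner]
  rw [← houter]
  have h2 (t : ℝ) (ht : t ∈ Set.Ioo 0 Real.pi) :
      mexp x m (fun k => mexp x m fun l => fejer (k i - l i : ℤ).natAbs t) =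
        q * ∑ j ∈ Finset.range m, (1 - q * (1 - Real.cos t)) ^ j := by
    have hc : 1 - Real.cos t ≠ 0 := by
      have : Real.cos t < 1 := by
        rw [← Real.cos_zero]
        exact Real.cos_lt_cos_of_nonneg_of_le_pi le_rfl ht.2.le ht.1
      linarith
    apply mul_left_cancel₀ hc
    rw [← mexp_const_mul]
    simp only [← mexp_const_mul, one_sub_cos_mul_fejer]
    have h3 (k l : Fin d → ℕ) : Real.cos (((k i - l i : ℤ).natAbs : ℝ) * t) =
        Real.cos (((k i : ℝ) - l i) * t) := by
      rw [← habs]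
      rcases abs_cases ((k i : ℝ) - l i) with h | h
      · rw [h.1]
      · rw [h.1, neg_mul, Real.cos_neg]
    simp only [h3, mexp_sub, mexp_const x hx]
    rw [mexp_mexp_cos hx, ← hq]
    have := mul_neg_geom_sum (1 - q * (1 - Real.cos t)) m
    linear_combination -this
  rw [intervalIntegral.integral_congr_ae (g := fun t =>
    q * ∑ j ∈ Finset.range m, (1 - q * (1 - Real.cos t)) ^ j)]
  · rw [intervalIntegral.integral_const_mul, intervalIntegral.integral_finsetSum, integral_pow_eq]
    · ring
    · exact fun j _ => Continuous.intervalIntegrable (by fun_prop) _ _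
  · have : ∀ᵐ t : ℝ, t ≠ Real.pi := by simp [ae_iff]
    filter_upwards [this] with t ht ht'
    rw [Set.uIoc_of_le Real.pi_pos.le] at ht'
    exact h2 t ⟨ht'.1, lt_of_le_of_ne ht'.2 ht⟩

lemma mexp_mexp_min {x : Fin d → ℝ} (hx : ∀ i, 0 ≤ x i) (m : ℕ) (i : Fin d) :
    mexp x m (fun k => mexp x m fun l => min (k i : ℝ) (l i)) =
      m * x i - mexp x m (fun k => mexp x m fun l => |(k i : ℝ) - l i|) / 2 := by
  have hm : mexp x m (fun k => (k i : ℝ)) = m * x i := by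
    have := mexp_centred hx m i
    unfold centred at this
    rw [mexp_sub, mexp_const x hx] at this
    linarith
  have h (a b : ℝ) : min a b = (1 / 2) * ((a + b) - |a - b|) := by
    rcases le_total a b with h | h
    · rw [min_eq_left h, abs_of_nonpos (by linarith)]; ring
    · rw [min_eq_right h, abs_of_nonneg (by linarith)]; ring
  simp only [h, mexp_const_mul, mexp_sub, mexp_add, mexp_const x hx, hm]
  ring

/-! ### Bessel functions and the Poisson limit -/

lemma integral_cos_pow_odd (k : ℕ) : ∫ t in (0 : ℝ)..Real.pi, Real.cos t ^ (2 * k + 1) = 0 := by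
  induction k with
  | zero => simp
  | succ k ih =>
    rw [show 2 * (k + 1) + 1 = (2 * k + 1) + 2 by ring, integral_cos_pow, ih]
    simp

lemma integral_cos_pow_even (k : ℕ) : ∫ t in (0 : ℝ)..Real.pi, Real.cos t ^ (2 * k) =
    Real.pi * ((2 * k).factorial / ((k.factorial : ℝ) ^ 2 * 4 ^ k)) := by
  induction k with
  | zero => simp
  | succ k ih =>
    rw [show 2 * (k + 1) = (2 * k) + 2 by ring, integral_cos_pow, ih]
    simp only [Nat.factorial_succ, Real.sin_pi, Real.sin_zero]
    push_cast
    field_simp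
    ring

lemma hasSum_integral_exp_cos (z : ℝ) (g : ℝ → ℝ) (hg : Continuous g) :
    HasSum (fun n : ℕ => z ^ n / (n.factorial : ℝ) *
        ∫ t in (0 : ℝ)..Real.pi, Real.cos t ^ n * g t)
      (∫ t in (0 : ℝ)..Real.pi, Real.exp (z * Real.cos t) * g t) := by
  have hs : ∀ t : ℝ, HasSum (fun n : ℕ => (z * Real.cos t) ^ n / (n.factorial : ℝ))
      (Real.exp (z * Real.cos t)) := fun t => by
    rw [Real.exp_eq_exp_ℝ]
    exact NormedSpace.expSeries_div_hasSum_exp (z * Real.cos t)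
  have := intervalIntegral.hasSum_integral_of_dominated_convergence (μ := volume)
    (a := 0) (b := Real.pi) (F := fun (n : ℕ) t => (z * Real.cos t) ^ n / (n.factorial : ℝ) * g t)
    (f := fun t => Real.exp (z * Real.cos t) * g t)
    (fun n t => |z| ^ n / (n.factorial : ℝ) * |g t|)
    (fun n => Continuous.aestronglyMeasurable (by fun_prop))
    (fun n => Eventually.of_forall fun t _ => by
      rw [Real.norm_eq_abs, abs_mul, abs_div, abs_pow, abs_mul, Nat.abs_cast]
      gcongr
      exact mul_le_of_le_one_right (abs_nonneg _) (Real.abs_cos_le_one t))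
    (Eventually.of_forall fun t _ => (Real.summable_pow_div_factorial |z|).mul_right _)
    (by
      simp only [tsum_mul_right]
      exact Continuous.intervalIntegrable (by fun_prop) _ _)
    (Eventually.of_forall fun t _ => (hs t).mul_right _)
  convert! this using 2 with n
  rw [← intervalIntegral.integral_const_mul]
  congr 1
  ext t
  rw [mul_pow]
  ring

lemma besselI_zero_add_besselI_one (z : ℝ) :
    besselI 0 z + besselI 1 z =
      Real.pi⁻¹ * ∫ t in (0 : ℝ)..Real.pi, Real.exp (z * Real.cos t) * (1 + Real.cos t) := by
  have hpi := Real.pi_ne_zero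
  have h0 := hasSum_integral_exp_cos z (fun _ => 1) continuous_const
  have h1 := hasSum_integral_exp_cos z Real.cos Real.continuous_cos
  simp only [mul_one, ← pow_succ] at h0 h1
  have inj0 : Function.Injective fun k : ℕ => 2 * k := fun a b h => by simpa using h
  have inj1 : Function.Injective fun k : ℕ => 2 * k + 1 := fun a b h => by simpa using h
  rw [← inj0.hasSum_iff] at h0
  · rw [← inj1.hasSum_iff] at h1
    · have e0 : besselI 0 z = Real.pi⁻¹ * ∫ t in (0 : ℝ)..Real.pi, Real.exp (z * Real.cos t) := by
        rw [← h0.tsum_eq, ← tsum_mul_left, besselI]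
        refine tsum_congr fun k => ?_
        have e : (z / 2) ^ (2 * k) = z ^ (2 * k) / 4 ^ k := by
          rw [div_pow, pow_mul 2]; norm_num
        simp only [Function.comp, integral_cos_pow_even, add_zero, e]
        field_simp
      have e1 : besselI 1 z =
          Real.pi⁻¹ * ∫ t in (0 : ℝ)..Real.pi, Real.exp (z * Real.cos t) * Real.cos t := by
        rw [← h1.tsum_eq, ← tsum_mul_left, besselI]
        refine tsum_congr fun k => ?_
        have e : (z / 2) ^ (2 * k + 1) = z ^ (2 * k + 1) / (2 * 4 ^ k) := by
          rw [div_pow, pow_succ 2, pow_mul 2]; norm_num [mul_comm]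
        simp only [Function.comp, e]
        rw [show 2 * k + 1 + 1 = 2 * (k + 1) by ring, integral_cos_pow_even]
        rw [show 2 * (k + 1) = 2 * k + 1 + 1 by ring]
        simp only [Nat.factorial_succ, pow_succ (4 : ℝ)]
        push_cast
        field_simp
        ring
      rw [e0, e1, ← mul_add, ← intervalIntegral.integral_add]
      · congr 2; ext t; ring
      all_goals exact Continuous.intervalIntegrable (by fun_prop) _ _
    · intro n hn
      rcases Nat.even_or_odd' n with ⟨k, rfl | rfl⟩
      · simp [integral_cos_pow_odd]
      · exact absurd ⟨k, rfl⟩ hn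
  · intro n hn
    rcases Nat.even_or_odd' n with ⟨k, rfl | rfl⟩
    · exact absurd ⟨k, rfl⟩ hn
    · simp [integral_cos_pow_odd]

lemma abs_exp_neg_sub_le {y : ℝ} (hy : 0 ≤ y) : |Real.exp (-y) - (1 - y)| ≤ y ^ 2 := by
  have h1 : 1 - y ≤ Real.exp (-y) := by linarith [Real.add_one_le_exp (-y)]
  have h2 : Real.exp (-y) ≤ (1 + y)⁻¹ := by
    rw [Real.exp_neg]
    exact inv_anti₀ (by linarith) (by linarith [Real.add_one_le_exp y])
  have h3 : (1 + y)⁻¹ ≤ 1 - y + y ^ 2 := by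
    rw [inv_le_iff_one_le_mul₀ (by linarith)]
    nlinarith [pow_nonneg hy 3]
  rw [abs_le]
  constructor <;> nlinarith

lemma abs_pow_sub_pow_le {a b : ℝ} (ha : 0 ≤ a) (ha1 : a ≤ 1) (hb : 0 ≤ b) (hb1 : b ≤ 1) (n : ℕ) :
    |a ^ n - b ^ n| ≤ n * |a - b| := by
  induction n with
  | zero => simp
  | succ n ih =>
    have : a ^ (n + 1) - b ^ (n + 1) = a * (a ^ n - b ^ n) + b ^ n * (a - b) := by ring
    rw [this]
    refine (abs_add_le _ _).trans ?_
    rw [abs_mul, abs_mul, abs_of_nonneg ha, abs_of_nonneg (pow_nonneg hb n)]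
    push_cast
    have h1 : a * |a ^ n - b ^ n| ≤ |a ^ n - b ^ n| := mul_le_of_le_one_left (abs_nonneg _) ha1
    have h2 : b ^ n * |a - b| ≤ |a - b| :=
      mul_le_of_le_one_left (abs_nonneg _) (pow_le_one₀ hb hb1)
    linarith

lemma one_sub_mul_one_sub_cos_mem {p : ℝ} (hp : p ∈ Set.Icc (0 : ℝ) 1) (t : ℝ) :
    1 - 2 * p * (1 - p) * (1 - Real.cos t) ∈ Set.Icc (0 : ℝ) 1 := by
  have h1 := Real.neg_one_le_cos t
  have h2 := Real.cos_le_one t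
  have h3 : 0 ≤ p * (1 - p) := mul_nonneg hp.1 (by linarith [hp.2])
  have h4 : p * (1 - p) ≤ 1 / 4 := by nlinarith [sq_nonneg (p - 1 / 2)]
  constructor <;> nlinarith

lemma abs_binomial_char_sub_le {lam : ℝ} {m : ℕ} (hl : 0 ≤ lam) (hm : 1 ≤ m) (hlm : lam ≤ m)
    (t : ℝ) :
    |(1 - 2 * (lam / m) * (1 - lam / m) * (1 - Real.cos t)) ^ (m - 1) -
      Real.exp (-(2 * lam * (1 - Real.cos t)))| ≤ (20 * lam ^ 2 + 4 * lam) * (m : ℝ)⁻¹ := by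
  have hm0 : (0 : ℝ) < m := by exact_mod_cast hm
  have hp : lam / m ∈ Set.Icc (0 : ℝ) 1 := ⟨by positivity, by rw [div_le_one hm0]; exact hlm⟩
  obtain ⟨ha0, ha1⟩ := one_sub_mul_one_sub_cos_mem hp t
  set c := 1 - Real.cos t with hc
  have hc0 : 0 ≤ c := by linarith [Real.cos_le_one t]
  have hc2 : c ≤ 2 := by linarith [Real.neg_one_le_cos t]
  set a := 1 - 2 * (lam / m) * (1 - lam / m) * c with ha
  set y := 2 * (lam / m) * c with hy
  have hy0 : 0 ≤ y := by positivity
  set b := Real.exp (-y) with hb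
  have hb0 : 0 ≤ b := (Real.exp_pos _).le
  have hb1 : b ≤ 1 := Real.exp_le_one_iff.2 (by linarith)
  have hbm : b ^ m = Real.exp (-(2 * lam * c)) := by
    rw [hb, ← Real.exp_nat_mul]; congr 1; rw [hy]; field_simp
  have h1 : |a - b| ≤ 20 * (lam / m) ^ 2 := by
    have e1 := abs_exp_neg_sub_le hy0
    have e2 : a - (1 - y) = 2 * (lam / m) ^ 2 * c := by rw [ha, hy]; ring
    have e3 : |a - (1 - y)| ≤ 4 * (lam / m) ^ 2 := by
      rw [e2, abs_of_nonneg (by positivity)]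
      nlinarith [sq_nonneg (lam / m)]
    have e4 : y ^ 2 ≤ 16 * (lam / m) ^ 2 := by
      have : y ≤ 4 * (lam / m) := by rw [hy]; nlinarith [hp.1]
      nlinarith
    have : a - b = (a - (1 - y)) - (b - (1 - y)) := by ring
    rw [this]
    refine (abs_sub _ _).trans ?_
    linarith
  have h2 := abs_pow_sub_pow_le ha0 ha1 hb0 hb1 (m - 1)
  have h3 : |b ^ (m - 1) - b ^ m| ≤ 4 * (lam / m) := by
    have e : b ^ m = b ^ (m - 1) * b := by rw [← pow_succ, Nat.sub_add_cancel hm]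
    have e1 : 1 - b ≤ y := by linarith [Real.add_one_le_exp (-y)]
    have e2 : y ≤ 4 * (lam / m) := by rw [hy]; nlinarith [hp.1]
    have e3 : b ^ (m - 1) ≤ 1 := pow_le_one₀ hb0 hb1
    have e4 : 0 ≤ b ^ (m - 1) := pow_nonneg hb0 _
    rw [e, abs_of_nonneg (by nlinarith)]
    nlinarith
  have h4 : ((m - 1 : ℕ) : ℝ) * |a - b| ≤ m * (20 * (lam / m) ^ 2) := by
    gcongr
    omega
  rw [← hbm]
  have h5 : a ^ (m - 1) - b ^ m = (a ^ (m - 1) - b ^ (m - 1)) + (b ^ (m - 1) - b ^ m) := by ring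
  rw [h5]
  refine (abs_add_le _ _).trans ?_
  have h6 : m * (20 * (lam / m) ^ 2) + 4 * (lam / m) = (20 * lam ^ 2 + 4 * lam) * (m : ℝ)⁻¹ := by
    field_simp
  linarith

lemma mexp_mexp_abs_sub_bessel {lam : ℝ} (hl : 0 ≤ lam) :
    ∃ C : ℝ, ∀ (m : ℕ) (x : Fin d → ℝ) (i : Fin d), 1 ≤ m → x ∈ simplex d → x i = lam / m →
      |mexp x m (fun k => mexp x m fun l => |(k i : ℝ) - l i|) -
        2 * (lam * (Real.exp (-2 * lam) * (besselI 0 (2 * lam) + besselI 1 (2 * lam))))| ≤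
        C * (m : ℝ)⁻¹ := by
  refine ⟨4 * lam * (20 * lam ^ 2 + 4 * lam) + 4 * lam ^ 2, fun m x i hm hx hxi => ?_⟩
  have hm0 : (0 : ℝ) < m := by exact_mod_cast hm
  have hp := hx.1 i
  rw [hxi] at hp
  have hlm : lam ≤ m := by rw [← div_le_one hm0]; exact hp.2
  rw [mexp_mexp_abs_sub (nonneg_of_mem_simplex hx), besselI_zero_add_besselI_one, hxi]
  set A := ∫ t in (0 : ℝ)..Real.pi,
    (1 - 2 * (lam / m) * (1 - lam / m) * (1 - Real.cos t)) ^ (m - 1) * (1 + Real.cos t) with hA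
  have hB : Real.exp (-2 * lam) * (Real.pi⁻¹ *
      ∫ t in (0 : ℝ)..Real.pi, Real.exp (2 * lam * Real.cos t) * (1 + Real.cos t)) =
      Real.pi⁻¹ * ∫ t in (0 : ℝ)..Real.pi,
        Real.exp (-(2 * lam * (1 - Real.cos t))) * (1 + Real.cos t) := by
    rw [mul_left_comm, ← intervalIntegral.integral_const_mul]
    congr 2
    ext t
    rw [← mul_assoc, ← Real.exp_add]
    ring_nf
  rw [hB]
  set B := ∫ t in (0 : ℝ)..Real.pi,
        Real.exp (-(2 * lam * (1 - Real.cos t))) * (1 + Real.cos t) with hBdef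
  set c := (20 * lam ^ 2 + 4 * lam) * (m : ℝ)⁻¹ with hc
  have hc0 : 0 ≤ c := by positivity
  have hpi := Real.pi_pos
  have hAB : |A - B| ≤ 2 * c * Real.pi := by
    rw [hA, hBdef, ← intervalIntegral.integral_sub]
    · have := intervalIntegral.norm_integral_le_of_norm_le_const (a := 0) (b := Real.pi)
        (C := 2 * c) (f := fun t => (1 - 2 * (lam / m) * (1 - lam / m) * (1 - Real.cos t)) ^ (m - 1)
          * (1 + Real.cos t) - Real.exp (-(2 * lam * (1 - Real.cos t))) * (1 + Real.cos t))
        fun t _ => by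
          rw [← sub_mul, Real.norm_eq_abs, abs_mul, mul_comm 2 c]
          refine mul_le_mul (abs_binomial_char_sub_le hl hm hlm t) ?_ (abs_nonneg _) hc0
          rw [abs_le]
          constructor <;> linarith [Real.cos_le_one t, Real.neg_one_le_cos t]
      simpa [abs_of_pos hpi] using this
    all_goals exact Continuous.intervalIntegrable (by fun_prop) _ _
  have hBbd : |B| ≤ 2 * Real.pi := by
    have := intervalIntegral.norm_integral_le_of_norm_le_const (a := 0) (b := Real.pi)
        (C := 2) (f := fun t => Real.exp (-(2 * lam * (1 - Real.cos t))) * (1 + Real.cos t))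
        fun t _ => by
          rw [Real.norm_eq_abs, abs_mul, abs_of_pos (Real.exp_pos _), ← one_mul (2 : ℝ)]
          have h1 := Real.cos_le_one t
          refine mul_le_mul (Real.exp_le_one_iff.2 ?_) ?_ (abs_nonneg _) zero_le_one
          · nlinarith
          · rw [abs_le]
            constructor <;> linarith [Real.cos_le_one t, Real.neg_one_le_cos t]
    simpa [abs_of_pos hpi] using this
  have hsplit : Real.pi⁻¹ * (m * (2 * (lam / m) * (1 - lam / m)) * A) - 2 * (lam * (Real.pi⁻¹ * B))
      = Real.pi⁻¹ * (2 * lam * (1 - lam / m) * (A - B) - 2 * lam * (lam / m) * B) := by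
    field_simp
    ring
  rw [hsplit, abs_mul, abs_of_pos (inv_pos.2 hpi)]
  have h1 : |2 * lam * (1 - lam / m) * (A - B)| ≤ 2 * lam * (2 * c * Real.pi) := by
    rw [abs_mul]
    refine mul_le_mul ?_ hAB (abs_nonneg _) (by positivity)
    rw [abs_of_nonneg (mul_nonneg (by positivity) (by linarith [hp.2]))]
    nlinarith [hp.1]
  have h2 : |2 * lam * (lam / m) * B| ≤ 2 * lam * (lam / m) * (2 * Real.pi) := by
    rw [abs_mul, abs_of_nonneg (a := 2 * lam * (lam / m)) (by positivity)]
    gcongr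
  calc Real.pi⁻¹ * |2 * lam * (1 - lam / m) * (A - B) - 2 * lam * (lam / m) * B|
      ≤ Real.pi⁻¹ * (2 * lam * (2 * c * Real.pi) + 2 * lam * (lam / m) * (2 * Real.pi)) := by
        gcongr
        exact (abs_sub _ _).trans (add_le_add h1 h2)
    _ = _ := by rw [hc]; field_simp; ring

/-! ### The Gaussian limit -/

lemma tendsto_binomial_char_pow (q u : ℝ) :
    Tendsto (fun m : ℕ => (1 - q * (1 - Real.cos (u / √(m : ℝ)))) ^ (m - 1)) atTop
      (nhds (Real.exp (-(q / 2) * u ^ 2))) := by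
  have hsq : Tendsto (fun m : ℕ => u / √(m : ℝ)) atTop (nhds 0) :=
    Tendsto.const_div_atTop (Real.tendsto_sqrt_atTop.comp tendsto_natCast_atTop_atTop) u
  have hcos : Tendsto (fun t : ℝ => Real.sinc (t / 2) ^ 2 / 2) (nhds 0) (nhds (1 / 2)) := by
    have : Continuous fun t : ℝ => Real.sinc (t / 2) ^ 2 / 2 :=
      ((Real.continuous_sinc.comp (continuous_id.div_const 2)).pow 2).div_const 2
    simpa using this.tendsto 0
  have hid (t : ℝ) : 1 - Real.cos t = t ^ 2 * (Real.sinc (t / 2) ^ 2 / 2) := by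
    rcases eq_or_ne t 0 with rfl | ht
    · simp
    · rw [Real.sinc_of_ne_zero (by simpa using ht)]
      have : Real.cos t = 1 - 2 * Real.sin (t / 2) ^ 2 := by
        conv_lhs => rw [show t = 2 * (t / 2) by ring, Real.cos_two_mul]
        linear_combination 2 * Real.sin_sq_add_cos_sq (t / 2)
      rw [this]
      field_simp
      ring
  have hlim : Tendsto (fun m : ℕ => (m : ℝ) * (-(q * (1 - Real.cos (u / √(m : ℝ)))))) atTop
      (nhds (-(q / 2) * u ^ 2)) := by
    have h1 := ((hcos.comp hsq).const_mul (-(q * u ^ 2)))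
    rw [show -(q * u ^ 2) * (1 / 2) = -(q / 2) * u ^ 2 by ring] at h1
    refine h1.congr' ?_
    filter_upwards [eventually_gt_atTop 0] with m hm
    have hm0 : (0 : ℝ) < m := by exact_mod_cast hm
    simp only [Function.comp]
    rw [hid, div_pow, Real.sq_sqrt hm0.le]
    field_simp
  have hpow := Real.tendsto_one_add_pow_exp_of_tendsto hlim
  have hbase : Tendsto (fun m : ℕ => 1 + -(q * (1 - Real.cos (u / √(m : ℝ))))) atTop (nhds 1) := by
    have : Continuous fun t : ℝ => 1 + -(q * (1 - Real.cos t)) := by fun_prop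
    simpa [Function.comp_def] using (this.tendsto 0).comp hsq
  have := hpow.div hbase one_ne_zero
  rw [div_one] at this
  refine this.congr' ?_
  filter_upwards [hbase.eventually_ne one_ne_zero, eventually_gt_atTop 0] with m hm hm0
  rw [Pi.div_apply, ← sub_eq_add_neg] at *
  rw [div_eq_iff hm, ← pow_succ, Nat.sub_add_cancel hm0]

lemma tendsto_sqrt_mul_integral {p : ℝ} (hp : p ∈ Set.Ioo (0 : ℝ) 1) :
    Tendsto (fun m : ℕ => √(m : ℝ) * ∫ t in (0 : ℝ)..Real.pi,
        (1 - 2 * p * (1 - p) * (1 - Real.cos t)) ^ (m - 1) * (1 + Real.cos t)) atTop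
      (nhds (√(Real.pi / (p * (1 - p))))) := by
  have hp' : p ∈ Set.Icc (0 : ℝ) 1 := ⟨hp.1.le, hp.2.le⟩
  set q := 2 * p * (1 - p) with hq
  have hq0 : 0 < q := mul_pos (by linarith [hp.1]) (by linarith [hp.2])
  have hpi := Real.pi_pos
  set f : ℕ → ℝ → ℝ := fun m u => (Set.Ioc 0 (√(m : ℝ) * Real.pi)).indicator
    (fun u => (1 - q * (1 - Real.cos (u / √(m : ℝ)))) ^ (m - 1) * (1 + Real.cos (u / √(m : ℝ)))) u
    with hf
  have hchange : ∀ᶠ m : ℕ in atTop, ∫ u in Set.Ioi (0 : ℝ), f m u =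
      √(m : ℝ) * ∫ t in (0 : ℝ)..Real.pi, (1 - q * (1 - Real.cos t)) ^ (m - 1) * (1 + Real.cos t) := by
    filter_upwards [eventually_gt_atTop 0] with m hm
    have hs : 0 < √(m : ℝ) := Real.sqrt_pos.2 (by exact_mod_cast hm)
    have h := intervalIntegral.integral_comp_div (a := 0) (b := √(m : ℝ) * Real.pi)
      (fun t => (1 - q * (1 - Real.cos t)) ^ (m - 1) * (1 + Real.cos t)) hs.ne'
    rw [zero_div, mul_div_cancel_left₀ _ hs.ne', smul_eq_mul] at h
    rw [← h, intervalIntegral.integral_of_le (by positivity), hf]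
    simp only
    rw [integral_indicator measurableSet_Ioc, Measure.restrict_restrict measurableSet_Ioc,
      Set.inter_eq_left.2 Set.Ioc_subset_Ioi_self]
  refine Tendsto.congr' hchange ?_
  have hval : ∫ u in Set.Ioi (0 : ℝ), Real.exp (-(q / 2) * u ^ 2) * 2 =
      √(Real.pi / (p * (1 - p))) := by
    rw [integral_mul_const, integral_gaussian_Ioi, div_mul_cancel₀ _ two_ne_zero]
    congr 2
    rw [hq]; ring
  rw [← hval]
  refine tendsto_integral_filter_of_dominated_convergence
    (fun u => Real.exp (-(q / Real.pi ^ 2) * u ^ 2) * 2) ?_ ?_ ?_ ?_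
  · refine Eventually.of_forall fun m => Measurable.aestronglyMeasurable ?_
    exact Measurable.indicator (Continuous.measurable (by fun_prop)) measurableSet_Ioc
  · filter_upwards [eventually_ge_atTop 2] with m hm
    refine Eventually.of_forall fun u => ?_
    have hm0 : (2 : ℝ) ≤ m := by exact_mod_cast hm
    have hs : 0 < √(m : ℝ) := Real.sqrt_pos.2 (by linarith)
    by_cases hu : u ∈ Set.Ioc 0 (√(m : ℝ) * Real.pi)
    · simp only [hf, Set.indicator_of_mem hu]
      set t := u / √(m : ℝ) with ht
      have ht0 : 0 ≤ t := div_nonneg hu.1.le hs.le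
      have htpi : t ≤ Real.pi := by rw [ht, div_le_iff₀ hs, mul_comm]; exact hu.2
      obtain ⟨ha0, ha1⟩ := one_sub_mul_one_sub_cos_mem hp' t
      have hcos := Real.cos_le_one_sub_mul_cos_sq (x := t) (by rwa [abs_of_nonneg ht0])
      have hc1 := Real.neg_one_le_cos t
      have hc2 := Real.cos_le_one t
      have hexp : 1 - q * (1 - Real.cos t) ≤ Real.exp (-(q * (2 / Real.pi ^ 2 * t ^ 2))) := by
        have := Real.add_one_le_exp (-(q * (2 / Real.pi ^ 2 * t ^ 2)))
        nlinarith
      rw [Real.norm_eq_abs, abs_mul, abs_of_nonneg (pow_nonneg ha0 _),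
        abs_of_nonneg (by linarith)]
      refine mul_le_mul ?_ (by linarith) (by linarith) (Real.exp_pos _).le
      refine (pow_le_pow_left₀ ha0 hexp _).trans ?_
      rw [← Real.exp_nat_mul, Real.exp_le_exp]
      have hu2 : u ^ 2 = m * t ^ 2 := by
        rw [ht, div_pow, Real.sq_sqrt (by linarith)]; field_simp
      rw [hu2, Nat.cast_sub (by omega)]
      have : 0 ≤ q / Real.pi ^ 2 * t ^ 2 := by positivity
      have e1 : ((m : ℝ) - (1 : ℕ)) * -(q * (2 / Real.pi ^ 2 * t ^ 2)) =
        -(2 * (m - 1)) * (q / Real.pi ^ 2 * t ^ 2) := by push_cast; ring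
      have e2 : -(q / Real.pi ^ 2) * (m * t ^ 2) = -m * (q / Real.pi ^ 2 * t ^ 2) := by ring
      rw [e1, e2]
      exact mul_le_mul_of_nonneg_right (by linarith) this
    · simp only [hf, Set.indicator_of_notMem hu, norm_zero]
      positivity
  · exact ((integrable_exp_neg_mul_sq (by positivity)).mul_const 2).integrableOn
  · rw [ae_restrict_iff' measurableSet_Ioi]
    refine Eventually.of_forall fun u hu => ?_
    have hsq : Tendsto (fun m : ℕ => √(m : ℝ)) atTop atTop :=
      Real.tendsto_sqrt_atTop.comp tendsto_natCast_atTop_atTop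
    have hcos : Tendsto (fun m : ℕ => 1 + Real.cos (u / √(m : ℝ))) atTop (nhds 2) := by
      have : Continuous fun t : ℝ => 1 + Real.cos t := by fun_prop
      have h2 : (2 : ℝ) = 1 + Real.cos 0 := by rw [Real.cos_zero]; norm_num
      rw [h2]
      exact (this.tendsto 0).comp (hsq.const_div_atTop u)
    refine ((tendsto_binomial_char_pow q u).mul hcos).congr' ?_
    filter_upwards [hsq.eventually_ge_atTop (u / Real.pi)] with m hm
    rw [div_le_iff₀ hpi] at hm
    simp only [hf]
    rw [Set.indicator_of_mem (show u ∈ Set.Ioc 0 (√(m : ℝ) * Real.pi) from ⟨hu, hm⟩)]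

/-- The mean distance of two independent binomial variables is of order `√m`. -/
lemma tendsto_mexp_mexp_abs_sub {x : Fin d → ℝ} (hx : ∀ i, 0 ≤ x i) {i : Fin d}
    (hi : x i ∈ Set.Ioo (0 : ℝ) 1) :
    Tendsto (fun m : ℕ => mexp x m (fun k => mexp x m fun l => |(k i : ℝ) - l i|) / √(m : ℝ)) atTop
      (nhds (2 * √(Real.pi⁻¹ * (x i * (1 - x i))))) := by
  have h := (tendsto_sqrt_mul_integral hi).const_mul (Real.pi⁻¹ * (2 * x i * (1 - x i)))
  have hpos : 0 < x i * (1 - x i) := mul_pos hi.1 (by linarith [hi.2])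
  have e : Real.pi⁻¹ * (2 * x i * (1 - x i)) * √(Real.pi / (x i * (1 - x i))) =
      2 * √(Real.pi⁻¹ * (x i * (1 - x i))) := by
    have hpi := Real.pi_pos
    have : Real.pi⁻¹ * (x i * (1 - x i)) = (Real.pi⁻¹ * (x i * (1 - x i))) ^ 2 *
        (Real.pi / (x i * (1 - x i))) := by field_simp
    rw [this, Real.sqrt_mul (by positivity), Real.sqrt_sq (by positivity)]
    ring
  rw [e] at h
  refine h.congr' ?_
  filter_upwards [eventually_gt_atTop 0] with m hm
  have hs : 0 < √(m : ℝ) := Real.sqrt_pos.2 (by exact_mod_cast hm)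
  have hmm : (m : ℝ) = √(m : ℝ) * √(m : ℝ) := (Real.mul_self_sqrt (by positivity)).symm
  rw [mexp_mexp_abs_sub hx, eq_div_iff hs.ne']
  set I := ∫ t in (0 : ℝ)..Real.pi,
    (1 - 2 * x i * (1 - x i) * (1 - Real.cos t)) ^ (m - 1) * (1 + Real.cos t)
  linear_combination (-(Real.pi⁻¹ * (2 * x i * (1 - x i)) * I)) * hmm

/-! ### Calculus on the simplex -/

lemma mem_simplex {x : Fin d → ℝ} : x ∈ simplex d ↔ (∀ i, 0 ≤ x i) ∧ ∑ i, x i ≤ 1 := by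
  constructor
  · intro h
    refine ⟨fun i => (h.1 i).1, ?_⟩
    simpa [abs_of_nonneg (h.1 _).1] using h.2
  · rintro ⟨h1, h2⟩
    refine ⟨fun i => ⟨h1 i, ?_⟩, by simpa [abs_of_nonneg (h1 _)] using h2⟩
    exact (Finset.single_le_sum (fun j _ => h1 j) (Finset.mem_univ i)).trans h2

lemma convex_simplex : Convex ℝ (simplex d) := by
  intro x hx y hy a b ha hb hab
  rw [mem_simplex] at *
  refine ⟨fun i => ?_, ?_⟩
  · have := hx.1 i
    have := hy.1 i
    simp only [Pi.add_apply, Pi.smul_apply, smul_eq_mul]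
    positivity
  · simp only [Pi.add_apply, Pi.smul_apply, smul_eq_mul, Finset.sum_add_distrib, ← Finset.mul_sum]
    nlinarith [hx.2, hy.2]

lemma isCompact_simplex : IsCompact (simplex d) := by
  have hcl : IsClosed {x : Fin d → ℝ | ∑ i, |x i| ≤ 1} :=
    isClosed_le (by fun_prop) continuous_const
  have : simplex d = (Set.univ.pi fun _ => Set.Icc (0 : ℝ) 1) ∩ {x | ∑ i, |x i| ≤ 1} := by
    ext x
    simp only [simplex, Set.mem_inter_iff, Set.mem_univ_pi, Set.mem_ofPred_eq]
  rw [this]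
  exact (isCompact_univ_pi fun _ => isCompact_Icc).inter_right hcl

lemma interior_simplex_nonempty : (interior (simplex d)).Nonempty := by
  refine ⟨fun _ => 1 / (d + 1), mem_interior.2
    ⟨{x | (∀ i, 0 < x i) ∧ ∑ i, x i < 1}, ?_, ?_, ?_, ?_⟩⟩
  · rintro x ⟨h1, h2⟩
    exact mem_simplex.2 ⟨fun i => (h1 i).le, h2.le⟩
  · have h1 : IsOpen {x : Fin d → ℝ | ∀ i, 0 < x i} := by
      simp only [Set.ofPred_forall]
      exact isOpen_iInter_of_finite fun i => isOpen_lt continuous_const (continuous_apply i)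
    have h2 : IsOpen {x : Fin d → ℝ | ∑ i, x i < 1} := isOpen_lt (by fun_prop) continuous_const
    exact h1.inter h2
  · intro i; positivity
  · simp only [Finset.sum_const, Finset.card_univ, Fintype.card_fin, nsmul_eq_mul]
    rw [mul_one_div, div_lt_one (by positivity)]
    linarith

lemma uniqueDiffOn_simplex : UniqueDiffOn ℝ (simplex d) :=
  uniqueDiffOn_convex convex_simplex interior_simplex_nonempty

lemma ContDiffOn.pderiv {n : ℕ} {G : (Fin d → ℝ) → ℝ} (hG : ContDiffOn ℝ (n + 1) G (simplex d))
    (i : Fin d) : ContDiffOn ℝ n (BernsteinSimplex.pderiv i G) (simplex d) :=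
  (hG.fderivWithin uniqueDiffOn_simplex le_rfl).clm_apply contDiffOn_const

lemma exists_bound_on_simplex {G : (Fin d → ℝ) → ℝ} (hG : ContinuousOn G (simplex d)) :
    ∃ C : ℝ, 0 ≤ C ∧ ∀ x ∈ simplex d, |G x| ≤ C := by
  obtain ⟨C, hC⟩ := isCompact_simplex.exists_bound_of_continuousOn hG
  exact ⟨max C 0, le_max_right _ _, fun x hx => (hC x hx).trans (le_max_left _ _)⟩

/-- The point at time `t` on the segment from `x` to `z`. -/
def segPoint (x z : Fin d → ℝ) (t : ℝ) : Fin d → ℝ := x + t • (z - x)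

lemma segPoint_zero (x z : Fin d → ℝ) : segPoint x z 0 = x := by simp [segPoint]

lemma segPoint_one (x z : Fin d → ℝ) : segPoint x z 1 = z := by simp [segPoint]

lemma segPoint_mem {x z : Fin d → ℝ} (hx : x ∈ simplex d) (hz : z ∈ simplex d) {t : ℝ}
    (ht : t ∈ Set.Icc (0 : ℝ) 1) : segPoint x z t ∈ simplex d :=
  convex_simplex.add_smul_sub_mem hx hz ht

lemma hasDerivWithinAt_segment {G : (Fin d → ℝ) → ℝ} (hG : DifferentiableOn ℝ G (simplex d))
    {x z : Fin d → ℝ} (hx : x ∈ simplex d) (hz : z ∈ simplex d) {t : ℝ}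
    (ht : t ∈ Set.Icc (0 : ℝ) 1) :
    HasDerivWithinAt (fun t => G (segPoint x z t))
      (∑ i, (z i - x i) * pderiv i G (segPoint x z t)) (Set.Icc 0 1) t := by
  have h1 := (hG _ (segPoint_mem hx hz ht)).hasFDerivWithinAt
  have h2 : HasDerivWithinAt (segPoint x z) (z - x) (Set.Icc 0 1) t := by
    have := ((hasDerivAt_id t).smul_const (z - x)).const_add x
    convert! this.hasDerivWithinAt using 1
    simp
  have h3 := h1.comp_hasDerivWithinAt t h2 (fun s hs => segPoint_mem hx hz hs)
  convert! h3 using 1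
  have : z - x = ∑ i, (z i - x i) • (Pi.single i (1 : ℝ) : Fin d → ℝ) := by
    ext j
    simp [Finset.sum_apply, Pi.single_apply]
  conv_rhs => rw [this, map_sum]
  simp [pderiv]

/-- The `ℓ¹` distance. -/
def dist1 (x z : Fin d → ℝ) : ℝ := ∑ i, |z i - x i|

lemma dist1_nonneg (x z : Fin d → ℝ) : 0 ≤ dist1 x z := Finset.sum_nonneg fun _ _ => abs_nonneg _

lemma abs_sum_mul_le {x z : Fin d → ℝ} {a : Fin d → ℝ} {C : ℝ} (h : ∀ i, |a i| ≤ C) :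
    |∑ i, (z i - x i) * a i| ≤ C * dist1 x z := by
  refine (Finset.abs_sum_le_sum_abs _ _).trans ?_
  rw [dist1, Finset.mul_sum]
  refine Finset.sum_le_sum fun i _ => ?_
  rw [abs_mul, mul_comm]
  exact mul_le_mul_of_nonneg_right (h i) (abs_nonneg _)

lemma abs_sub_zero_le_of_deriv {f f' : ℝ → ℝ} {C : ℝ}
    (hf : ∀ t ∈ Set.Icc (0 : ℝ) 1, HasDerivWithinAt f (f' t) (Set.Icc 0 1) t)
    (hC : ∀ t ∈ Set.Icc (0 : ℝ) 1, |f' t| ≤ C) {t : ℝ} (ht : t ∈ Set.Icc (0 : ℝ) 1) :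
    |f t - f 0| ≤ C := by
  have h := Convex.norm_image_sub_le_of_norm_hasDerivWithin_le hf hC (convex_Icc 0 1)
    (Set.left_mem_Icc.2 zero_le_one) ht
  have hC0 : 0 ≤ C := (abs_nonneg _).trans (hC t ht)
  refine h.trans (mul_le_of_le_one_right hC0 ?_)
  rw [sub_zero, Real.norm_eq_abs, abs_of_nonneg ht.1]
  exact ht.2

/-- The first-order Taylor polynomial minus its constant term. -/
def taylorOne (G : (Fin d → ℝ) → ℝ) (x z : Fin d → ℝ) : ℝ := ∑ i, (z i - x i) * pderiv i G x

/-- Twice the second-order term of the Taylor polynomial. -/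
def taylorTwo (G : (Fin d → ℝ) → ℝ) (x z : Fin d → ℝ) : ℝ :=
  ∑ i, (z i - x i) * taylorOne (pderiv i G) x z

/-- Six times the third-order term of the Taylor polynomial. -/
def taylorThree (G : (Fin d → ℝ) → ℝ) (x z : Fin d → ℝ) : ℝ :=
  ∑ i, (z i - x i) * taylorTwo (pderiv i G) x z

lemma exists_lipschitz {G : (Fin d → ℝ) → ℝ} (hG : ContDiffOn ℝ (1 : ℕ) G (simplex d)) :
    ∃ C : ℝ, 0 ≤ C ∧ ∀ x ∈ simplex d, ∀ z ∈ simplex d, |G z - G x| ≤ C * dist1 x z := by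
  have hd (i : Fin d) : ContDiffOn ℝ (0 : ℕ) (pderiv i G) (simplex d) := ContDiffOn.pderiv hG i
  choose C hC0 hC using fun i => exists_bound_on_simplex (hd i).continuousOn
  refine ⟨∑ i, C i, Finset.sum_nonneg fun i _ => hC0 i, fun x hx z hz => ?_⟩
  have := abs_sub_zero_le_of_deriv (f := fun t => G (segPoint x z t))
    (fun t ht => hasDerivWithinAt_segment (hG.differentiableOn (by simp)) hx hz ht)
    (fun t ht => abs_sum_mul_le fun i => (hC i _ (segPoint_mem hx hz ht)).trans
      (Finset.single_le_sum (f := C) (fun j _ => hC0 j) (Finset.mem_univ i)))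
    (Set.right_mem_Icc.2 zero_le_one)
  simpa [segPoint_zero, segPoint_one] using this

/-- If the partial derivatives along the segment admit a common bound, so does the function. -/
lemma abs_taylor_step {G : (Fin d → ℝ) → ℝ} (hG : DifferentiableOn ℝ G (simplex d))
    {x z : Fin d → ℝ} (hx : x ∈ simplex d) (hz : z ∈ simplex d) (p : Fin d → ℝ → ℝ) (P : ℝ → ℝ)
    (hP : ∀ t, HasDerivAt P (∑ i, (z i - x i) * p i t) t) (hP0 : P 0 = G x) {C : ℝ}
    (h : ∀ i, ∀ t ∈ Set.Icc (0 : ℝ) 1, |pderiv i G (segPoint x z t) - p i t| ≤ C)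
    {t : ℝ} (ht : t ∈ Set.Icc (0 : ℝ) 1) :
    |G (segPoint x z t) - P t| ≤ C * dist1 x z := by
  have := abs_sub_zero_le_of_deriv (f := fun t => G (segPoint x z t) - P t)
    (f' := fun t => ∑ i, (z i - x i) * (pderiv i G (segPoint x z t) - p i t))
    (fun t ht => by
      have := (hasDerivWithinAt_segment hG hx hz ht).sub (hP t).hasDerivWithinAt (s := Set.Icc 0 1)
      convert! this using 1
      simp [mul_sub])
    (fun t ht => abs_sum_mul_le fun i => h i t ht) ht
  simpa [segPoint_zero, hP0] using this

lemma hasDerivAt_taylorPoly (a b c e t : ℝ) :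
    HasDerivAt (fun t : ℝ => a + t * b + t ^ 2 / 2 * c + t ^ 3 / 6 * e)
      (b + t * c + t ^ 2 / 2 * e) t := by
  have h1 := ((hasDerivAt_id t).mul_const b).const_add a
  have h2 := ((hasDerivAt_pow 2 t).div_const 2).mul_const c
  have h3 := ((hasDerivAt_pow 3 t).div_const 6).mul_const e
  convert! (h1.add h2).add h3 using 1
  simp only [Nat.cast_ofNat, Nat.reduceSub, pow_one, one_mul]
  ring

lemma taylor_one_bound {G : (Fin d → ℝ) → ℝ} (hG : DifferentiableOn ℝ G (simplex d))
    {x z : Fin d → ℝ} (hx : x ∈ simplex d) (hz : z ∈ simplex d) {C : ℝ}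
    (h : ∀ i, ∀ t ∈ Set.Icc (0 : ℝ) 1, |pderiv i G (segPoint x z t) - pderiv i G x| ≤ C)
    {t : ℝ} (ht : t ∈ Set.Icc (0 : ℝ) 1) :
    |G (segPoint x z t) - (G x + t * taylorOne G x z)| ≤ C * dist1 x z := by
  refine abs_taylor_step hG hx hz (fun i _ => pderiv i G x) (fun t => G x + t * taylorOne G x z)
    (fun t => ?_) (by simp) h ht
  convert! hasDerivAt_taylorPoly (G x) (taylorOne G x z) 0 0 t using 1
  · ext; ring
  · simp [taylorOne]

lemma taylor_two_bound {G : (Fin d → ℝ) → ℝ} (hG : DifferentiableOn ℝ G (simplex d))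
    (hG' : ∀ i, DifferentiableOn ℝ (pderiv i G) (simplex d))
    {x z : Fin d → ℝ} (hx : x ∈ simplex d) (hz : z ∈ simplex d) {C : ℝ}
    (h : ∀ i j, ∀ t ∈ Set.Icc (0 : ℝ) 1,
      |pderiv j (pderiv i G) (segPoint x z t) - pderiv j (pderiv i G) x| ≤ C)
    {t : ℝ} (ht : t ∈ Set.Icc (0 : ℝ) 1) :
    |G (segPoint x z t) - (G x + t * taylorOne G x z + t ^ 2 / 2 * taylorTwo G x z)| ≤
      C * dist1 x z * dist1 x z := by
  refine abs_taylor_step hG hx hz (fun i t => pderiv i G x + t * taylorOne (pderiv i G) x z)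
    (fun t => G x + t * taylorOne G x z + t ^ 2 / 2 * taylorTwo G x z)
    (fun t => ?_) (by simp) (fun i t ht => taylor_one_bound (hG' i) hx hz (h i) ht) ht
  convert! hasDerivAt_taylorPoly (G x) (taylorOne G x z) (taylorTwo G x z) 0 t using 1
  · ext; ring
  · simp only [mul_add, Finset.sum_add_distrib, mul_left_comm _ t, ← Finset.mul_sum]
    simp [taylorOne, taylorTwo]

lemma taylor_three_bound {G : (Fin d → ℝ) → ℝ} (hG : DifferentiableOn ℝ G (simplex d))
    (hG' : ∀ i, DifferentiableOn ℝ (pderiv i G) (simplex d))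
    (hG'' : ∀ i j, DifferentiableOn ℝ (pderiv j (pderiv i G)) (simplex d))
    {x z : Fin d → ℝ} (hx : x ∈ simplex d) (hz : z ∈ simplex d) {C : ℝ}
    (h : ∀ i j l, ∀ t ∈ Set.Icc (0 : ℝ) 1,
      |pderiv l (pderiv j (pderiv i G)) (segPoint x z t) - pderiv l (pderiv j (pderiv i G)) x| ≤ C)
    {t : ℝ} (ht : t ∈ Set.Icc (0 : ℝ) 1) :
    |G (segPoint x z t) - (G x + t * taylorOne G x z + t ^ 2 / 2 * taylorTwo G x z +
      t ^ 3 / 6 * taylorThree G x z)| ≤ C * dist1 x z * dist1 x z * dist1 x z := by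
  refine abs_taylor_step hG hx hz (fun i t => pderiv i G x + t * taylorOne (pderiv i G) x z +
      t ^ 2 / 2 * taylorTwo (pderiv i G) x z)
    (fun t => G x + t * taylorOne G x z + t ^ 2 / 2 * taylorTwo G x z +
      t ^ 3 / 6 * taylorThree G x z)
    (fun t => ?_) (by simp)
    (fun i t ht => taylor_two_bound (hG' i) (hG'' i) hx hz (h i) ht) ht
  convert! hasDerivAt_taylorPoly (G x) (taylorOne G x z) (taylorTwo G x z) (taylorThree G x z) t
    using 1
  simp only [mul_add, Finset.sum_add_distrib, mul_left_comm _ t, mul_left_comm _ (t ^ 2 / 2),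
    ← Finset.mul_sum]
  simp [taylorOne, taylorTwo, taylorThree]

lemma exists_taylor_two {G : (Fin d → ℝ) → ℝ} (hG : ContDiffOn ℝ (2 : ℕ) G (simplex d)) :
    ∃ C : ℝ, 0 ≤ C ∧ ∀ x ∈ simplex d, ∀ z ∈ simplex d,
      |G z - G x - taylorOne G x z| ≤ C * dist1 x z ^ 2 := by
  have hd (i : Fin d) : ContDiffOn ℝ (1 : ℕ) (pderiv i G) (simplex d) := ContDiffOn.pderiv hG i
  choose C hC0 hC using fun i => exists_lipschitz (hd i)
  refine ⟨∑ i, C i, Finset.sum_nonneg fun i _ => hC0 i, fun x hx z hz => ?_⟩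
  have := taylor_one_bound (hG.differentiableOn (by simp)) hx hz (C := (∑ i, C i) * dist1 x z)
    (fun i t ht => by
      refine (hC i x hx _ (segPoint_mem hx hz ht)).trans ?_
      refine mul_le_mul (Finset.single_le_sum (f := C) (fun j _ => hC0 j) (Finset.mem_univ i))
        ?_ (dist1_nonneg _ _) (Finset.sum_nonneg fun i _ => hC0 i)
      refine Finset.sum_le_sum fun j _ => ?_
      simp only [segPoint, Pi.add_apply, Pi.smul_apply, Pi.sub_apply, smul_eq_mul,
        add_sub_cancel_left, abs_mul, abs_of_nonneg ht.1]
      exact mul_le_of_le_one_left (abs_nonneg _) ht.2)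
    (Set.right_mem_Icc.2 zero_le_one)
  rw [segPoint_one, one_mul] at this
  rw [sub_sub, pow_two, ← mul_assoc]
  exact this

lemma exists_taylor_three {G : (Fin d → ℝ) → ℝ} (hG : ContDiffOn ℝ (3 : ℕ) G (simplex d))
    {ε : ℝ} (hε : 0 < ε) :
    ∃ C : ℝ, 0 ≤ C ∧ ∀ x ∈ simplex d, ∀ z ∈ simplex d,
      |G z - G x - taylorOne G x z - taylorTwo G x z / 2 - taylorThree G x z / 6| ≤
        ε * dist1 x z ^ 3 + C * dist1 x z ^ 4 := by
  have hd1 (i : Fin d) : ContDiffOn ℝ (2 : ℕ) (pderiv i G) (simplex d) := ContDiffOn.pderiv hG i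
  have hd2 (i j : Fin d) : ContDiffOn ℝ (1 : ℕ) (pderiv j (pderiv i G)) (simplex d) :=
    ContDiffOn.pderiv (hd1 i) j
  have hd3 (i j l : Fin d) : ContDiffOn ℝ (0 : ℕ) (pderiv l (pderiv j (pderiv i G))) (simplex d) :=
    ContDiffOn.pderiv (hd2 i j) l
  -- all third derivatives at once, as a single continuous map
  set H : (Fin d → ℝ) → (Fin d → Fin d → Fin d → ℝ) :=
    fun x i j l => pderiv l (pderiv j (pderiv i G)) x with hH
  have hHc : ContinuousOn H (simplex d) :=
    continuousOn_pi.2 fun i => continuousOn_pi.2 fun j => continuousOn_pi.2 fun l =>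
      (hd3 i j l).continuousOn
  have hu := isCompact_simplex.uniformContinuousOn_of_continuous hHc
  obtain ⟨δ, hδ, hδH⟩ := Metric.uniformContinuousOn_iff.1 hu ε hε
  obtain ⟨M, hM⟩ := isCompact_simplex.exists_bound_of_continuousOn hHc
  refine ⟨2 * |M| / δ, by positivity, fun x hx z hz => ?_⟩
  have hcoord (i j l : Fin d) (u v : Fin d → ℝ) :
      |pderiv l (pderiv j (pderiv i G)) u - pderiv l (pderiv j (pderiv i G)) v| ≤
        ‖H u - H v‖ := by
    have h1 := norm_le_pi_norm (H u - H v) i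
    have h2 := norm_le_pi_norm ((H u - H v) i) j
    have h3 := norm_le_pi_norm ((H u - H v) i j) l
    exact h3.trans (h2.trans h1)
  have hseg (t : ℝ) (ht : t ∈ Set.Icc (0 : ℝ) 1) : dist (segPoint x z t) x ≤ dist1 x z := by
    rw [dist_eq_norm, segPoint, add_sub_cancel_left, norm_smul, Real.norm_eq_abs,
      abs_of_nonneg ht.1]
    refine (mul_le_of_le_one_left (norm_nonneg _) ht.2).trans ?_
    exact (pi_norm_le_iff_of_nonneg (dist1_nonneg _ _)).2 fun i =>
      Finset.single_le_sum (f := fun i => |z i - x i|) (fun _ _ => abs_nonneg _) (Finset.mem_univ i)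
  have hs := dist1_nonneg x z
  have main := taylor_three_bound (hG.differentiableOn (by simp))
    (fun i => (hd1 i).differentiableOn (by simp)) (fun i j => (hd2 i j).differentiableOn (by simp))
    hx hz (C := ε + 2 * |M| / δ * dist1 x z) (fun i j l t ht => by
      have hmem := segPoint_mem hx hz ht
      refine (hcoord i j l _ _).trans ?_
      rcases lt_or_ge (dist1 x z) δ with h | h
      · have := hδH _ hmem x hx ((hseg t ht).trans_lt h)
        rw [dist_eq_norm] at this
        have : 0 ≤ 2 * |M| / δ * dist1 x z := by positivity
        linarith
      · have h1 := norm_sub_le (H (segPoint x z t)) (H x)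
        have h2 := (hM _ hmem).trans (le_abs_self M)
        have h3 := (hM x hx).trans (le_abs_self M)
        have h4 : 2 * |M| ≤ 2 * |M| / δ * dist1 x z := by
          rw [div_mul_eq_mul_div, le_div_iff₀ hδ]
          exact mul_le_mul_of_nonneg_left h (by positivity)
        linarith)
    (Set.right_mem_Icc.2 zero_le_one)
  rw [segPoint_one] at main
  have e1 : G z - G x - taylorOne G x z - taylorTwo G x z / 2 - taylorThree G x z / 6 =
      G z - (G x + 1 * taylorOne G x z + 1 ^ 2 / 2 * taylorTwo G x z +
        1 ^ 3 / 6 * taylorThree G x z) := by ring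
  rw [e1]
  refine main.trans (le_of_eq ?_)
  ring

/-- If `G` vanishes on a segment of the simplex in a coordinate direction, the corresponding
partial derivative vanishes at its end point. -/
lemma pderiv_eq_zero {G : (Fin d → ℝ) → ℝ} (hG : DifferentiableOn ℝ G (simplex d))
    {x : Fin d → ℝ} (hx : x ∈ simplex d) {i : Fin d} (hi : 0 < x i)
    (h : ∀ z ∈ simplex d, (∀ j, j ≠ i → z j = x j) → G z = 0) : pderiv i G x = 0 := by
  set z := Function.update x i 0 with hz
  have hzx (j : Fin d) (hj : j ≠ i) : z j = x j := by simp [hz, hj]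
  have hzi : z i = 0 := by simp [hz]
  have hzs : z ∈ simplex d := by
    rw [mem_simplex] at *
    have hle (j : Fin d) : z j ≤ x j := by
      rcases eq_or_ne j i with rfl | hj
      · rw [hzi]; exact hx.1 j
      · exact (hzx j hj).le
    refine ⟨fun j => ?_, (Finset.sum_le_sum fun j _ => hle j).trans hx.2⟩
    rcases eq_or_ne j i with rfl | hj
    · exact hzi.ge
    · rw [hzx j hj]; exact hx.1 j
  have h0 : (0 : ℝ) ∈ Set.Icc (0 : ℝ) 1 := Set.left_mem_Icc.2 zero_le_one
  have h1 := hasDerivWithinAt_segment hG hx hzs h0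
  have h2 : HasDerivWithinAt (fun t => G (segPoint x z t)) 0 (Set.Icc 0 1) 0 := by
    refine (hasDerivWithinAt_const (0 : ℝ) (Set.Icc (0 : ℝ) 1) (0 : ℝ)).congr_of_mem
      (fun t ht => ?_) h0
    refine h _ (segPoint_mem hx hzs ht) fun j hj => ?_
    simp [segPoint, hzx j hj]
  have h3 := (uniqueDiffOn_Icc zero_lt_one 0 h0).eq_deriv _ h1 h2
  rw [Finset.sum_eq_single i (fun j _ hj => by simp [hzx j hj]) (by simp), hzi,
    segPoint_zero] at h3
  simpa [hi.ne'] using h3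

/-! ### The mean squared error in terms of the multinomial expectation -/

/-- The grid point `k / m`. -/
def gridPoint (m : ℕ) (k : Fin d → ℕ) : Fin d → ℝ := fun i => (k i : ℝ) / m

lemma gridPoint_mem {m : ℕ} {k : Fin d → ℕ} (hk : ∑ i, k i ≤ m) : gridPoint m k ∈ simplex d := by
  refine mem_simplex.2 ⟨fun i => by unfold gridPoint; positivity, ?_⟩
  simp only [gridPoint, ← Finset.sum_div]
  exact div_le_one_of_le₀ (by exact_mod_cast hk) (by positivity)

lemma gridPoint_inf (m : ℕ) (k l : Fin d → ℕ) :
    gridPoint m (k ⊓ l) = gridPoint m k ⊓ gridPoint m l := by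
  ext i
  simp only [gridPoint, Pi.inf_apply]
  rw [Nat.cast_min, min_div_div_right (by positivity)]

/-- The conditional probability, given an observation `p`, that `p` lies below the random grid
point. -/
def coverProb (x : Fin d → ℝ) (m : ℕ) (p : Fin d → ℝ) : ℝ :=
  mexp x m fun k => (Set.Iic (gridPoint m k)).indicator (fun _ => (1 : ℝ)) p

lemma bernsteinEstimator_eq (obs : ℕ → Fin d → ℝ) (n m : ℕ) (x : Fin d → ℝ) :
    bernsteinEstimator obs n m x = (n : ℝ)⁻¹ * ∑ j ∈ Finset.range n, coverProb x m (obs j) := by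
  simp only [coverProb, ← mexp_sum, ← mexp_const_mul]
  rfl

lemma bernsteinPoly_eq (G : (Fin d → ℝ) → ℝ) (m : ℕ) (x : Fin d → ℝ) :
    bernsteinPoly G m x = mexp x m fun k => G (gridPoint m k) := rfl

lemma measurable_coverProb (x : Fin d → ℝ) (m : ℕ) : Measurable (coverProb x m) :=
  Finset.measurable_fun_sum _ fun _ _ =>
    (measurable_const.indicator measurableSet_Iic).mul_const _

lemma coverProb_mem {x : Fin d → ℝ} (hx : x ∈ simplex d) (m : ℕ) (p : Fin d → ℝ) :
    coverProb x m p ∈ Set.Icc (0 : ℝ) 1 := by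
  refine ⟨mexp_nonneg hx fun k _ => Set.indicator_nonneg (fun _ _ => zero_le_one) _, ?_⟩
  rw [← mexp_one x (nonneg_of_mem_simplex hx) m]
  exact mexp_mono hx fun k _ => Set.indicator_le_self' (fun _ _ => zero_le_one) _

variable (μ : Measure (Fin d → ℝ))

lemma integral_indicator_Iic (w : Fin d → ℝ) :
    ∫ p, (Set.Iic w).indicator (fun _ => (1 : ℝ)) p ∂μ = jointCDF μ w := by
  rw [integral_indicator_const _ measurableSet_Iic]
  simp [jointCDF]

lemma integral_mexp_measure {x : Fin d → ℝ} {m : ℕ} {f : (Fin d → ℕ) → (Fin d → ℝ) → ℝ}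
    (hf : ∀ k, Integrable (f k) μ) :
    ∫ p, mexp x m (fun k => f k p) ∂μ = mexp x m fun k => ∫ p, f k p ∂μ := by
  simp only [mexp]
  rw [integral_finsetSum _ fun k _ => (hf k).mul_const _]
  simp [integral_mul_const]

variable [IsProbabilityMeasure μ]

lemma integrable_indicator_Iic (w : Fin d → ℝ) :
    Integrable ((Set.Iic w).indicator (fun _ => (1 : ℝ))) μ :=
  (integrable_const _).indicator measurableSet_Iic

lemma integral_coverProb (x : Fin d → ℝ) (m : ℕ) :
    ∫ p, coverProb x m p ∂μ = bernsteinPoly (jointCDF μ) m x := by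
  simp only [coverProb]
  rw [integral_mexp_measure μ fun k => integrable_indicator_Iic μ _]
  simp only [integral_indicator_Iic]
  rfl

lemma indicator_Iic_mul (v w p : Fin d → ℝ) :
    (Set.Iic v).indicator (fun _ => (1 : ℝ)) p * (Set.Iic w).indicator (fun _ => (1 : ℝ)) p =
      (Set.Iic (v ⊓ w)).indicator (fun _ => (1 : ℝ)) p := by
  classical
  simp only [Set.indicator_apply, Set.mem_Iic, le_inf_iff]
  split_ifs <;> simp_all

lemma integral_indicator_mul_coverProb (w x : Fin d → ℝ) (m : ℕ) :
    ∫ p, (Set.Iic w).indicator (fun _ => (1 : ℝ)) p * coverProb x m p ∂μ =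
      mexp x m fun k => jointCDF μ (w ⊓ gridPoint m k) := by
  simp only [coverProb, ← mexp_const_mul, indicator_Iic_mul]
  rw [integral_mexp_measure μ fun k => integrable_indicator_Iic μ _]
  simp only [integral_indicator_Iic]

lemma integral_coverProb_sq {x : Fin d → ℝ} (hx : x ∈ simplex d) (m : ℕ) :
    ∫ p, coverProb x m p ^ 2 ∂μ =
      mexp x m fun k => mexp x m fun l => jointCDF μ (gridPoint m (k ⊓ l)) := by
  have hint (k : Fin d → ℕ) : Integrable
      (fun p => (Set.Iic (gridPoint m k)).indicator (fun _ => (1 : ℝ)) p * coverProb x m p) μ := by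
    refine (integrable_indicator_Iic μ _).mul_bdd (c := 1)
      (measurable_coverProb x m).aestronglyMeasurable (Eventually.of_forall fun p => ?_)
    have := coverProb_mem hx m p
    rw [Real.norm_eq_abs, abs_of_nonneg this.1]
    exact this.2
  have h (p : Fin d → ℝ) : coverProb x m p ^ 2 = mexp x m fun k =>
      (Set.Iic (gridPoint m k)).indicator (fun _ => (1 : ℝ)) p * coverProb x m p := by
    rw [mexp_mul_const, pow_two]
    rfl
  simp only [h]
  rw [integral_mexp_measure μ hint]
  simp only [integral_indicator_mul_coverProb, gridPoint_inf]

lemma memLp_coverProb {x : Fin d → ℝ} (hx : x ∈ simplex d) (m : ℕ) :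
    MemLp (coverProb x m) 2 μ :=
  MemLp.of_bound (measurable_coverProb x m).aestronglyMeasurable 1 <| Eventually.of_forall fun p => by
    have := coverProb_mem hx m p
    rw [Real.norm_eq_abs, abs_of_nonneg this.1]
    exact this.2

lemma variance_coverProb {x : Fin d → ℝ} (hx : x ∈ simplex d) (m : ℕ) :
    Var[coverProb x m; μ] =
      (mexp x m fun k => mexp x m fun l => jointCDF μ (gridPoint m (k ⊓ l))) -
        bernsteinPoly (jointCDF μ) m x ^ 2 := by
  rw [variance_eq_sub (memLp_coverProb μ hx m), integral_coverProb, ← integral_coverProb_sq μ hx]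
  rfl

lemma variance_coverProb_le {x : Fin d → ℝ} (hx : x ∈ simplex d) (m : ℕ) :
    Var[coverProb x m; μ] ≤ bernsteinPoly (jointCDF μ) m x := by
  have h1 : ∫ p, coverProb x m p ^ 2 ∂μ ≤ ∫ p, coverProb x m p ∂μ := by
    refine integral_mono (memLp_coverProb μ hx m).integrable_sq
      ((memLp_coverProb μ hx m).integrable one_le_two) fun p => ?_
    have := coverProb_mem hx m p
    exact pow_le_of_le_one this.1 this.2 two_ne_zero
  rw [variance_coverProb μ hx, ← integral_coverProb_sq μ hx]
  rw [integral_coverProb] at h1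
  nlinarith [sq_nonneg (bernsteinPoly (jointCDF μ) m x)]

variable {μ}

/-- The bias-variance decomposition of the Bernstein estimator. -/
lemma mse_eq {Ω : Type*} [MeasurableSpace Ω] {P : Measure Ω} [IsProbabilityMeasure P]
    {X : ℕ → Ω → Fin d → ℝ} (hlaw : ∀ i, HasLaw (X i) μ P) (hindep : iIndepFun X P)
    (F : (Fin d → ℝ) → ℝ) {n m : ℕ} (hn : 1 ≤ n) {x : Fin d → ℝ} (hx : x ∈ simplex d) :
    mse P X F n m x =
      (n : ℝ)⁻¹ * Var[coverProb x m; μ] + (bernsteinPoly (jointCDF μ) m x - F x) ^ 2 := by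
  have hn0 : (n : ℝ) ≠ 0 := by positivity
  set Y : ℕ → Ω → ℝ := fun j => coverProb x m ∘ X j with hY
  have hYm (j : ℕ) : AEStronglyMeasurable (Y j) P :=
    ((measurable_coverProb x m).comp_aemeasurable (hlaw j).aemeasurable).aestronglyMeasurable
  have hYL (j : ℕ) : MemLp (Y j) 2 P :=
    MemLp.of_bound (hYm j) 1 <| Eventually.of_forall fun ω => by
      have := coverProb_mem hx m (X j ω)
      rw [← Real.norm_of_nonneg this.1] at this
      exact this.2
  have hYmean (j : ℕ) : ∫ ω, Y j ω ∂P = bernsteinPoly (jointCDF μ) m x := by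
    rw [← integral_coverProb, ← (hlaw j).integral_comp
      (measurable_coverProb x m).aestronglyMeasurable]
  have hYvar (j : ℕ) : Var[Y j; P] = Var[coverProb x m; μ] := by
    rw [← (hlaw j).map_eq, variance_map (measurable_coverProb x m).aemeasurable
      (hlaw j).aemeasurable]
  have hYind : iIndepFun Y P := hindep.comp _ fun _ => measurable_coverProb x m
  have hsum : Var[∑ j ∈ Finset.range n, Y j; P] = n * Var[coverProb x m; μ] := by
    rw [IndepFun.variance_sum (fun j _ => hYL j) fun i _ j _ hij => hYind.indepFun hij]
    simp [hYvar]
  set T : Ω → ℝ := fun ω => (n : ℝ)⁻¹ * (∑ j ∈ Finset.range n, Y j) ω with hT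
  have hTL : MemLp T 2 P := (memLp_finsetSum' _ fun j _ => hYL j).const_mul _
  have hTvar : Var[T; P] = (n : ℝ)⁻¹ * Var[coverProb x m; μ] := by
    rw [hT, variance_const_mul, hsum]
    field_simp
  have hTmean : ∫ ω, T ω ∂P = bernsteinPoly (jointCDF μ) m x := by
    simp only [hT, Finset.sum_apply]
    rw [integral_const_mul, integral_finsetSum _ fun j _ => (hYL j).integrable one_le_two]
    simp only [hYmean, Finset.sum_const, Finset.card_range, nsmul_eq_mul]
    field_simp
  have hTX : (fun ω => bernsteinEstimator (fun i => X i ω) n m x) = T := by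
    ext ω
    rw [bernsteinEstimator_eq]
    simp [hT, hY]
  have hconst : MemLp (fun ω => T ω - F x) 2 P := hTL.sub (memLp_const _)
  have h1 := variance_eq_sub hconst
  rw [variance_sub_const hTL.aestronglyMeasurable, hTvar,
    integral_sub (hTL.integrable one_le_two) (integrable_const _), hTmean] at h1
  simp only [integral_const, probReal_univ, one_smul] at h1
  have h2 : mse P X F n m x = P[(fun ω => T ω - F x) ^ 2] := by
    rw [mse, ← hTX]
    rfl
  rw [h2, h1]
  ring

/-! ### Expansions of the bias and of the second moment -/

lemma gridPoint_sub {m : ℕ} (hm : 1 ≤ m) (x : Fin d → ℝ) (k : Fin d → ℕ) (i : Fin d) :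
    gridPoint m k i - x i = (m : ℝ)⁻¹ * centred x m i k := by
  have : (m : ℝ) ≠ 0 := by positivity
  simp only [gridPoint, centred]
  field_simp

lemma dist1_sq_le (x z : Fin d → ℝ) : dist1 x z ^ 2 ≤ d * ∑ i, (z i - x i) ^ 2 := by
  have := sq_sum_le_card_mul_sum_sq (s := Finset.univ) (f := fun i => |z i - x i|)
  simpa [dist1] using this

lemma dist1_pow_four_le (x z : Fin d → ℝ) :
    dist1 x z ^ 4 ≤ (d : ℝ) ^ 3 * ∑ i, (z i - x i) ^ 4 := by
  have h1 := dist1_sq_le x z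
  have h2 := sq_sum_le_card_mul_sum_sq (s := Finset.univ) (f := fun i => (z i - x i) ^ 2)
  simp only [Finset.card_univ, Fintype.card_fin, ← pow_mul] at h2
  calc dist1 x z ^ 4 = (dist1 x z ^ 2) ^ 2 := by ring
    _ ≤ (d * ∑ i, (z i - x i) ^ 2) ^ 2 := pow_le_pow_left₀ (sq_nonneg _) h1 2
    _ = (d : ℝ) ^ 2 * (∑ i, (z i - x i) ^ 2) ^ 2 := by ring
    _ ≤ (d : ℝ) ^ 2 * (d * ∑ i, (z i - x i) ^ (2 * 2)) := by gcongr
    _ = _ := by ring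

lemma mexp_gridPoint_sub_sq_le {x : Fin d → ℝ} (hx : x ∈ simplex d) {m : ℕ} (hm : 1 ≤ m)
    (i : Fin d) : mexp x m (fun k => (gridPoint m k i - x i) ^ 2) ≤ x i / m := by
  have hm0 : (m : ℝ) ≠ 0 := by positivity
  have h (k : Fin d → ℕ) : (gridPoint m k i - x i) ^ 2 =
      ((m : ℝ)⁻¹) ^ 2 * (centred x m i k * centred x m i k) := by rw [gridPoint_sub hm]; ring
  simp only [h, mexp_const_mul, mexp_centred_mul (nonneg_of_mem_simplex hx), if_true]
  have : ((m : ℝ)⁻¹) ^ 2 * (m * (x i - x i * x i)) = (x i - x i * x i) / m := by field_simp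
  rw [this]
  gcongr
  nlinarith [sq_nonneg (x i)]

lemma mexp_dist1_sq_le {x : Fin d → ℝ} (hx : x ∈ simplex d) {m : ℕ} (hm : 1 ≤ m) :
    mexp x m (fun k => dist1 x (gridPoint m k) ^ 2) ≤ d * ((∑ i, x i) / m) := by
  refine (mexp_mono hx fun k _ => dist1_sq_le x (gridPoint m k)).trans ?_
  rw [mexp_const_mul, mexp_sum, Finset.sum_div]
  gcongr with i
  exact mexp_gridPoint_sub_sq_le hx hm i

lemma mexp_dist1_pow_four_le {x : Fin d → ℝ} (hx : x ∈ simplex d) {m : ℕ} (hm : 1 ≤ m) :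
    mexp x m (fun k => dist1 x (gridPoint m k) ^ 4) ≤ 3 * (d : ℝ) ^ 4 * ((m : ℝ) ^ 2)⁻¹ := by
  have hm0 : (m : ℝ) ≠ 0 := by positivity
  refine (mexp_mono hx fun k _ => dist1_pow_four_le x (gridPoint m k)).trans ?_
  rw [mexp_const_mul, mexp_sum]
  have h (i : Fin d) : mexp x m (fun k => (gridPoint m k i - x i) ^ 4) ≤ 3 * ((m : ℝ) ^ 2)⁻¹ := by
    have e (k : Fin d → ℕ) : (gridPoint m k i - x i) ^ 4 =
        ((m : ℝ)⁻¹) ^ 4 * centred x m i k ^ 4 := by rw [gridPoint_sub hm]; ring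
    simp only [e, mexp_const_mul]
    calc ((m : ℝ)⁻¹) ^ 4 * mexp x m (fun k => centred x m i k ^ 4)
        ≤ ((m : ℝ)⁻¹) ^ 4 * (3 * (m : ℝ) ^ 2) := by
          gcongr; exact mexp_centred_pow_four_le hx m i
      _ = _ := by field_simp
  calc (d : ℝ) ^ 3 * ∑ i, mexp x m (fun k => (gridPoint m k i - x i) ^ 4)
      ≤ (d : ℝ) ^ 3 * ∑ _i : Fin d, 3 * ((m : ℝ) ^ 2)⁻¹ := by gcongr with i; exact h i
    _ = _ := by simp; ring

lemma mexp_taylorOne {x : Fin d → ℝ} (hx : x ∈ simplex d) {m : ℕ} (hm : 1 ≤ m)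
    (G : (Fin d → ℝ) → ℝ) : mexp x m (fun k => taylorOne G x (gridPoint m k)) = 0 := by
  simp only [taylorOne, gridPoint_sub hm, mexp_sum, mexp_mul_const, mexp_const_mul,
    mexp_centred (nonneg_of_mem_simplex hx)]
  simp

lemma mexp_taylorTwo {x : Fin d → ℝ} (hx : x ∈ simplex d) {m : ℕ} (hm : 1 ≤ m)
    (G : (Fin d → ℝ) → ℝ) : mexp x m (fun k => taylorTwo G x (gridPoint m k)) =
      (m : ℝ)⁻¹ * ∑ i, ∑ j, ((if i = j then x i else 0) - x i * x j) *
        pderiv j (pderiv i G) x := by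
  have hm0 : (m : ℝ) ≠ 0 := by positivity
  have h (k : Fin d → ℕ) : taylorTwo G x (gridPoint m k) = ∑ i, ∑ j,
      ((m : ℝ)⁻¹) ^ 2 * (centred x m i k * centred x m j k) * pderiv j (pderiv i G) x := by
    simp only [taylorTwo, taylorOne, gridPoint_sub hm, Finset.mul_sum]
    exact Finset.sum_congr rfl fun i _ => Finset.sum_congr rfl fun j _ => by ring
  simp only [h, mexp_sum, mexp_mul_const, mexp_const_mul,
    mexp_centred_mul (nonneg_of_mem_simplex hx), Finset.mul_sum]
  exact Finset.sum_congr rfl fun i _ => Finset.sum_congr rfl fun j _ => by field_simp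

lemma abs_mexp_taylorThree_le {x : Fin d → ℝ} (hx : x ∈ simplex d) {m : ℕ} (hm : 1 ≤ m)
    {G : (Fin d → ℝ) → ℝ} {C : ℝ}
    (hC : ∀ i j l, |pderiv l (pderiv j (pderiv i G)) x| ≤ C) :
    |mexp x m (fun k => taylorThree G x (gridPoint m k))| ≤
      (d : ℝ) ^ 3 * C * ((m : ℝ) ^ 2)⁻¹ := by
  have hm0 : (m : ℝ) ≠ 0 := by positivity
  have h (k : Fin d → ℕ) : taylorThree G x (gridPoint m k) = ∑ i, ∑ j, ∑ l,
      ((m : ℝ)⁻¹) ^ 3 * (centred x m i k * centred x m j k * centred x m l k) *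
        pderiv l (pderiv j (pderiv i G)) x := by
    simp only [taylorThree, taylorTwo, taylorOne, gridPoint_sub hm, Finset.mul_sum]
    exact Finset.sum_congr rfl fun i _ => Finset.sum_congr rfl fun j _ =>
      Finset.sum_congr rfl fun l _ => by ring
  simp only [h, mexp_sum, mexp_mul_const, mexp_const_mul]
  have hterm (i j l : Fin d) : |((m : ℝ)⁻¹) ^ 3 *
      mexp x m (fun k => centred x m i k * centred x m j k * centred x m l k) *
        pderiv l (pderiv j (pderiv i G)) x| ≤ C * ((m : ℝ) ^ 2)⁻¹ := by
    rw [abs_mul, abs_mul, abs_of_nonneg (by positivity : (0 : ℝ) ≤ ((m : ℝ)⁻¹) ^ 3)]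
    calc ((m : ℝ)⁻¹) ^ 3 * |mexp x m (fun k => centred x m i k * centred x m j k *
            centred x m l k)| * |pderiv l (pderiv j (pderiv i G)) x|
        ≤ ((m : ℝ)⁻¹) ^ 3 * m * C := by
          gcongr
          · exact abs_mexp_centred_mul_mul_le hx m i j l
          · exact hC i j l
      _ = _ := by field_simp
  calc _ ≤ ∑ _i : Fin d, ∑ _j : Fin d, ∑ _l : Fin d, C * ((m : ℝ) ^ 2)⁻¹ := by
        refine (Finset.abs_sum_le_sum_abs _ _).trans (Finset.sum_le_sum fun i _ => ?_)
        refine (Finset.abs_sum_le_sum_abs _ _).trans (Finset.sum_le_sum fun j _ => ?_)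
        exact (Finset.abs_sum_le_sum_abs _ _).trans (Finset.sum_le_sum fun l _ => hterm i j l)
    _ = _ := by simp; ring

/-- The bias is of order `1 / m`. -/
lemma exists_bias_bound {G : (Fin d → ℝ) → ℝ} (hG : ContDiffOn ℝ (2 : ℕ) G (simplex d)) :
    ∃ C : ℝ, 0 ≤ C ∧ ∀ m : ℕ, 1 ≤ m → ∀ x ∈ simplex d,
      |bernsteinPoly G m x - G x| ≤ C * ((∑ i, x i) / m) := by
  obtain ⟨C, hC0, hC⟩ := exists_taylor_two hG
  refine ⟨C * d, by positivity, fun m hm x hx => ?_⟩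
  have h : bernsteinPoly G m x - G x =
      mexp x m (fun k => G (gridPoint m k) - G x - taylorOne G x (gridPoint m k)) := by
    rw [mexp_sub, mexp_sub, mexp_taylorOne hx hm, mexp_const x (nonneg_of_mem_simplex hx),
      sub_zero]
    rfl
  rw [h]
  refine (abs_mexp_le hx fun k hk => hC x hx _ (gridPoint_mem hk)).trans ?_
  rw [mexp_const_mul, mul_assoc]
  exact mul_le_mul_of_nonneg_left (mexp_dist1_sq_le hx hm) hC0

lemma sum_le_one_of_mem {x : Fin d → ℝ} (hx : x ∈ simplex d) : ∑ i, x i ≤ 1 := (mem_simplex.1 hx).2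

/-- The bias to the order `m ^ (-3 / 2)`, uniformly on the simplex. -/
lemma bias_expansion {G : (Fin d → ℝ) → ℝ} (hG : ContDiffOn ℝ (3 : ℕ) G (simplex d))
    {ε : ℝ} (hε : 0 < ε) :
    ∃ M : ℕ, ∀ m : ℕ, 1 ≤ m → M ≤ m → ∀ x ∈ simplex d,
      |bernsteinPoly G m x - G x - (2 * m : ℝ)⁻¹ * ∑ i, ∑ j,
        ((if i = j then x i else 0) - x i * x j) * pderiv j (pderiv i G) x| ≤
        ε * ((m : ℝ) * √(m : ℝ))⁻¹ := by
  set η : ℝ := ε / (3 * (d : ℝ) ^ 4 + d + 1) with hη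
  have hη0 : 0 < η := by positivity
  obtain ⟨C, hC0, hC⟩ := exists_taylor_three hG hη0
  have hd3 (i j l : Fin d) : ContDiffOn ℝ (0 : ℕ) (pderiv l (pderiv j (pderiv i G))) (simplex d) :=
    ContDiffOn.pderiv (ContDiffOn.pderiv (n := (1 : ℕ)) (ContDiffOn.pderiv (n := (2 : ℕ)) hG i) j) l
  choose B hB0 hB using fun i j l => exists_bound_on_simplex (hd3 i j l).continuousOn
  set B' := ∑ i, ∑ j, ∑ l, B i j l with hB'
  have hB'0 : 0 ≤ B' := Finset.sum_nonneg fun i _ => Finset.sum_nonneg fun j _ =>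
    Finset.sum_nonneg fun l _ => hB0 i j l
  have hBle (i j l : Fin d) : B i j l ≤ B' :=
    (Finset.single_le_sum (f := fun l => B i j l) (fun l _ => hB0 i j l) (Finset.mem_univ l)).trans
      ((Finset.single_le_sum (f := fun j => ∑ l, B i j l)
        (fun j _ => Finset.sum_nonneg fun l _ => hB0 i j l) (Finset.mem_univ j)).trans
        (Finset.single_le_sum (f := fun i => ∑ j, ∑ l, B i j l)
          (fun i _ => Finset.sum_nonneg fun j _ => Finset.sum_nonneg fun l _ => hB0 i j l)
          (Finset.mem_univ i)))
  set K : ℝ := C * (3 * (d : ℝ) ^ 4) + (d : ℝ) ^ 3 * B' with hK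
  have hK0 : 0 ≤ K := by positivity
  refine ⟨⌈(2 * K / ε) ^ 2⌉₊, fun m hm hM x hx => ?_⟩
  have hx0 := nonneg_of_mem_simplex hx
  have hm0 : (0 : ℝ) < m := by exact_mod_cast hm
  set s := √(m : ℝ) with hs
  have hs0 : 0 < s := Real.sqrt_pos.2 hm0
  have hss : (m : ℝ) = s * s := (Real.mul_self_sqrt hm0.le).symm
  have hsK : 2 * K / ε ≤ s := Real.le_sqrt_of_sq_le ((Nat.le_ceil _).trans (by exact_mod_cast hM))
  set T : ℝ := ∑ i, ∑ j, ((if i = j then x i else 0) - x i * x j) * pderiv j (pderiv i G) x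
  have h2 := mexp_taylorTwo hx hm G
  have hsplit : bernsteinPoly G m x - G x - (2 * m : ℝ)⁻¹ * T =
      mexp x m (fun k => G (gridPoint m k) - G x - taylorOne G x (gridPoint m k) -
        taylorTwo G x (gridPoint m k) / 2 - taylorThree G x (gridPoint m k) / 6) +
      mexp x m (fun k => taylorThree G x (gridPoint m k)) / 6 := by
    simp only [mexp_sub, div_eq_mul_inv, mexp_mul_const, mexp_taylorOne hx hm, mexp_const x hx0, h2,
      bernsteinPoly_eq, mul_inv]
    ring
  have hrem : |mexp x m (fun k => G (gridPoint m k) - G x - taylorOne G x (gridPoint m k) -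
        taylorTwo G x (gridPoint m k) / 2 - taylorThree G x (gridPoint m k) / 6)| ≤
      η / 2 * (s * (3 * (d : ℝ) ^ 4 * ((m : ℝ) ^ 2)⁻¹) + s⁻¹ * (d * (m : ℝ)⁻¹)) +
        C * (3 * (d : ℝ) ^ 4 * ((m : ℝ) ^ 2)⁻¹) := by
    have hpt (k : Fin d → ℕ) : η * dist1 x (gridPoint m k) ^ 3 + C * dist1 x (gridPoint m k) ^ 4 ≤
        η / 2 * (s * dist1 x (gridPoint m k) ^ 4 + s⁻¹ * dist1 x (gridPoint m k) ^ 2) +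
          C * dist1 x (gridPoint m k) ^ 4 := by
      set r := dist1 x (gridPoint m k)
      have : 0 ≤ s⁻¹ * (r ^ 2 * (s * r - 1) ^ 2) := by positivity
      have e : s⁻¹ * (r ^ 2 * (s * r - 1) ^ 2) = s * r ^ 4 + s⁻¹ * r ^ 2 - 2 * r ^ 3 := by
        field_simp; ring
      nlinarith
    refine (abs_mexp_le hx fun k hk => (hC x hx _ (gridPoint_mem hk)).trans (hpt k)).trans ?_
    have h4 := mexp_dist1_pow_four_le hx hm
    have h2' : mexp x m (fun k => dist1 x (gridPoint m k) ^ 2) ≤ d * (m : ℝ)⁻¹ :=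
      (mexp_dist1_sq_le hx hm).trans (by
        rw [← one_div]; gcongr; exact sum_le_one_of_mem hx)
    simp only [mexp_add, mexp_const_mul]
    gcongr
  have hthree := abs_mexp_taylorThree_le hx hm fun i j l => (hB i j l x hx).trans (hBle i j l)
  rw [hsplit]
  refine (abs_add_le _ _).trans ?_
  rw [abs_div, abs_of_pos (by norm_num : (0 : ℝ) < 6)]
  have hfin : η / 2 * (s * (3 * (d : ℝ) ^ 4 * ((m : ℝ) ^ 2)⁻¹) + s⁻¹ * (d * (m : ℝ)⁻¹)) ≤
      ε / 2 * ((m : ℝ) * s)⁻¹ := by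
    have e : η / 2 * (s * (3 * (d : ℝ) ^ 4 * ((m : ℝ) ^ 2)⁻¹) + s⁻¹ * (d * (m : ℝ)⁻¹)) =
        η * (3 * (d : ℝ) ^ 4 + d) / 2 * ((m : ℝ) * s)⁻¹ := by
      rw [hss]; field_simp
    rw [e]
    gcongr
    rw [hη, div_mul_eq_mul_div, div_le_iff₀ (by positivity)]
    nlinarith
  have hfin2 : K * ((m : ℝ) ^ 2)⁻¹ ≤ ε / 2 * ((m : ℝ) * s)⁻¹ := by
    have e : ε / 2 * ((m : ℝ) * s)⁻¹ = (ε / 2 * s) * ((m : ℝ) ^ 2)⁻¹ := by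
      rw [hss]; field_simp
    rw [e]
    gcongr
    rw [div_le_iff₀ hε] at hsK
    linarith
  have hB'' : 0 ≤ (d : ℝ) ^ 3 * B' * ((m : ℝ) ^ 2)⁻¹ := by positivity
  have hKe : K * ((m : ℝ) ^ 2)⁻¹ = C * (3 * (d : ℝ) ^ 4 * ((m : ℝ) ^ 2)⁻¹) +
      (d : ℝ) ^ 3 * B' * ((m : ℝ) ^ 2)⁻¹ := by rw [hK]; ring
  linarith

lemma dist1_inf_sq_le (x u v : Fin d → ℝ) :
    dist1 x (u ⊓ v) ^ 2 ≤ d * ∑ i, ((u i - x i) ^ 2 + (v i - x i) ^ 2) := by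
  refine (dist1_sq_le _ _).trans ?_
  gcongr with i
  rcases le_total (u i) (v i) with h | h
  · simp only [Pi.inf_apply, inf_eq_left.2 h]; nlinarith [sq_nonneg (v i - x i)]
  · simp only [Pi.inf_apply, inf_eq_right.2 h]; nlinarith [sq_nonneg (u i - x i)]

/-- The mean distance of the `i`-th coordinates of two independent multinomial vectors. -/
def meanDist (x : Fin d → ℝ) (m : ℕ) (i : Fin d) : ℝ :=
  mexp x m fun k => mexp x m fun l => |(k i : ℝ) - l i|

lemma second_moment_expansion {G : (Fin d → ℝ) → ℝ} (hG : ContDiffOn ℝ (2 : ℕ) G (simplex d)) :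
    ∃ C : ℝ, 0 ≤ C ∧ ∀ m : ℕ, 1 ≤ m → ∀ x ∈ simplex d,
      |mexp x m (fun k => mexp x m fun l => G (gridPoint m (k ⊓ l))) - G x +
        (2 * m : ℝ)⁻¹ * ∑ i, pderiv i G x * meanDist x m i| ≤ C * ((∑ i, x i) / m) := by
  obtain ⟨C, hC0, hC⟩ := exists_taylor_two hG
  refine ⟨2 * C * d, by positivity, fun m hm x hx => ?_⟩
  have hx0 := nonneg_of_mem_simplex hx
  have hm0 : (m : ℝ) ≠ 0 := by positivity
  have hone : mexp x m (fun k => mexp x m fun l => taylorOne G x (gridPoint m (k ⊓ l))) =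
      -((2 * m : ℝ)⁻¹ * ∑ i, pderiv i G x * meanDist x m i) := by
    have e (k l : Fin d → ℕ) : taylorOne G x (gridPoint m (k ⊓ l)) =
        ∑ i, ((m : ℝ)⁻¹ * min (k i : ℝ) (l i) - x i) * pderiv i G x := by
      simp only [taylorOne, gridPoint, Pi.inf_apply]
      exact Finset.sum_congr rfl fun i _ => by
        rw [show ((k i ⊓ l i : ℕ) : ℝ) = min (k i : ℝ) (l i) from Nat.cast_min _ _]; ring
    simp only [e, mexp_sum, mexp_mul_const, mexp_sub, mexp_const_mul, mexp_const x hx0,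
      mexp_mexp_min hx0, Finset.mul_sum, meanDist]
    rw [← Finset.sum_neg_distrib]
    exact Finset.sum_congr rfl fun i _ => by field_simp; ring
  have hsplit : mexp x m (fun k => mexp x m fun l => G (gridPoint m (k ⊓ l))) - G x +
        (2 * m : ℝ)⁻¹ * ∑ i, pderiv i G x * meanDist x m i =
      mexp x m (fun k => mexp x m fun l =>
        G (gridPoint m (k ⊓ l)) - G x - taylorOne G x (gridPoint m (k ⊓ l))) := by
    simp only [mexp_sub, hone, mexp_const x hx0]
    ring
  have hle {k l : Fin d → ℕ} (hk : ∑ i, k i ≤ m) : ∑ i, (k ⊓ l) i ≤ m :=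
    (Finset.sum_le_sum fun i _ => inf_le_left).trans hk
  rw [hsplit]
  have hpt (k l : Fin d → ℕ) (hk : ∑ i, k i ≤ m) :
      |G (gridPoint m (k ⊓ l)) - G x - taylorOne G x (gridPoint m (k ⊓ l))| ≤
        C * (d * ∑ i, ((gridPoint m k i - x i) ^ 2 + (gridPoint m l i - x i) ^ 2)) := by
    refine (hC x hx _ (gridPoint_mem (hle hk))).trans (mul_le_mul_of_nonneg_left ?_ hC0)
    rw [gridPoint_inf]
    exact dist1_inf_sq_le x (gridPoint m k) (gridPoint m l)
  refine (abs_mexp_le hx fun k hk => abs_mexp_le hx fun l _ => hpt k l hk).trans ?_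
  simp only [mexp_const_mul, mexp_sum, mexp_add, mexp_const x hx0]
  have : ∑ i, (mexp x m (fun k => (gridPoint m k i - x i) ^ 2) +
      mexp x m (fun k => (gridPoint m k i - x i) ^ 2)) ≤ 2 * ((∑ i, x i) / m) := by
    rw [Finset.sum_div, Finset.mul_sum]
    exact Finset.sum_le_sum fun i _ => by linarith [mexp_gridPoint_sub_sq_le hx hm i]
  calc _ ≤ C * (d * (2 * ((∑ i, x i) / m))) := by gcongr
    _ = _ := by ring

lemma meanDist_nonneg {x : Fin d → ℝ} (hx : x ∈ simplex d) (m : ℕ) (i : Fin d) :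
    0 ≤ meanDist x m i :=
  mexp_nonneg hx fun _ _ => mexp_nonneg hx fun _ _ => abs_nonneg _

lemma meanDist_le {x : Fin d → ℝ} (hx : x ∈ simplex d) (m : ℕ) (i : Fin d) :
    meanDist x m i ≤ 2 * (m * x i) := by
  have hx0 := nonneg_of_mem_simplex hx
  have h : 0 ≤ mexp x m (fun k => mexp x m fun l => min (k i : ℝ) (l i)) :=
    mexp_nonneg hx fun _ _ => mexp_nonneg hx fun _ _ => by positivity
  rw [mexp_mexp_min hx0] at h
  rw [meanDist]
  linarith

/-! ### A lower bound for orthant probabilities by a change of measure -/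

lemma mexp_prod_pow (x : Fin d → ℝ) (m : ℕ) (a : ℝ) (r : Fin d → ℝ) :
    mexp x m (fun k => a ^ (m - ∑ i, k i) * ∏ i, r i ^ k i) =
      ((1 - ∑ i, |x i|) * a + ∑ i, x i * r i) ^ m := by
  induction m with
  | zero => simp [mexp_zero]
  | succ m ih =>
    rw [mexp_succ, pow_succ, ← ih, ← mexp_mul_const]
    refine mexp_congr fun k hk => ?_
    have h1 : m + 1 - ∑ i, k i = (m - ∑ i, k i) + 1 := by omega
    have h2 (i : Fin d) : ∏ j, r j ^ (k + Pi.single i 1 : Fin d → ℕ) j = r i * ∏ j, r j ^ k j := by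
      simp only [Pi.add_apply, pow_add, Finset.prod_mul_distrib]
      rw [mul_comm, Finset.prod_eq_single i (fun j _ hj => by simp [hj]) (by simp)]
      simp
    simp only [trialMean, sum_add_single, h1, h2, Nat.add_sub_add_right, mul_add, Finset.mul_sum,
      pow_succ]
    congr 1
    · ring
    · exact Finset.sum_congr rfl fun i _ => by ring

/-- The likelihood ratio of the multinomial laws with parameters `x'` and `x`. -/
def likelihood (x x' : Fin d → ℝ) (m : ℕ) (k : Fin d → ℕ) : ℝ :=
  ((1 - ∑ i, x' i) / (1 - ∑ i, x i)) ^ (m - ∑ i, k i) * ∏ i, (x' i / x i) ^ k i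

lemma mexp_likelihood_mul {x x' : Fin d → ℝ} (hx : ∀ i, 0 < x i) (hx1 : ∑ i, x i < 1)
    (hx' : ∀ i, 0 ≤ x' i) (m : ℕ) (G : (Fin d → ℕ) → ℝ) :
    mexp x m (fun k => likelihood x x' m k * G k) = mexp x' m G := by
  refine Finset.sum_congr rfl fun k _ => ?_
  have h1 : (1 - ∑ i, x i) ^ (m - ∑ i, k i) ≠ 0 := pow_ne_zero _ (by linarith)
  have h2 : ∏ i, x i ^ k i ≠ 0 := Finset.prod_ne_zero_iff.2 fun i _ => pow_ne_zero _ (hx i).ne'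
  simp only [likelihood, multinomialWeight, abs_of_pos (hx _), abs_of_nonneg (hx' _), div_pow,
    Finset.prod_div_distrib]
  field_simp

lemma mexp_likelihood_sq {x x' : Fin d → ℝ} (hx : ∀ i, 0 < x i) (hx1 : ∑ i, x i < 1) (m : ℕ) :
    mexp x m (fun k => likelihood x x' m k ^ 2) =
      (1 + ((∑ i, (x' i - x i)) ^ 2 / (1 - ∑ i, x i) + ∑ i, (x' i - x i) ^ 2 / x i)) ^ m := by
  have h (k : Fin d → ℕ) : likelihood x x' m k ^ 2 =
      (((1 - ∑ i, x' i) / (1 - ∑ i, x i)) ^ 2) ^ (m - ∑ i, k i) *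
        ∏ i, ((x' i / x i) ^ 2) ^ k i := by
    simp only [likelihood, mul_pow, ← Finset.prod_pow, ← pow_mul, mul_comm 2]
  simp only [h]
  rw [mexp_prod_pow]
  congr 1
  have h0 : 1 - ∑ i, x i ≠ 0 := by linarith
  have hi (i : Fin d) : x i * (x' i / x i) ^ 2 =
      (x' i - x i) ^ 2 / x i + (2 * (x' i - x i) + x i) := by
    have := (hx i).ne'
    field_simp; ring
  simp only [hi, abs_of_pos (hx _), Finset.sum_add_distrib, ← Finset.mul_sum,
    Finset.sum_sub_distrib]
  field_simp
  ring

lemma le_mexp_of_likelihood {x x' : Fin d → ℝ} (hxs : x ∈ simplex d) (hx : ∀ i, 0 < x i)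
    (hx1 : ∑ i, x i < 1)
    (hx' : ∀ i, 0 ≤ x' i) {m : ℕ} {A : (Fin d → ℕ) → ℝ} (hA : ∀ k, A k = 0 ∨ A k = 1)
    {K : ℝ} (hK : 0 < K) (hLK : mexp x m (fun k => likelihood x x' m k ^ 2) ≤ K)
    (hP : 1 / 2 ≤ mexp x' m A) : 1 / (4 * K) ≤ mexp x m A := by
  have hpt (k : Fin d → ℕ) : likelihood x x' m k * A k ≤
      1 / (4 * K) * likelihood x x' m k ^ 2 + K * A k := by
    have e : 1 / (4 * K) * likelihood x x' m k ^ 2 + K - likelihood x x' m k =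
      1 / (4 * K) * (likelihood x x' m k - 2 * K) ^ 2 := by field_simp; ring
    have : 0 ≤ 1 / (4 * K) * (likelihood x x' m k - 2 * K) ^ 2 := by positivity
    have h' : 0 ≤ 1 / (4 * K) * likelihood x x' m k ^ 2 := by positivity
    rcases hA k with h | h <;> rw [h] <;> linarith
  have h1 := mexp_mono (m := m) hxs fun k _ => hpt k
  rw [mexp_likelihood_mul hx hx1 hx', mexp_add, mexp_const_mul, mexp_const_mul] at h1
  have h2 : 1 / (4 * K) * mexp x m (fun k => likelihood x x' m k ^ 2) ≤ 1 / 4 := by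
    calc _ ≤ 1 / (4 * K) * K := by gcongr
      _ = 1 / 4 := by field_simp
  have h3 : 1 / 4 ≤ K * mexp x m A := by linarith
  rw [div_le_iff₀ (by positivity)]
  linarith

/-- The indicator of the event that the grid point dominates `x`. -/
def dominates (x : Fin d → ℝ) (m : ℕ) (k : Fin d → ℕ) : ℝ :=
  (Set.Ici x).indicator (fun _ => 1) (gridPoint m k)

lemma one_sub_le_mexp_dominates {x x' : Fin d → ℝ} (hx' : x' ∈ simplex d)
    (hlt : ∀ i, x i < x' i) {m : ℕ} (hm : 1 ≤ m) :
    1 - ∑ i, x' i / (m * (x' i - x i) ^ 2) ≤ mexp x' m (dominates x m) := by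
  have hpt (k : Fin d → ℕ) :
      1 - ∑ i, ((x' i - x i) ^ 2)⁻¹ * (gridPoint m k i - x' i) ^ 2 ≤ dominates x m k := by
    have hterm (i : Fin d) : 0 ≤ ((x' i - x i) ^ 2)⁻¹ * (gridPoint m k i - x' i) ^ 2 := by
      positivity
    by_cases h : gridPoint m k ∈ Set.Ici x
    · rw [dominates, Set.indicator_of_mem h]
      linarith [Finset.sum_nonneg fun i (_ : i ∈ Finset.univ) => hterm i]
    · rw [dominates, Set.indicator_of_notMem h]
      simp only [Set.mem_Ici, Pi.le_def, not_forall, not_le] at h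
      obtain ⟨i, hi⟩ := h
      have h1 : 1 ≤ ((x' i - x i) ^ 2)⁻¹ * (gridPoint m k i - x' i) ^ 2 := by
        have := hlt i
        rw [inv_mul_eq_div, one_le_div (by nlinarith)]
        nlinarith
      have h2 := Finset.single_le_sum (fun i _ => hterm i) (Finset.mem_univ i)
      linarith
  have hmono := mexp_mono (m := m) hx' fun k _ => hpt k
  refine le_trans ?_ hmono
  rw [mexp_sub, mexp_sum, mexp_one x' (nonneg_of_mem_simplex hx')]
  gcongr with i
  rw [mexp_const_mul]
  calc ((x' i - x i) ^ 2)⁻¹ * mexp x' m (fun k => (gridPoint m k i - x' i) ^ 2)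
      ≤ ((x' i - x i) ^ 2)⁻¹ * (x' i / m) := by
        gcongr; exact mexp_gridPoint_sub_sq_le hx' hm i
    _ = _ := by rw [inv_mul_eq_div, div_div]

lemma sum_boundaryPoint (J : Finset (Fin d)) (lam y : Fin d → ℝ) (m : ℕ) :
    ∑ i, boundaryPoint J lam y m i = (∑ i ∈ J, lam i) / m + ∑ i ∈ Jᶜ, y i := by
  rw [← Finset.sum_add_sum_compl J, Finset.sum_div]
  congr 1
  · exact Finset.sum_congr rfl fun i hi => by simp [boundaryPoint, hi]
  · exact Finset.sum_congr rfl fun i hi => by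
      simp [boundaryPoint, Finset.mem_compl.1 hi]

lemma boundaryPoint_pos {J : Finset (Fin d)} {lam y : Fin d → ℝ} (hlam : ∀ i ∈ J, 0 < lam i)
    (hy : ∀ i, i ∉ J → y i ∈ Set.Ioo (0 : ℝ) 1) {m : ℕ} (hm : 1 ≤ m) (i : Fin d) :
    0 < boundaryPoint J lam y m i := by
  unfold boundaryPoint
  split_ifs with h
  · have := hlam i h
    positivity
  · exact (hy i h).1

lemma eventually_sum_boundaryPoint {J : Finset (Fin d)} {lam y : Fin d → ℝ}
    (hsum : ∑ i ∈ Jᶜ, y i < 1) :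
    ∀ᶠ m : ℕ in atTop, (1 - ∑ i ∈ Jᶜ, y i) / 2 ≤ 1 - ∑ i, boundaryPoint J lam y m i := by
  have h : Tendsto (fun m : ℕ => (∑ i ∈ J, lam i) / (m : ℝ)) atTop (nhds 0) :=
    tendsto_const_div_atTop_nhds_zero_nat _
  have hpos : 0 < (1 - ∑ i ∈ Jᶜ, y i) / 2 := by linarith
  filter_upwards [h.eventually_lt_const hpos] with m hm
  rw [sum_boundaryPoint]
  linarith

lemma eventually_boundaryPoint_mem {J : Finset (Fin d)} {lam y : Fin d → ℝ}
    (hlam : ∀ i ∈ J, 0 < lam i) (hy : ∀ i, i ∉ J → y i ∈ Set.Ioo (0 : ℝ) 1)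
    (hsum : ∑ i ∈ Jᶜ, y i < 1) :
    ∀ᶠ m : ℕ in atTop, boundaryPoint J lam y m ∈ simplex d := by
  filter_upwards [eventually_sum_boundaryPoint (lam := lam) hsum, eventually_ge_atTop 1] with m hm h1
  exact mem_simplex.2 ⟨fun i => (boundaryPoint_pos hlam hy h1 i).le, by linarith⟩

/-- The multinomial vector dominates its mean with probability bounded below. -/
lemma exists_le_mexp_dominates {J : Finset (Fin d)} {lam y : Fin d → ℝ}
    (hlam : ∀ i ∈ J, 0 < lam i) (hy : ∀ i, i ∉ J → y i ∈ Set.Ioo (0 : ℝ) 1)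
    (hsum : ∑ i ∈ Jᶜ, y i < 1) :
    ∃ δ > (0 : ℝ), ∀ᶠ m : ℕ in atTop,
      δ ≤ mexp (boundaryPoint J lam y m) m (dominates (boundaryPoint J lam y m) m) := by
  set t : Fin d → ℝ := fun i => if i ∈ J then 4 * d * (lam i + 1) else 4 * d with ht
  set ρ : ℝ := (1 - ∑ i ∈ Jᶜ, y i) / 2 with hρ
  have hρ0 : 0 < ρ := by linarith
  have hd (i : Fin d) : (1 : ℝ) ≤ d := by exact_mod_cast (Fin.pos i)
  have ht4 (i : Fin d) : 4 * d ≤ t i := by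
    simp only [ht]
    split_ifs with h
    · have := hlam i h; nlinarith [hd i]
    · exact le_rfl
  have ht0 (i : Fin d) : 0 < t i := by have := ht4 i; have := hd i; linarith
  set B : ℝ := ∑ i, t i with hB
  have hB0 : 0 ≤ B := Finset.sum_nonneg fun i _ => (ht0 i).le
  set w : Fin d → ℝ := fun i => if i ∈ J then lam i else y i with hw
  have hw0 (i : Fin d) : 0 < w i := by
    simp only [hw]
    split_ifs with h
    · exact hlam i h
    · exact (hy i h).1
  set K1 : ℝ := B ^ 2 / ρ + ∑ i, t i ^ 2 / w i with hK1
  have hK10 : 0 ≤ K1 := by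
    have : 0 ≤ ∑ i, t i ^ 2 / w i := Finset.sum_nonneg fun i _ => by have := hw0 i; positivity
    positivity
  refine ⟨1 / (4 * Real.exp K1), by positivity, ?_⟩
  have hsqrt : Tendsto (fun m : ℕ => B / √(m : ℝ)) atTop (nhds 0) :=
    (Real.tendsto_sqrt_atTop.comp tendsto_natCast_atTop_atTop).const_div_atTop B
  filter_upwards [eventually_sum_boundaryPoint (lam := lam) hsum, eventually_ge_atTop 1,
    hsqrt.eventually_lt_const hρ0] with m hmρ hm1 hmB
  set x := boundaryPoint J lam y m with hx
  have hm0 : (0 : ℝ) < m := by exact_mod_cast hm1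
  have hm1' : (1 : ℝ) ≤ m := by exact_mod_cast hm1
  set s := √(m : ℝ) with hs
  have hs0 : 0 < s := Real.sqrt_pos.2 hm0
  have hss : (m : ℝ) = s * s := (Real.mul_self_sqrt hm0.le).symm
  have hs1 : 1 ≤ s := Real.one_le_sqrt.2 hm1'
  have hsm : s ≤ m := by nlinarith
  have hxpos : ∀ i, 0 < x i := boundaryPoint_pos hlam hy hm1
  set e : Fin d → ℝ := fun i => if i ∈ J then t i / m else t i / s with he
  have he0 (i : Fin d) : 0 < e i := by
    have := ht0 i
    simp only [he]; split_ifs <;> positivity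
  have hele (i : Fin d) : e i ≤ t i / s := by
    have := (ht0 i).le
    simp only [he]; split_ifs
    · gcongr
    · exact le_rfl
  have hesum : ∑ i, e i ≤ B / s := by
    rw [hB, Finset.sum_div]; exact Finset.sum_le_sum fun i _ => hele i
  have hesum0 : 0 ≤ ∑ i, e i := Finset.sum_nonneg fun i _ => (he0 i).le
  set x' : Fin d → ℝ := fun i => x i + e i with hx'
  have hx1 : ∑ i, x i < 1 := by linarith
  have hxs : x ∈ simplex d := mem_simplex.2 ⟨fun i => (hxpos i).le, hx1.le⟩
  have hx's : x' ∈ simplex d := by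
    refine mem_simplex.2 ⟨fun i => (add_pos (hxpos i) (he0 i)).le, ?_⟩
    simp only [hx', Finset.sum_add_distrib]
    linarith
  refine le_mexp_of_likelihood hxs hxpos hx1 (nonneg_of_mem_simplex hx's) (fun k => ?_)
    (Real.exp_pos K1) ?_ ?_
  · by_cases h : gridPoint m k ∈ Set.Ici x
    · exact Or.inr (Set.indicator_of_mem h _)
    · exact Or.inl (Set.indicator_of_notMem h _)
  · rw [mexp_likelihood_sq hxpos hx1]
    have hcell : (∑ i, (x' i - x i)) ^ 2 / (1 - ∑ i, x i) + ∑ i, (x' i - x i) ^ 2 / x i ≤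
        K1 / m := by
      simp only [hx', add_sub_cancel_left]
      rw [hK1, add_div, Finset.sum_div]
      refine add_le_add ?_ (Finset.sum_le_sum fun i _ => ?_)
      · calc (∑ i, e i) ^ 2 / (1 - ∑ i, x i) ≤ (B / s) ^ 2 / ρ := by gcongr
          _ = _ := by rw [hss]; field_simp
      · simp only [he, hx, boundaryPoint, hw]
        split_ifs with h
        · have := hlam i h
          apply le_of_eq; field_simp
        · have := (hy i h).1
          apply le_of_eq; rw [hss]; field_simp
    calc _ ≤ (1 + K1 / m) ^ m := by
          have : 0 ≤ (∑ i, (x' i - x i)) ^ 2 / (1 - ∑ i, x i) + ∑ i, (x' i - x i) ^ 2 / x i :=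
            add_nonneg (div_nonneg (sq_nonneg _) (by linarith))
              (Finset.sum_nonneg fun i _ => div_nonneg (sq_nonneg _) (hxpos i).le)
          gcongr
      _ ≤ Real.exp (K1 / m) ^ m := by
          gcongr
          linarith [Real.add_one_le_exp (K1 / m)]
      _ = Real.exp K1 := by rw [← Real.exp_nat_mul]; congr 1; field_simp
  · refine le_trans ?_ (one_sub_le_mexp_dominates hx's (fun i => lt_add_of_pos_right _ (he0 i)) hm1)
    have hterm (i : Fin d) : x' i / (m * (x' i - x i) ^ 2) ≤ 1 / (2 * d) := by
      have hdi := hd i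
      have h4 := ht4 i
      have h0 := ht0 i
      rw [show x' i - x i = e i by simp [hx']]
      by_cases h : i ∈ J
      · have hl := hlam i h
        have e1 : e i = t i / m := by simp [he, h]
        have e2 : x' i = (lam i + t i) / m := by simp [hx', hx, boundaryPoint, h, e1, add_div]
        have e3 : t i = 4 * d * (lam i + 1) := by simp [ht, h]
        have e4 : (lam i + t i) / m / (m * (t i / m) ^ 2) = (lam i + t i) / t i ^ 2 := by
          field_simp
        rw [e1, e2, e4, div_le_div_iff₀ (by positivity) (by positivity)]
        have h5 : lam i ≤ t i := by rw [e3]; nlinarith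
        nlinarith
      · have e1 : e i = t i / s := by simp [he, h]
        have h1 : x' i ≤ 1 := (hx's.1 i).2
        have e4 : (m : ℝ) * (t i / s) ^ 2 = t i ^ 2 := by rw [hss]; field_simp
        rw [e1, e4, div_le_div_iff₀ (by positivity) (by positivity)]
        nlinarith
    have : ∑ i, x' i / (m * (x' i - x i) ^ 2) ≤ 1 / 2 := by
      refine (Finset.sum_le_sum fun i _ => hterm i).trans ?_
      simp only [Finset.sum_const, Finset.card_univ, Fintype.card_fin, nsmul_eq_mul]
      rcases Nat.eq_zero_or_pos d with h | h
      · simp [h]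
      · have : (d : ℝ) ≠ 0 := by positivity
        apply le_of_eq; field_simp
    linarith

/-! ### Positivity and decay of the mean squared error -/

lemma zeroOn_mem {x : Fin d → ℝ} (hx : x ∈ simplex d) (J : Finset (Fin d)) :
    zeroOn J x ∈ simplex d := by
  rw [mem_simplex] at *
  have hle (i : Fin d) : zeroOn J x i ≤ x i := by
    unfold zeroOn; split_ifs
    · exact hx.1 i
    · exact le_rfl
  refine ⟨fun i => ?_, (Finset.sum_le_sum fun i _ => hle i).trans hx.2⟩
  unfold zeroOn; split_ifs
  · exact le_rfl
  · exact hx.1 i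

lemma dist1_zeroOn {J : Finset (Fin d)} {lam : Fin d → ℝ} (hlam : ∀ i ∈ J, 0 < lam i)
    (y : Fin d → ℝ) (m : ℕ) :
    dist1 (zeroOn J (boundaryPoint J lam y m)) (boundaryPoint J lam y m) =
      (∑ i ∈ J, lam i) / m := by
  rw [dist1, ← Finset.sum_add_sum_compl J, Finset.sum_div]
  rw [Finset.sum_eq_zero (s := Jᶜ), add_zero]
  · refine Finset.sum_congr rfl fun i hi => ?_
    have := hlam i hi
    simp only [zeroOn, boundaryPoint, hi, if_true, sub_zero]
    rw [abs_of_nonneg (by positivity)]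
  · intro i hi
    simp [zeroOn, Finset.mem_compl.1 hi]

lemma exists_le_near_face {F : (Fin d → ℝ) → ℝ} (hF : ContDiffOn ℝ (1 : ℕ) F (simplex d))
    {J : Finset (Fin d)} (hJ : J.Nonempty)
    (hface : ∀ x ∈ simplex d, (∃ i ∈ J, x i = 0) → F x = 0)
    {lam : Fin d → ℝ} (hlam : ∀ i ∈ J, 0 < lam i) :
    ∃ C : ℝ, 0 ≤ C ∧ ∀ (y : Fin d → ℝ) (m : ℕ), boundaryPoint J lam y m ∈ simplex d →
      |F (boundaryPoint J lam y m)| ≤ C * (m : ℝ)⁻¹ := by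
  obtain ⟨L, hL0, hL⟩ := exists_lipschitz hF
  have hlam0 : 0 ≤ ∑ i ∈ J, lam i := Finset.sum_nonneg fun i hi => (hlam i hi).le
  refine ⟨L * ∑ i ∈ J, lam i, by positivity, fun y m hx => ?_⟩
  have h := hL _ (zeroOn_mem hx J) _ hx
  obtain ⟨i, hi⟩ := hJ
  rw [hface _ (zeroOn_mem hx J) ⟨i, hi, by simp [zeroOn, hi]⟩, sub_zero, dist1_zeroOn hlam] at h
  rwa [mul_assoc, ← div_eq_mul_inv]

lemma multinomialWeight_pos {x : Fin d → ℝ} (hx : ∀ i, 0 < x i) (hx1 : ∑ i, x i < 1)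
    (k : Fin d → ℕ) (m : ℕ) : 0 < multinomialWeight k m x := by
  have h1 : 0 < 1 - ∑ i, |x i| := by
    simp only [abs_of_pos (hx _)]; linarith
  have h2 : 0 < ∏ i, x i ^ k i := Finset.prod_pos fun i _ => pow_pos (hx i) _
  unfold multinomialWeight
  positivity

lemma jointCDF_nonneg (μ : Measure (Fin d → ℝ)) (x : Fin d → ℝ) : 0 ≤ jointCDF μ x :=
  measureReal_nonneg

/-- On a fine grid, a continuous c.d.f. that is not zero has a positive Bernstein polynomial. -/
lemma eventually_bernsteinPoly_pos {μ : Measure (Fin d → ℝ)}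
    (hF : ContDiffOn ℝ (1 : ℕ) (jointCDF μ) (simplex d))
    (hne : ∃ z ∈ simplex d, jointCDF μ z ≠ 0) :
    ∀ᶠ m : ℕ in atTop, ∀ x : Fin d → ℝ, (∀ i, 0 < x i) → ∑ i, x i < 1 →
      0 < bernsteinPoly (jointCDF μ) m x := by
  obtain ⟨z, hz, hFz⟩ := hne
  obtain ⟨L, hL0, hL⟩ := exists_lipschitz hF
  have hpos : 0 < jointCDF μ z := lt_of_le_of_ne (jointCDF_nonneg μ z) (Ne.symm hFz)
  have hlim : Tendsto (fun m : ℕ => L * d / (m : ℝ)) atTop (nhds 0) :=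
    tendsto_const_div_atTop_nhds_zero_nat _
  filter_upwards [hlim.eventually_lt_const hpos, eventually_ge_atTop 1] with m hm hm1 x hx hx1
  have hm0 : (0 : ℝ) < m := by exact_mod_cast hm1
  set k : Fin d → ℕ := fun i => ⌊m * z i⌋₊ with hk
  have hz0 := nonneg_of_mem_simplex hz
  have hkle (i : Fin d) : (k i : ℝ) ≤ m * z i :=
    Nat.floor_le (mul_nonneg hm0.le (hz0 i))
  have hkgt (i : Fin d) : m * z i < k i + 1 := Nat.lt_floor_add_one _
  have hksum : ∑ i, k i ≤ m := by
    have : (∑ i, (k i : ℝ)) ≤ m := by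
      refine (Finset.sum_le_sum fun i _ => hkle i).trans ?_
      rw [← Finset.mul_sum]
      exact mul_le_of_le_one_right hm0.le (sum_le_one_of_mem hz)
    exact_mod_cast this
  have hdist : dist1 z (gridPoint m k) ≤ d / m := by
    have (i : Fin d) : |gridPoint m k i - z i| ≤ 1 / m := by
      rw [gridPoint, abs_le]
      constructor
      · rw [neg_le_iff_add_nonneg, ← sub_nonneg]
        have : 0 ≤ ((k i : ℝ) + 1 - m * z i) / m := div_nonneg (by linarith [hkgt i]) hm0.le
        have e : ((k i : ℝ) + 1 - m * z i) / m = (k i : ℝ) / m - z i + 1 / m - 0 := by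
          field_simp; ring
        linarith
      · have : (k i : ℝ) / m ≤ z i := by rw [div_le_iff₀ hm0]; linarith [hkle i]
        have : 0 ≤ 1 / (m : ℝ) := by positivity
        linarith
    calc dist1 z (gridPoint m k) ≤ ∑ _i : Fin d, 1 / (m : ℝ) := Finset.sum_le_sum fun i _ => this i
      _ = d / m := by simp; ring
  have hFk : 0 < jointCDF μ (gridPoint m k) := by
    have h1 := hL z hz _ (gridPoint_mem hksum)
    have h2 : L * dist1 z (gridPoint m k) ≤ L * d / m := by
      rw [mul_div_assoc]; gcongr
    have h3 := (abs_le.1 (h1.trans h2)).1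
    linarith
  have hw (k : Fin d → ℕ) := multinomialWeight_pos hx hx1 k m
  refine lt_of_lt_of_le (mul_pos hFk (hw k)) ?_
  exact Finset.single_le_sum (f := fun k => jointCDF μ (gridPoint m k) * multinomialWeight k m x)
    (fun k _ => mul_nonneg (jointCDF_nonneg μ _) (hw k).le) (mem_multiIndices.2 hksum)

lemma estimator_eq_zero_on_face {Ω : Type*} [MeasurableSpace Ω] {P : Measure Ω}
    {μ : Measure (Fin d → ℝ)} [IsFiniteMeasure μ] {X : ℕ → Ω → Fin d → ℝ} {J : Finset (Fin d)}
    (hlaw : ∀ i, HasLaw (X i) μ P)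
    (hface : ∀ x ∈ simplex d, (∃ i ∈ J, x i = 0) → jointCDF μ x = 0) (n : ℕ) {m : ℕ}
    {x : Fin d → ℝ} (hi : ∃ i ∈ J, x i = 0) :
    ∀ᵐ ω ∂P, bernsteinEstimator (fun i => X i ω) n m x = 0 := by
  obtain ⟨i, hiJ, hxi⟩ := hi
  have hcover : ∀ᵐ p ∂μ, coverProb x m p = 0 := by
    have h : ∀ᵐ p ∂μ, ∀ k ∈ multiIndices d m, k i = 0 → p ∉ Set.Iic (gridPoint m k) := by
      rw [Finset.eventually_all]
      intro k hk
      rw [eventually_imp_distrib_left]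
      intro hki
      have h0 := hface _ (gridPoint_mem (mem_multiIndices.1 hk)) ⟨i, hiJ, by simp [gridPoint, hki]⟩
      rw [jointCDF, measureReal_eq_zero_iff] at h0
      exact measure_eq_zero_iff_ae_notMem.1 h0
    filter_upwards [h] with p hp
    refine Finset.sum_eq_zero fun k hk => ?_
    by_cases hki : k i = 0
    · simp only [Set.indicator_of_notMem (hp k hk hki), zero_mul]
    · have : ∏ j, x j ^ k j = 0 := Finset.prod_eq_zero (Finset.mem_univ i) (by simp [hxi, hki])
      simp [multinomialWeight, this]
  have hall : ∀ᵐ ω ∂P, ∀ j, coverProb x m (X j ω) = 0 := by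
    rw [ae_all_iff]
    intro j
    have := hcover
    rw [← (hlaw j).map_eq] at this
    exact ae_of_ae_map (hlaw j).aemeasurable this
  filter_upwards [hall] with ω hω
  rw [bernsteinEstimator_eq]
  simp [hω]

section

variable {Ω : Type*} [MeasurableSpace Ω] {P : Measure Ω} [IsProbabilityMeasure P]
  {μ : Measure (Fin d → ℝ)} [IsProbabilityMeasure μ] {X : ℕ → Ω → Fin d → ℝ}

lemma mse_pos_of_lt (hlaw : ∀ i, HasLaw (X i) μ P) (hindep : iIndepFun X P) {n m : ℕ}
    (hn : 1 ≤ n) {x : Fin d → ℝ} (hx : x ∈ simplex d)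
    (hpos : 0 < bernsteinPoly (jointCDF μ) m x)
    (hlt : jointCDF μ x < mexp x m (dominates x m)) : 0 < mse P X (jointCDF μ) n m x := by
  rw [mse_eq hlaw hindep _ hn hx]
  have hn0 : (0 : ℝ) < (n : ℝ)⁻¹ := by positivity
  have hV := variance_nonneg (coverProb x m) μ
  by_contra hcon
  have hsq := sq_nonneg (bernsteinPoly (jointCDF μ) m x - jointCDF μ x)
  have hV' := mul_nonneg hn0.le hV
  have hbias : bernsteinPoly (jointCDF μ) m x = jointCDF μ x := by
    have : (bernsteinPoly (jointCDF μ) m x - jointCDF μ x) ^ 2 = 0 := by linarith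
    exact sub_eq_zero.1 (pow_eq_zero_iff two_ne_zero |>.1 this)
  have hvar : Var[coverProb x m; μ] = 0 := by
    have : (n : ℝ)⁻¹ * Var[coverProb x m; μ] = 0 := by linarith
    exact (mul_eq_zero.1 this).resolve_left hn0.ne'
  have hae := ae_eq_integral_of_variance_eq_zero (memLp_coverProb μ hx m) hvar
  rw [integral_coverProb, hbias] at hae
  have h1 := integral_indicator_mul_coverProb μ x x m
  have h2 : ∫ p, (Set.Iic x).indicator (fun _ => (1 : ℝ)) p * coverProb x m p ∂μ =
      jointCDF μ x * jointCDF μ x := by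
    rw [integral_congr_ae (g := fun p => (Set.Iic x).indicator (fun _ => (1 : ℝ)) p *
      jointCDF μ x) (hae.mono fun p hp => by simp only [hp]), integral_mul_const,
      integral_indicator_Iic]
  have h3 : jointCDF μ x * mexp x m (dominates x m) ≤
      mexp x m fun k => jointCDF μ (x ⊓ gridPoint m k) := by
    rw [← mexp_const_mul]
    refine mexp_mono hx fun k _ => ?_
    by_cases h : gridPoint m k ∈ Set.Ici x
    · rw [dominates, Set.indicator_of_mem h, mul_one, inf_eq_left.2 h]
    · rw [dominates, Set.indicator_of_notMem h, mul_zero]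
      exact jointCDF_nonneg μ _
  rw [hbias] at hpos
  nlinarith

variable {J : Finset (Fin d)} {lam y : Fin d → ℝ}

lemma eventually_mse_pos (hlaw : ∀ i, HasLaw (X i) μ P) (hindep : iIndepFun X P)
    (hF : ContDiffOn ℝ (1 : ℕ) (jointCDF μ) (simplex d)) (hJ : J.Nonempty)
    (hface : ∀ x ∈ simplex d, (∃ i ∈ J, x i = 0) → jointCDF μ x = 0)
    (hlam : ∀ i ∈ J, 0 < lam i) (hy : ∀ i, i ∉ J → y i ∈ Set.Ioo (0 : ℝ) 1)
    (hsum : ∑ i ∈ Jᶜ, y i < 1) (hne : ∃ z ∈ simplex d, jointCDF μ z ≠ 0) :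
    ∀ᶠ m : ℕ in atTop, ∀ n : ℕ, 1 ≤ n →
      0 < mse P X (jointCDF μ) n m (boundaryPoint J lam y m) := by
  obtain ⟨δ, hδ, hdom⟩ := exists_le_mexp_dominates hlam hy hsum
  obtain ⟨C, _, hC⟩ := exists_le_near_face hF hJ hface hlam
  have hlim : Tendsto (fun m : ℕ => C * (m : ℝ)⁻¹) atTop (nhds 0) := by
    simpa [div_eq_mul_inv] using tendsto_const_div_atTop_nhds_zero_nat C
  filter_upwards [hdom, hlim.eventually_lt_const hδ, eventually_boundaryPoint_mem hlam hy hsum,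
    eventually_bernsteinPoly_pos hF hne, eventually_sum_boundaryPoint (lam := lam) hsum,
    eventually_ge_atTop 1] with m h1 h2 h3 h4 h5 h6 n hn
  refine mse_pos_of_lt hlaw hindep hn h3
    (h4 _ (boundaryPoint_pos hlam hy h6) (by linarith)) ?_
  exact ((le_abs_self _).trans (hC y m h3)).trans_lt (h2.trans_le h1)

lemma exists_variance_le (hF : ContDiffOn ℝ (2 : ℕ) (jointCDF μ) (simplex d)) (hJ : J.Nonempty)
    (hface : ∀ x ∈ simplex d, (∃ i ∈ J, x i = 0) → jointCDF μ x = 0)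
    (hlam : ∀ i ∈ J, 0 < lam i) :
    ∃ C : ℝ, 0 ≤ C ∧ ∀ (y : Fin d → ℝ) (m : ℕ), 1 ≤ m → boundaryPoint J lam y m ∈ simplex d →
      Var[coverProb (boundaryPoint J lam y m) m; μ] ≤ C * (m : ℝ)⁻¹ := by
  obtain ⟨C, hC0, hC⟩ := exists_le_near_face (hF.of_le (by norm_num)) hJ hface hlam
  obtain ⟨D, hD0, hD⟩ := exists_bias_bound hF
  refine ⟨C + D, by positivity, fun y m hm hx => ?_⟩
  have hm0 : (0 : ℝ) < m := by exact_mod_cast hm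
  refine (variance_coverProb_le μ hx m).trans ?_
  have h1 := (abs_le.1 (hD m hm _ hx)).2
  have h2 := (abs_le.1 (hC y m hx)).2
  have h3 : D * ((∑ i, boundaryPoint J lam y m i) / m) ≤ D * (m : ℝ)⁻¹ := by
    rw [← one_div]; gcongr; exact sum_le_one_of_mem hx
  linarith

lemma tendsto_mse_zero (hlaw : ∀ i, HasLaw (X i) μ P) (hindep : iIndepFun X P)
    (hF : ContDiffOn ℝ (2 : ℕ) (jointCDF μ) (simplex d)) (hJ : J.Nonempty)
    (hface : ∀ x ∈ simplex d, (∃ i ∈ J, x i = 0) → jointCDF μ x = 0)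
    (hlam : ∀ i ∈ J, 0 < lam i) (hy : ∀ i, i ∉ J → y i ∈ Set.Ioo (0 : ℝ) 1)
    (hsum : ∑ i ∈ Jᶜ, y i < 1) {n : ℕ} (hn : 1 ≤ n) :
    Tendsto (fun m => mse P X (jointCDF μ) n m (boundaryPoint J lam y m)) atTop (nhds 0) := by
  obtain ⟨C, hC0, hC⟩ := exists_variance_le hF hJ hface hlam
  obtain ⟨D, hD0, hD⟩ := exists_bias_bound hF
  have hinv : Tendsto (fun m : ℕ => (m : ℝ)⁻¹) atTop (nhds 0) :=
    tendsto_inv_atTop_nhds_zero_nat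
  have hlim : Tendsto (fun m : ℕ => C * (m : ℝ)⁻¹ + (D * (m : ℝ)⁻¹) ^ 2) atTop (nhds 0) := by
    simpa using (hinv.const_mul C).add ((hinv.const_mul D).pow 2)
  refine tendsto_of_tendsto_of_tendsto_of_le_of_le' tendsto_const_nhds hlim ?_ ?_
  · exact Eventually.of_forall fun m => integral_nonneg fun ω => sq_nonneg _
  · filter_upwards [eventually_boundaryPoint_mem hlam hy hsum, eventually_ge_atTop 1] with m hx hm
    have hm0 : (0 : ℝ) < m := by exact_mod_cast hm
    rw [mse_eq hlaw hindep _ hn hx]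
    have h1 : (n : ℝ)⁻¹ * Var[coverProb (boundaryPoint J lam y m) m; μ] ≤ C * (m : ℝ)⁻¹ :=
      (mul_le_of_le_one_left (variance_nonneg _ _)
        (inv_le_one_of_one_le₀ (by exact_mod_cast hn))).trans (hC y m hm hx)
    have h3 : D * ((∑ i, boundaryPoint J lam y m i) / m) ≤ D * (m : ℝ)⁻¹ := by
      rw [← one_div]; gcongr; exact sum_le_one_of_mem hx
    have h2 := sq_le_sq' (by linarith [(abs_le.1 (hD m hm _ hx)).1])
      ((abs_le.1 (hD m hm _ hx)).2.trans h3)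
    linarith

end

/-! ### The variance expansion -/

lemma zeroOn_univ (x : Fin d → ℝ) : zeroOn Finset.univ x = 0 := by
  ext i; simp [zeroOn]

lemma zeroOn_empty (x : Fin d → ℝ) : zeroOn ∅ x = x := by
  ext i; simp [zeroOn]

lemma boundaryPoint_empty (lam y : Fin d → ℝ) (m : ℕ) : boundaryPoint ∅ lam y m = y := by
  ext i; simp [boundaryPoint]

/-- The factor `λ (1 - exp (-2 λ) (I₀ (2 λ) + I₁ (2 λ)))`. -/
def poissonFactor (l : ℝ) : ℝ :=
  l * (1 - Real.exp (-2 * l) * (besselI 0 (2 * l) + besselI 1 (2 * l)))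

lemma variance_expansion_univ {μ : Measure (Fin d → ℝ)} [IsProbabilityMeasure μ]
    (hF : ContDiffOn ℝ (2 : ℕ) (jointCDF μ) (simplex d))
    (hne : (Finset.univ : Finset (Fin d)).Nonempty)
    (hface : ∀ x ∈ simplex d, (∃ i ∈ Finset.univ, x i = 0) → jointCDF μ x = 0)
    {lam : Fin d → ℝ} (hlam : ∀ i, 0 < lam i) :
    ∃ C : ℝ, ∀ (y : Fin d → ℝ) (m : ℕ), 1 ≤ m →
      boundaryPoint Finset.univ lam y m ∈ simplex d →
      |Var[coverProb (boundaryPoint Finset.univ lam y m) m; μ] -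
        (m : ℝ)⁻¹ * ∑ i, pderiv i (jointCDF μ) 0 * poissonFactor (lam i)| ≤
        C * ((m : ℝ) ^ 2)⁻¹ := by
  set F := jointCDF μ with hFdef
  have hlamJ : ∀ i ∈ Finset.univ, 0 < lam i := fun i _ => hlam i
  have h0S : (0 : Fin d → ℝ) ∈ simplex d := mem_simplex.2 ⟨fun _ => le_rfl, by simp⟩
  have hF0 : F 0 = 0 := by
    obtain ⟨i, hi⟩ := hne
    exact hface 0 h0S ⟨i, hi, rfl⟩
  set Λ : ℝ := ∑ i, lam i with hΛ
  have hΛ0 : 0 ≤ Λ := Finset.sum_nonneg fun i _ => (hlam i).le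
  obtain ⟨C1, hC10, hC1⟩ := second_moment_expansion hF
  obtain ⟨C2, hC20, hC2⟩ := exists_taylor_two hF
  have hd1 (i : Fin d) : ContDiffOn ℝ (1 : ℕ) (pderiv i F) (simplex d) := ContDiffOn.pderiv hF i
  choose L hL0 hL using fun i => exists_lipschitz (hd1 i)
  choose C3 hC3 using fun i => mexp_mexp_abs_sub_bessel (d := d) (hlam i).le
  obtain ⟨C4, hC40, hC4⟩ := exists_bias_bound hF
  obtain ⟨C5, hC50, hC5⟩ := exists_le_near_face (hF.of_le (by norm_num)) hne hface hlamJ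
  set K : Fin d → ℝ := fun i => L i * Λ * (2 * lam i) + |pderiv i F 0| * C3 i with hK
  refine ⟨C1 * Λ + C2 * Λ ^ 2 + (∑ i, K i) / 2 + (C4 + C5) ^ 2, fun y m hm hx => ?_⟩
  set x := boundaryPoint Finset.univ lam y m with hxdef
  have hm0 : (0 : ℝ) < m := by exact_mod_cast hm
  have hxi (i : Fin d) : x i = lam i / m := by simp [hxdef, boundaryPoint]
  have hsum : ∑ i, x i = Λ / m := by simp only [hxi, hΛ, Finset.sum_div]
  have hdist : dist1 0 x = Λ / m := by
    have := dist1_zeroOn hlamJ y m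
    rwa [zeroOn_univ] at this
  have e1 := hC1 m hm x hx
  have e2 := hC2 0 h0S x hx
  rw [hdist, hF0, sub_zero] at e2
  rw [hsum] at e1
  have htay : taylorOne F 0 x = (m : ℝ)⁻¹ * ∑ i, lam i * pderiv i F 0 := by
    simp only [taylorOne, hxi, Finset.mul_sum, Pi.zero_apply, sub_zero]
    exact Finset.sum_congr rfl fun i _ => by ring
  rw [htay] at e2
  set B := bernsteinPoly F m x with hB
  have e4 : |B| ≤ (C4 + C5) * (m : ℝ)⁻¹ := by
    have h1 := hC4 m hm x hx
    have h2 := hC5 y m hx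
    have h3 : C4 * ((∑ i, x i) / m) ≤ C4 * (m : ℝ)⁻¹ := by
      rw [← one_div]; gcongr; exact sum_le_one_of_mem hx
    have : B = (B - F x) + F x := by ring
    rw [this]
    refine (abs_add_le _ _).trans ?_
    linarith
  have e5 : B ^ 2 ≤ (C4 + C5) ^ 2 * ((m : ℝ) ^ 2)⁻¹ := by
    have := pow_le_pow_left₀ (abs_nonneg B) e4 2
    rwa [sq_abs, mul_pow, inv_pow] at this
  set r : Fin d → ℝ := fun i =>
    Real.exp (-2 * lam i) * (besselI 0 (2 * lam i) + besselI 1 (2 * lam i)) with hr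
  have e6 : |∑ i, ((pderiv i F x - pderiv i F 0) * meanDist x m i +
      pderiv i F 0 * (meanDist x m i - 2 * (lam i * r i)))| ≤ (∑ i, K i) * (m : ℝ)⁻¹ := by
    rw [Finset.sum_mul]
    refine (Finset.abs_sum_le_sum_abs _ _).trans (Finset.sum_le_sum fun i _ => ?_)
    refine (abs_add_le _ _).trans ?_
    rw [abs_mul, abs_mul, abs_of_nonneg (meanDist_nonneg hx m i)]
    have h1 := hL i 0 h0S x hx
    rw [hdist] at h1
    have h2 := meanDist_le hx m i
    rw [hxi, mul_div_cancel₀ _ hm0.ne'] at h2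
    have h3 := hC3 i m x i hm hx (hxi i)
    calc _ ≤ L i * (Λ / m) * (2 * lam i) + |pderiv i F 0| * (C3 i * (m : ℝ)⁻¹) := by
          have := hL0 i
          have := meanDist_nonneg hx m i
          gcongr
          exact h3
      _ = K i * (m : ℝ)⁻¹ := by rw [hK]; ring
  rw [variance_coverProb μ hx]
  have hsplit : (mexp x m fun k => mexp x m fun l => F (gridPoint m (k ⊓ l))) - B ^ 2 -
        (m : ℝ)⁻¹ * ∑ i, pderiv i F 0 * poissonFactor (lam i) =
      ((mexp x m fun k => mexp x m fun l => F (gridPoint m (k ⊓ l))) - F x +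
        (2 * m : ℝ)⁻¹ * ∑ i, pderiv i F x * meanDist x m i) +
      (F x - (m : ℝ)⁻¹ * ∑ i, lam i * pderiv i F 0) -
      (2 * m : ℝ)⁻¹ * (∑ i, ((pderiv i F x - pderiv i F 0) * meanDist x m i +
        pderiv i F 0 * (meanDist x m i - 2 * (lam i * r i)))) - B ^ 2 := by
    have : ∑ i, ((pderiv i F x - pderiv i F 0) * meanDist x m i +
        pderiv i F 0 * (meanDist x m i - 2 * (lam i * r i))) =
        ∑ i, pderiv i F x * meanDist x m i + 2 * ∑ i, pderiv i F 0 * poissonFactor (lam i) -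
          2 * ∑ i, lam i * pderiv i F 0 := by
      rw [Finset.mul_sum, Finset.mul_sum, ← Finset.sum_add_distrib, ← Finset.sum_sub_distrib]
      refine Finset.sum_congr rfl fun i _ => ?_
      simp only [poissonFactor, hr]
      ring
    rw [this]
    field_simp
    ring
  rw [hsplit]
  have t1 := abs_le.1 e1
  have t2 := abs_le.1 e2
  have e7 : |(2 * m : ℝ)⁻¹ * (∑ i, ((pderiv i F x - pderiv i F 0) * meanDist x m i +
        pderiv i F 0 * (meanDist x m i - 2 * (lam i * r i))))| ≤
        (∑ i, K i) / 2 * ((m : ℝ) ^ 2)⁻¹ := by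
    rw [abs_mul, abs_of_pos (by positivity : (0 : ℝ) < (2 * m : ℝ)⁻¹)]
    calc _ ≤ (2 * m : ℝ)⁻¹ * ((∑ i, K i) * (m : ℝ)⁻¹) := by gcongr
      _ = _ := by field_simp
  have t3 := abs_le.1 e7
  have f1 : C1 * (Λ / m / m) = C1 * Λ * ((m : ℝ) ^ 2)⁻¹ := by field_simp
  have f2 : C2 * (Λ / m) ^ 2 = C2 * Λ ^ 2 * ((m : ℝ) ^ 2)⁻¹ := by field_simp
  rw [f1] at t1
  rw [f2] at t2
  have hB0 := sq_nonneg B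
  rw [abs_le]
  constructor <;> linarith [t1.1, t1.2, t2.1, t2.2, t3.1, t3.2]

lemma bernsteinPoly_mem {μ : Measure (Fin d → ℝ)} [IsProbabilityMeasure μ] {x : Fin d → ℝ}
    (hx : x ∈ simplex d) (m : ℕ) : bernsteinPoly (jointCDF μ) m x ∈ Set.Icc (0 : ℝ) 1 := by
  rw [bernsteinPoly_eq]
  refine ⟨mexp_nonneg hx fun k _ => jointCDF_nonneg μ _, ?_⟩
  rw [← mexp_one x (nonneg_of_mem_simplex hx) m]
  exact mexp_mono hx fun k _ => measureReal_le_one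

lemma variance_expansion_interior {μ : Measure (Fin d → ℝ)} [IsProbabilityMeasure μ]
    (hF : ContDiffOn ℝ (2 : ℕ) (jointCDF μ) (simplex d)) {x : Fin d → ℝ} (hx : x ∈ simplex d)
    (hx01 : ∀ i, x i ∈ Set.Ioo (0 : ℝ) 1) :
    Tendsto (fun m : ℕ => √(m : ℝ) * (Var[coverProb x m; μ] -
        jointCDF μ x * (1 - jointCDF μ x)) +
        ∑ i, pderiv i (jointCDF μ) x * √(Real.pi⁻¹ * (x i * (1 - x i)))) atTop (nhds 0) := by
  set F := jointCDF μ with hFdef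
  have hx0 := nonneg_of_mem_simplex hx
  obtain ⟨C1, hC10, hC1⟩ := second_moment_expansion hF
  obtain ⟨C4, hC40, hC4⟩ := exists_bias_bound hF
  have hinv : Tendsto (fun m : ℕ => (√(m : ℝ))⁻¹) atTop (nhds 0) :=
    tendsto_inv_atTop_zero.comp (Real.tendsto_sqrt_atTop.comp tendsto_natCast_atTop_atTop)
  have hS : Tendsto (fun m : ℕ => ∑ i, pderiv i F x *
      (2⁻¹ * (meanDist x m i / √(m : ℝ)) - √(Real.pi⁻¹ * (x i * (1 - x i))))) atTop (nhds 0) := by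
    have : (0 : ℝ) = ∑ i, pderiv i F x * (2⁻¹ * (2 * √(Real.pi⁻¹ * (x i * (1 - x i)))) -
        √(Real.pi⁻¹ * (x i * (1 - x i)))) := by
      simp
    rw [this]
    exact tendsto_finsetSum _ fun i _ =>
      (((tendsto_mexp_mexp_abs_sub hx0 (hx01 i)).const_mul 2⁻¹).sub_const _).const_mul _
  have hR : Tendsto (fun m : ℕ => √(m : ℝ) * (Var[coverProb x m; μ] - F x * (1 - F x)) +
        ∑ i, pderiv i F x * √(Real.pi⁻¹ * (x i * (1 - x i))) +
        ∑ i, pderiv i F x *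
          (2⁻¹ * (meanDist x m i / √(m : ℝ)) - √(Real.pi⁻¹ * (x i * (1 - x i))))) atTop
      (nhds 0) := by
    refine squeeze_zero_norm' (a := fun m : ℕ => (C1 + 2 * C4) * (√(m : ℝ))⁻¹) ?_
      (by simpa using hinv.const_mul (C1 + 2 * C4))
    filter_upwards [eventually_ge_atTop 1] with m hm
    have hm0 : (0 : ℝ) < m := by exact_mod_cast hm
    set s := √(m : ℝ) with hs
    have hs0 : 0 < s := Real.sqrt_pos.2 hm0
    have hss : (m : ℝ) = s * s := (Real.mul_self_sqrt hm0.le).symm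
    rw [variance_coverProb μ hx]
    set B := bernsteinPoly F m x with hB
    set V := mexp x m fun k => mexp x m fun l => F (gridPoint m (k ⊓ l)) with hV
    have hsplit : s * (V - B ^ 2 - F x * (1 - F x)) +
          ∑ i, pderiv i F x * √(Real.pi⁻¹ * (x i * (1 - x i))) +
          ∑ i, pderiv i F x * (2⁻¹ * (meanDist x m i / s) - √(Real.pi⁻¹ * (x i * (1 - x i)))) =
        s * (V - F x + (2 * m : ℝ)⁻¹ * ∑ i, pderiv i F x * meanDist x m i) -
          s * ((B - F x) * (B + F x)) := by
      rw [add_assoc, ← Finset.sum_add_distrib]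
      have : ∑ i, (pderiv i F x * √(Real.pi⁻¹ * (x i * (1 - x i))) +
          pderiv i F x * (2⁻¹ * (meanDist x m i / s) - √(Real.pi⁻¹ * (x i * (1 - x i))))) =
          (2 * s)⁻¹ * ∑ i, pderiv i F x * meanDist x m i := by
        rw [Finset.mul_sum]
        exact Finset.sum_congr rfl fun i _ => by field_simp; ring
      rw [this, hss]
      field_simp
      ring
    have hsum : (∑ i, x i) / m ≤ (m : ℝ)⁻¹ := by
      rw [← one_div]; gcongr; exact sum_le_one_of_mem hx
    have e1 : |V - F x + (2 * m : ℝ)⁻¹ * ∑ i, pderiv i F x * meanDist x m i| ≤ C1 * (m : ℝ)⁻¹ :=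
      (hC1 m hm x hx).trans (mul_le_mul_of_nonneg_left hsum hC10)
    have e2 : |B - F x| ≤ C4 * (m : ℝ)⁻¹ :=
      (hC4 m hm x hx).trans (mul_le_mul_of_nonneg_left hsum hC40)
    have e3 : |B + F x| ≤ 2 := by
      have h1 := bernsteinPoly_mem (μ := μ) hx m
      have h2 : F x ≤ 1 := measureReal_le_one
      have h3 : 0 ≤ F x := jointCDF_nonneg μ x
      rw [abs_le]
      constructor <;> linarith [h1.1, h1.2]
    rw [Real.norm_eq_abs, hsplit]
    refine (abs_sub _ _).trans ?_
    rw [abs_mul, abs_mul, abs_mul, abs_of_pos hs0]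
    calc _ ≤ s * (C1 * (m : ℝ)⁻¹) + s * (C4 * (m : ℝ)⁻¹ * 2) := by gcongr
      _ = (C1 + 2 * C4) * s⁻¹ := by rw [hss]; field_simp
  simpa using hR.sub hS

/-! ### The bias expansion -/

lemma exists_biasTerm_bound {F : (Fin d → ℝ) → ℝ} (hF : ContDiffOn ℝ (2 : ℕ) F (simplex d))
    (J : Finset (Fin d)) {lam : Fin d → ℝ} :
    ∃ C : ℝ, 0 ≤ C ∧ ∀ x ∈ simplex d, ∀ m : ℕ, 1 ≤ m → |biasTerm F J lam x m| ≤ C * (m : ℝ)⁻¹ := by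
  have hd2 (i j : Fin d) : ContDiffOn ℝ (0 : ℕ) (pderiv i (pderiv j F)) (simplex d) :=
    ContDiffOn.pderiv (ContDiffOn.pderiv (n := (1 : ℕ)) hF j) i
  choose B hB0 hB using fun i j => exists_bound_on_simplex (hd2 i j).continuousOn
  refine ⟨∑ i ∈ Jᶜ, ∑ j ∈ Jᶜ, B i j + |∑ i ∈ J, lam i * pderiv i (pderiv i F) 0|,
    add_nonneg (Finset.sum_nonneg fun i _ => Finset.sum_nonneg fun j _ => hB0 i j) (abs_nonneg _),
    fun x hx m hm => ?_⟩
  have hm0 : (0 : ℝ) < m := by exact_mod_cast hm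
  have hm1 : (1 : ℝ) ≤ m := by exact_mod_cast hm
  have hz := zeroOn_mem hx J
  rw [biasTerm, add_mul]
  refine (abs_add_le _ _).trans (add_le_add ?_ ?_)
  · rw [abs_mul, mul_comm]
    refine mul_le_mul ?_ ?_ (abs_nonneg _)
      (Finset.sum_nonneg fun i _ => Finset.sum_nonneg fun j _ => hB0 i j)
    · refine (Finset.abs_sum_le_sum_abs _ _).trans (Finset.sum_le_sum fun i _ => ?_)
      refine (Finset.abs_sum_le_sum_abs _ _).trans (Finset.sum_le_sum fun j _ => ?_)
      rw [abs_mul]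
      refine (mul_le_of_le_one_left (abs_nonneg _) ?_).trans (hB i j _ hz)
      have h1 := hx.1 i
      have h2 := hx.1 j
      simp only [Set.mem_Icc] at h1 h2
      have h3 : 0 ≤ x i * x j := mul_nonneg h1.1 h2.1
      have h4 : x i * x j ≤ 1 := mul_le_one₀ h1.2 h2.1 h2.2
      rw [abs_le]
      split_ifs <;> constructor <;> linarith
    · rw [abs_of_pos (by positivity), one_div]
      gcongr
      linarith
  · rw [abs_mul, mul_comm]
    gcongr
    rw [abs_of_pos (by positivity), one_div]
    gcongr
    nlinarith

/-- The bias at the boundary point, uniformly in the free coordinates. -/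
lemma bias_expansion_boundary {F : (Fin d → ℝ) → ℝ} (hF : ContDiffOn ℝ (3 : ℕ) F (simplex d))
    (J : Finset (Fin d)) {lam : Fin d → ℝ} (hlam : ∀ i ∈ J, 0 < lam i) {ε : ℝ} (hε : 0 < ε) :
    ∃ M : ℕ, ∀ (y : Fin d → ℝ) (m : ℕ), 1 ≤ m → M ≤ m → boundaryPoint J lam y m ∈ simplex d →
      |bernsteinPoly F m (boundaryPoint J lam y m) - F (boundaryPoint J lam y m) -
        biasTerm F J lam (boundaryPoint J lam y m) m| ≤ ε * ((m : ℝ) * √(m : ℝ))⁻¹ := by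
  have hd2 (i j : Fin d) : ContDiffOn ℝ (1 : ℕ) (pderiv i (pderiv j F)) (simplex d) :=
    ContDiffOn.pderiv (ContDiffOn.pderiv (n := (2 : ℕ)) hF j) i
  choose B hB0 hB using fun i j => exists_bound_on_simplex (hd2 i j).continuousOn
  choose L hL0 hL using fun i j => exists_lipschitz (hd2 i j)
  obtain ⟨M1, hM1⟩ := bias_expansion hF (half_pos hε)
  set Λ : ℝ := ∑ i ∈ J, lam i with hΛ
  have hΛ0 : 0 ≤ Λ := Finset.sum_nonneg fun i hi => (hlam i hi).le
  set K : ℝ := ∑ i, ∑ j, (2 * Λ * B i j + L i j * Λ) + |∑ i ∈ J, lam i * pderiv i (pderiv i F) 0|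
    with hK
  have hKterm (i j : Fin d) : 0 ≤ 2 * Λ * B i j + L i j * Λ := by
    have := hB0 i j
    have := hL0 i j
    positivity
  have hK0 : 0 ≤ K := add_nonneg (Finset.sum_nonneg fun i _ => Finset.sum_nonneg fun j _ =>
    hKterm i j) (abs_nonneg _)
  refine ⟨max M1 ⌈(2 * K / ε) ^ 2⌉₊, fun y m hm hM hx => ?_⟩
  have hm0 : (0 : ℝ) < m := by exact_mod_cast hm
  set x := boundaryPoint J lam y m with hxdef
  set s := √(m : ℝ) with hs
  have hs0 : 0 < s := Real.sqrt_pos.2 hm0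
  have hss : (m : ℝ) = s * s := (Real.mul_self_sqrt hm0.le).symm
  have hsK : 2 * K / ε ≤ s := Real.le_sqrt_of_sq_le
    ((Nat.le_ceil _).trans (by exact_mod_cast (le_max_right _ _).trans hM))
  have hz := zeroOn_mem hx J
  have e1 := hM1 m hm ((le_max_left _ _).trans hM) x hx
  have hxJ (i : Fin d) (hi : i ∈ J) : x i ≤ Λ / m := by
    have : x i = lam i / m := by simp [hxdef, boundaryPoint, hi]
    rw [this]
    gcongr
    exact Finset.single_le_sum (f := lam) (fun i hi => (hlam i hi).le) hi
  have hcoef (i j : Fin d) (h : i ∈ J ∨ j ∈ J) :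
      |(if i = j then x i else 0) - x i * x j| ≤ 2 * (Λ / m) := by
    have h1 := hx.1 i
    have h2 := hx.1 j
    simp only [Set.mem_Icc] at h1 h2
    have hdiag : (if i = j then x i else 0) ≤ Λ / m ∧ 0 ≤ (if i = j then x i else 0) := by
      split_ifs with hij
      · subst hij
        exact ⟨hxJ i (h.elim id id), h1.1⟩
      · exact ⟨by positivity, le_rfl⟩
    have hprod : x i * x j ≤ Λ / m ∧ 0 ≤ x i * x j := by
      refine ⟨?_, mul_nonneg h1.1 h2.1⟩
      rcases h with h | h
      · exact (mul_le_of_le_one_right h1.1 h2.2).trans (hxJ i h)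
      · exact (mul_le_of_le_one_left h2.1 h1.2).trans (hxJ j h)
    rw [abs_le]
    constructor <;> linarith [hdiag.1, hdiag.2, hprod.1, hprod.2]
  have hΛm : 0 ≤ Λ / m := by positivity
  have hterm (i j : Fin d) : |((if i = j then x i else 0) - x i * x j) * pderiv i (pderiv j F) x -
      (if i ∈ Jᶜ then if j ∈ Jᶜ then ((if i = j then x i else 0) - x i * x j) *
        pderiv i (pderiv j F) (zeroOn J x) else 0 else 0)| ≤
      (2 * Λ * B i j + L i j * Λ) * (m : ℝ)⁻¹ := by
    have hb : 0 ≤ 2 * (Λ / m) * B i j := mul_nonneg (by positivity) (hB0 i j)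
    have hl : 0 ≤ L i j * (Λ / m) := mul_nonneg (hL0 i j) hΛm
    have e : (2 * Λ * B i j + L i j * Λ) * (m : ℝ)⁻¹ =
      2 * (Λ / m) * B i j + L i j * (Λ / m) := by field_simp
    rw [e]
    by_cases h : i ∈ J ∨ j ∈ J
    · have : (if i ∈ Jᶜ then if j ∈ Jᶜ then ((if i = j then x i else 0) - x i * x j) *
        pderiv i (pderiv j F) (zeroOn J x) else 0 else 0) = 0 := by
        rcases h with h | h <;> simp [h]
      rw [this, sub_zero, abs_mul]
      have := mul_le_mul (hcoef i j h) (hB i j x hx) (abs_nonneg _) (by positivity)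
      linarith
    · push Not at h
      rw [if_pos (Finset.mem_compl.2 h.1), if_pos (Finset.mem_compl.2 h.2), ← mul_sub, abs_mul]
      have h1 := hx.1 i
      have h2 := hx.1 j
      simp only [Set.mem_Icc] at h1 h2
      have h3 : 0 ≤ x i * x j := mul_nonneg h1.1 h2.1
      have h4 : x i * x j ≤ 1 := mul_le_one₀ h1.2 h2.1 h2.2
      have h5 : |(if i = j then x i else 0) - x i * x j| ≤ 1 := by
        rw [abs_le]
        split_ifs <;> constructor <;> linarith
      have h6 := hL i j _ hz x hx
      rw [hxdef, dist1_zeroOn hlam, ← hxdef] at h6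
      have := mul_le_mul h5 h6 (abs_nonneg _) zero_le_one
      linarith
  set T1 : ℝ := ∑ i, ∑ j, ((if i = j then x i else 0) - x i * x j) * pderiv j (pderiv i F) x
    with hT1
  set T2 : ℝ := ∑ i ∈ Jᶜ, ∑ j ∈ Jᶜ, ((if i = j then x i else 0) - x i * x j) *
        pderiv i (pderiv j F) (zeroOn J x) with hT2
  have hT1' : T1 = ∑ i, ∑ j, ((if i = j then x i else 0) - x i * x j) *
      pderiv i (pderiv j F) x := by
    rw [hT1, Finset.sum_comm]
    refine Finset.sum_congr rfl fun i _ => Finset.sum_congr rfl fun j _ => ?_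
    rw [mul_comm (x j)]
    by_cases h : i = j
    · subst h; simp
    · simp [h, Ne.symm h]
  have hT2' : T2 = ∑ i, ∑ j, (if i ∈ Jᶜ then if j ∈ Jᶜ then
      ((if i = j then x i else 0) - x i * x j) * pderiv i (pderiv j F) (zeroOn J x) else 0
        else 0) := by
    rw [hT2, ← Finset.sum_filter_add_sum_filter_not Finset.univ (· ∈ Jᶜ)
      (fun i => ∑ j, (if i ∈ Jᶜ then if j ∈ Jᶜ then
      ((if i = j then x i else 0) - x i * x j) * pderiv i (pderiv j F) (zeroOn J x) else 0
        else 0))]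
    rw [Finset.sum_eq_zero (s := Finset.univ.filter (¬ · ∈ Jᶜ)), add_zero, Finset.filter_univ_mem]
    · refine Finset.sum_congr rfl fun i hi => ?_
      simp only [hi, if_true]
      rw [← Finset.sum_filter, Finset.filter_univ_mem]
    · intro i hi
      have := (Finset.mem_filter.1 hi).2
      simp [this]
  have hT : |T1 - T2| ≤ (∑ i, ∑ j, (2 * Λ * B i j + L i j * Λ)) * (m : ℝ)⁻¹ := by
    rw [hT1', hT2', ← Finset.sum_sub_distrib, Finset.sum_mul]
    refine (Finset.abs_sum_le_sum_abs _ _).trans (Finset.sum_le_sum fun i _ => ?_)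
    rw [← Finset.sum_sub_distrib, Finset.sum_mul]
    exact (Finset.abs_sum_le_sum_abs _ _).trans (Finset.sum_le_sum fun j _ => hterm i j)
  set Q : ℝ := ∑ i ∈ J, lam i * pderiv i (pderiv i F) 0 with hQ
  have hsplit : bernsteinPoly F m x - F x - biasTerm F J lam x m =
      (bernsteinPoly F m x - F x - (2 * m : ℝ)⁻¹ * T1) +
        ((2 * m : ℝ)⁻¹ * (T1 - T2) - (2 * (m : ℝ) ^ 2)⁻¹ * Q) := by
    rw [biasTerm, one_div, one_div]
    ring
  rw [hsplit]
  refine (abs_add_le _ _).trans ?_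
  have e2 : |(2 * m : ℝ)⁻¹ * (T1 - T2) - (2 * (m : ℝ) ^ 2)⁻¹ * Q| ≤ K * ((m : ℝ) ^ 2)⁻¹ := by
    refine (abs_sub _ _).trans ?_
    rw [abs_mul, abs_mul, abs_of_pos (by positivity : (0 : ℝ) < (2 * m : ℝ)⁻¹),
      abs_of_pos (by positivity : (0 : ℝ) < (2 * (m : ℝ) ^ 2)⁻¹)]
    have h1 : (2 * m : ℝ)⁻¹ * |T1 - T2| ≤
        (m : ℝ)⁻¹ * ((∑ i, ∑ j, (2 * Λ * B i j + L i j * Λ)) * (m : ℝ)⁻¹) := by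
      gcongr
      linarith
    have h2 : (2 * (m : ℝ) ^ 2)⁻¹ * |Q| ≤ ((m : ℝ) ^ 2)⁻¹ * |Q| := by
      gcongr
      nlinarith
    have h3 : K * ((m : ℝ) ^ 2)⁻¹ = (m : ℝ)⁻¹ * ((∑ i, ∑ j, (2 * Λ * B i j + L i j * Λ)) *
      (m : ℝ)⁻¹) + ((m : ℝ) ^ 2)⁻¹ * |Q| := by rw [hK]; field_simp
    linarith
  have e3 : K * ((m : ℝ) ^ 2)⁻¹ ≤ ε / 2 * ((m : ℝ) * s)⁻¹ := by
    have e : ε / 2 * ((m : ℝ) * s)⁻¹ = (ε / 2 * s) * ((m : ℝ) ^ 2)⁻¹ := by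
      rw [hss]; field_simp
    rw [e]
    gcongr
    rw [div_le_iff₀ hε] at hsK
    linarith
  linarith

/-! ### The error terms of the expansion -/

section

variable {μ : Measure (Fin d → ℝ)} [IsProbabilityMeasure μ] {J : Finset (Fin d)}
  {lam : Fin d → ℝ}

lemma variance_error_univ (hF : ContDiffOn ℝ (2 : ℕ) (jointCDF μ) (simplex d))
    (hface : ∀ x ∈ simplex d, (∃ i ∈ (Finset.univ : Finset (Fin d)), x i = 0) → jointCDF μ x = 0)
    (hlam : ∀ i, 0 < lam i) :
    ∃ C : ℝ, ∀ (y : Fin d → ℝ) (n m : ℕ), 1 ≤ m →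
      boundaryPoint Finset.univ lam y m ∈ simplex d →
      |(n : ℝ)⁻¹ * Var[coverProb (boundaryPoint Finset.univ lam y m) m; μ] -
        varianceTerm (jointCDF μ) Finset.univ lam (boundaryPoint Finset.univ lam y m) n m| ≤
        C * ((n : ℝ)⁻¹ * ((m : ℝ) ^ 2)⁻¹) := by
  rcases (Finset.univ : Finset (Fin d)).eq_empty_or_nonempty with he | hne
  · refine ⟨0, fun y n m hm hx => ?_⟩
    have : IsEmpty (Fin d) := Finset.univ_eq_empty_iff.1 he
    have hone (z : Fin d → ℝ) : jointCDF μ z = 1 := by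
      have : Set.Iic z = Set.univ := Set.eq_univ_of_forall fun p i => isEmptyElim i
      simp [jointCDF, this]
    rw [variance_coverProb μ hx, bernsteinPoly_eq]
    simp only [hone, mexp_const _ (nonneg_of_mem_simplex hx), varianceTerm]
    simp
  · obtain ⟨C, hC⟩ := variance_expansion_univ hF hne hface hlam
    refine ⟨C, fun y n m hm hx => ?_⟩
    have h := hC y m hm hx
    have e : (n : ℝ)⁻¹ * Var[coverProb (boundaryPoint Finset.univ lam y m) m; μ] -
        varianceTerm (jointCDF μ) Finset.univ lam (boundaryPoint Finset.univ lam y m) n m =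
        (n : ℝ)⁻¹ * (Var[coverProb (boundaryPoint Finset.univ lam y m) m; μ] -
        (m : ℝ)⁻¹ * ∑ i, pderiv i (jointCDF μ) 0 * poissonFactor (lam i)) := by
      simp only [varianceTerm, zeroOn_univ, Finset.mem_univ, if_true, not_true_eq_false, if_false,
        hne.ne_empty, sub_zero, add_zero, poissonFactor]
      ring
    rw [e, abs_mul, abs_of_nonneg (by positivity : (0 : ℝ) ≤ (n : ℝ)⁻¹), mul_left_comm]
    gcongr

lemma variance_error_empty (hF : ContDiffOn ℝ (2 : ℕ) (jointCDF μ) (simplex d)) (y : Fin d → ℝ)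
    {ε : ℝ} (hε : 0 < ε) :
    ∃ M : ℕ, ∀ n m : ℕ, M ≤ m → Admissible ∅ lam y m →
      |(n : ℝ)⁻¹ * Var[coverProb (boundaryPoint ∅ lam y m) m; μ] -
        varianceTerm (jointCDF μ) ∅ lam (boundaryPoint ∅ lam y m) n m| ≤
        ε * ((n : ℝ)⁻¹ * (√(m : ℝ))⁻¹) := by
  simp only [Admissible, boundaryPoint_empty]
  by_cases hy : (∀ i, i ∉ (∅ : Finset (Fin d)) → y i ∈ Set.Ioo (0 : ℝ) 1) ∧ y ∈ simplex d
  · have h := variance_expansion_interior hF hy.2 fun i => hy.1 i (by simp)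
    obtain ⟨M, hM⟩ := Metric.tendsto_atTop.1 h ε hε
    refine ⟨M, fun n m hm ha => ?_⟩
    have hm1 := ha.1
    have hm0 : (0 : ℝ) < m := by exact_mod_cast hm1
    have h1 := hM m hm
    rw [Real.dist_0_eq_abs] at h1
    set s := √(m : ℝ) with hs
    have hs0 : 0 < s := Real.sqrt_pos.2 hm0
    have hss : (m : ℝ) = s * s := (Real.mul_self_sqrt hm0.le).symm
    have e : (n : ℝ)⁻¹ * Var[coverProb y m; μ] - varianceTerm (jointCDF μ) ∅ lam y n m =
        (n : ℝ)⁻¹ * s⁻¹ * (s * (Var[coverProb y m; μ] - jointCDF μ y * (1 - jointCDF μ y)) +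
          ∑ i, pderiv i (jointCDF μ) y * √(Real.pi⁻¹ * (y i * (1 - y i)))) := by
      have hsum : ∑ i, pderiv i (jointCDF μ) y * (0 - s * √(Real.pi⁻¹ * (y i * (1 - y i)))) =
          -s * ∑ i, pderiv i (jointCDF μ) y * √(Real.pi⁻¹ * (y i * (1 - y i))) := by
        rw [Finset.mul_sum]
        exact Finset.sum_congr rfl fun i _ => by ring
      simp only [varianceTerm, zeroOn_empty, Finset.notMem_empty, if_false, not_false_eq_true,
        if_true, ← Real.sqrt_eq_rpow, ← hs, hsum]
      rw [hss]
      field_simp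
      ring
    rw [e, abs_mul, abs_of_nonneg (by positivity : (0 : ℝ) ≤ (n : ℝ)⁻¹ * s⁻¹), mul_comm]
    gcongr
  · exact ⟨0, fun n m _ ha => absurd ha.2 hy⟩

lemma abs_varianceTerm_le {F : (Fin d → ℝ) → ℝ} (hF : ContDiffOn ℝ (1 : ℕ) F (simplex d))
    (hJ : J.Nonempty) (hface : ∀ x ∈ simplex d, (∃ i ∈ J, x i = 0) → F x = 0) :
    ∃ C : ℝ, 0 ≤ C ∧ ∀ (y : Fin d → ℝ) (n m : ℕ), Admissible J lam y m →
      |varianceTerm F J lam (boundaryPoint J lam y m) n m| ≤ C * ((n : ℝ)⁻¹ * (m : ℝ)⁻¹) := by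
  have hd (i : Fin d) : ContDiffOn ℝ (0 : ℕ) (pderiv i F) (simplex d) := ContDiffOn.pderiv hF i
  choose B hB0 hB using fun i => exists_bound_on_simplex (hd i).continuousOn
  refine ⟨∑ i, B i * |poissonFactor (lam i)|, Finset.sum_nonneg fun i _ =>
    mul_nonneg (hB0 i) (abs_nonneg _), fun y n m ha => ?_⟩
  obtain ⟨hm, hy, hx⟩ := ha
  set x := boundaryPoint J lam y m with hxdef
  have hz := zeroOn_mem hx J
  rw [varianceTerm, if_neg hJ.ne_empty, add_zero, abs_mul,
    abs_of_nonneg (by positivity : (0 : ℝ) ≤ (n : ℝ)⁻¹ * (m : ℝ)⁻¹), mul_comm]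
  gcongr
  refine (Finset.abs_sum_le_sum_abs _ _).trans (Finset.sum_le_sum fun i _ => ?_)
  by_cases hi : i ∈ J
  · simp only [hi, if_true, not_true_eq_false, if_false, sub_zero]
    rw [← poissonFactor, abs_mul]
    exact mul_le_mul_of_nonneg_right (hB i _ hz) (abs_nonneg _)
  · have hzero : pderiv i F (zeroOn J x) = 0 := by
      refine pderiv_eq_zero (hF.differentiableOn (by simp)) hz ?_ fun w hw hwx => ?_
      · simp only [zeroOn, hxdef, boundaryPoint, hi, if_false]
        exact (hy i hi).1
      · obtain ⟨j, hj⟩ := hJ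
        refine hface w hw ⟨j, hj, ?_⟩
        rw [hwx j fun h => hi (h ▸ hj)]
        simp [zeroOn, hj]
    rw [hzero, zero_mul, abs_zero]
    exact mul_nonneg (hB0 i) (abs_nonneg _)

lemma variance_error_proper (hF : ContDiffOn ℝ (2 : ℕ) (jointCDF μ) (simplex d)) (hJ : J.Nonempty)
    (hface : ∀ x ∈ simplex d, (∃ i ∈ J, x i = 0) → jointCDF μ x = 0)
    (hlam : ∀ i ∈ J, 0 < lam i) {ε : ℝ} (hε : 0 < ε) :
    ∃ M : ℕ, ∀ (y : Fin d → ℝ) (n m : ℕ), M ≤ m → Admissible J lam y m →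
      |(n : ℝ)⁻¹ * Var[coverProb (boundaryPoint J lam y m) m; μ] -
        varianceTerm (jointCDF μ) J lam (boundaryPoint J lam y m) n m| ≤
        ε * ((n : ℝ)⁻¹ * (√(m : ℝ))⁻¹) := by
  obtain ⟨C, hC0, hC⟩ := exists_variance_le hF hJ hface hlam
  obtain ⟨D, hD0, hD⟩ := abs_varianceTerm_le (lam := lam) (hF.of_le (by norm_num)) hJ hface
  refine ⟨⌈((C + D) / ε) ^ 2⌉₊, fun y n m hM ha => ?_⟩
  have hm0 : (0 : ℝ) < m := by exact_mod_cast ha.1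
  set s := √(m : ℝ) with hs
  have hs0 : 0 < s := Real.sqrt_pos.2 hm0
  have hss : (m : ℝ) = s * s := (Real.mul_self_sqrt hm0.le).symm
  have hsK : (C + D) / ε ≤ s :=
    Real.le_sqrt_of_sq_le ((Nat.le_ceil _).trans (by exact_mod_cast hM))
  rw [div_le_iff₀ hε] at hsK
  refine (abs_sub _ _).trans ?_
  rw [abs_of_nonneg (mul_nonneg (by positivity) (variance_nonneg _ _))]
  have h1 : (n : ℝ)⁻¹ * Var[coverProb (boundaryPoint J lam y m) m; μ] ≤
      (n : ℝ)⁻¹ * (C * (m : ℝ)⁻¹) := by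
    gcongr; exact hC y m ha.1 ha.2.2
  have h2 := hD y n m ha
  have h3 : (n : ℝ)⁻¹ * (C * (m : ℝ)⁻¹) + D * ((n : ℝ)⁻¹ * (m : ℝ)⁻¹) =
      ((C + D) * (m : ℝ)⁻¹) * (n : ℝ)⁻¹ := by ring
  have h4 : (C + D) * (m : ℝ)⁻¹ ≤ ε * s⁻¹ := by
    calc (C + D) * (m : ℝ)⁻¹ ≤ (s * ε) * (m : ℝ)⁻¹ := by gcongr
      _ = ε * s⁻¹ := by rw [hss]; field_simp
  calc _ ≤ ((C + D) * (m : ℝ)⁻¹) * (n : ℝ)⁻¹ := by linarith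
    _ ≤ (ε * s⁻¹) * (n : ℝ)⁻¹ := by gcongr
    _ = _ := by ring

lemma bias_error_univ {F : (Fin d → ℝ) → ℝ} (hF : ContDiffOn ℝ (2 : ℕ) F (simplex d))
    (lam : Fin d → ℝ) :
    ∃ C : ℝ, ∀ (y : Fin d → ℝ) (m : ℕ), 1 ≤ m → boundaryPoint Finset.univ lam y m ∈ simplex d →
      |(bernsteinPoly F m (boundaryPoint Finset.univ lam y m) -
          F (boundaryPoint Finset.univ lam y m)) ^ 2 -
        biasTerm F Finset.univ lam (boundaryPoint Finset.univ lam y m) m ^ 2| ≤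
        C * ((m : ℝ) ^ 4)⁻¹ := by
  obtain ⟨C, hC0, hC⟩ := exists_bias_bound hF
  set Q : ℝ := ∑ i, lam i * pderiv i (pderiv i F) 0 with hQ
  refine ⟨(C * ∑ i, lam i) ^ 2 + Q ^ 2, fun y m hm hx => ?_⟩
  have hm0 : (0 : ℝ) < m := by exact_mod_cast hm
  set x := boundaryPoint Finset.univ lam y m with hxdef
  have hsum : ∑ i, x i = (∑ i, lam i) / m := by
    rw [hxdef, sum_boundaryPoint]; simp
  have h1 := hC m hm x hx
  rw [hsum] at h1
  have h2 := pow_le_pow_left₀ (abs_nonneg _) h1 2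
  rw [sq_abs] at h2
  have h3 : biasTerm F Finset.univ lam x m = (2 * (m : ℝ) ^ 2)⁻¹ * Q := by
    simp [biasTerm, hQ]
  have h4 : (C * ((∑ i, lam i) / m / m)) ^ 2 = (C * ∑ i, lam i) ^ 2 * ((m : ℝ) ^ 4)⁻¹ := by
    field_simp
  have h5 : ((2 * (m : ℝ) ^ 2)⁻¹ * Q) ^ 2 ≤ Q ^ 2 * ((m : ℝ) ^ 4)⁻¹ := by
    have : ((2 * (m : ℝ) ^ 2)⁻¹ * Q) ^ 2 = 1 / 4 * (Q ^ 2 * ((m : ℝ) ^ 4)⁻¹) := by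
      field_simp; ring
    rw [this]
    have : 0 ≤ Q ^ 2 * ((m : ℝ) ^ 4)⁻¹ := by positivity
    linarith
  rw [h4] at h2
  rw [h3]
  have h6 := sq_nonneg ((2 * (m : ℝ) ^ 2)⁻¹ * Q)
  have h7 := sq_nonneg (bernsteinPoly F m x - F x)
  rw [abs_le]
  constructor <;> nlinarith

lemma bias_error {F : (Fin d → ℝ) → ℝ} (hF : ContDiffOn ℝ (3 : ℕ) F (simplex d))
    (J : Finset (Fin d)) (hlam : ∀ i ∈ J, 0 < lam i) {ε : ℝ} (hε : 0 < ε) :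
    ∃ M : ℕ, ∀ (y : Fin d → ℝ) (m : ℕ), 1 ≤ m → M ≤ m → boundaryPoint J lam y m ∈ simplex d →
      |(bernsteinPoly F m (boundaryPoint J lam y m) - F (boundaryPoint J lam y m)) ^ 2 -
        biasTerm F J lam (boundaryPoint J lam y m) m ^ 2| ≤
        ε * ((m : ℝ) ^ 2 * √(m : ℝ))⁻¹ := by
  obtain ⟨K, hK0, hK⟩ := exists_biasTerm_bound (hF.of_le (by norm_num)) J (lam := lam)
  set η : ℝ := min 1 (ε / (2 * K + 1)) with hη
  have hη0 : 0 < η := by positivity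
  have hη1 : η ≤ 1 := min_le_left _ _
  have hηε : η * (2 * K + 1) ≤ ε := by
    rw [← le_div_iff₀ (by positivity)]; exact min_le_right _ _
  obtain ⟨M, hM⟩ := bias_expansion_boundary hF J hlam hη0
  refine ⟨M, fun y m hm hMm hx => ?_⟩
  have h1 := hM y m hm hMm hx
  set x := boundaryPoint J lam y m with hxdef
  have h2 := hK x hx m hm
  have hm0 : (0 : ℝ) < m := by exact_mod_cast hm
  have hm1 : (1 : ℝ) ≤ m := by exact_mod_cast hm
  set s := √(m : ℝ) with hs
  have hs0 : 0 < s := Real.sqrt_pos.2 hm0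
  have hs1 : 1 ≤ s := Real.one_le_sqrt.2 hm1
  set b := biasTerm F J lam x m
  set e := bernsteinPoly F m x - F x - b with he
  have hsplit : (bernsteinPoly F m x - F x) ^ 2 - b ^ 2 = e * (2 * b + e) := by rw [he]; ring
  have h3 : η * ((m : ℝ) * s)⁻¹ ≤ (m : ℝ)⁻¹ := by
    calc η * ((m : ℝ) * s)⁻¹ ≤ 1 * ((m : ℝ) * 1)⁻¹ := by gcongr
      _ = _ := by rw [one_mul, mul_one]
  have h4 : |2 * b + e| ≤ (2 * K + 1) * (m : ℝ)⁻¹ := by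
    refine (abs_add_le _ _).trans ?_
    rw [abs_mul, abs_two]
    linarith
  rw [hsplit, abs_mul]
  calc |e| * |2 * b + e| ≤ (η * ((m : ℝ) * s)⁻¹) * ((2 * K + 1) * (m : ℝ)⁻¹) := by gcongr
    _ = (η * (2 * K + 1)) * ((m : ℝ) ^ 2 * s)⁻¹ := by field_simp
    _ ≤ _ := by gcongr

end

end

end BernsteinSimplex

theorem corollary3 {d : ℕ} {Ω : Type*} [MeasurableSpace Ω]
    (P : MeasureTheory.Measure Ω) [MeasureTheory.IsProbabilityMeasure P]
    (μ : MeasureTheory.Measure (Fin d → ℝ)) [MeasureTheory.IsProbabilityMeasure μ]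
    (X : ℕ → Ω → Fin d → ℝ)
    (hlaw : ∀ i, ProbabilityTheory.HasLaw (X i) μ P)
    (hindep : ProbabilityTheory.iIndepFun X P)
    (F : (Fin d → ℝ) → ℝ) (hF : F = BernsteinSimplex.jointCDF μ)
    (hC3 : ContDiffOn ℝ 3 F (BernsteinSimplex.simplex d))
    (J : Finset (Fin d))
    (hface : ∀ x ∈ BernsteinSimplex.simplex d, (∃ i ∈ J, x i = 0) → F x = 0) :
    -- asymptotic expansion of the mean squared error
    (∀ lam : Fin d → ℝ, (∀ i ∈ J, 0 < lam i) →
      ∃ E₁ E₂ E₃ E₄ : (Fin d → ℝ) → ℕ → ℕ → ℝ,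
        (∀ (y : Fin d → ℝ) (n m : ℕ), 1 ≤ n → BernsteinSimplex.Admissible J lam y m →
          BernsteinSimplex.mse P X F n m (BernsteinSimplex.boundaryPoint J lam y m) =
            BernsteinSimplex.varianceTerm F J lam
                (BernsteinSimplex.boundaryPoint J lam y m) n m +
              (BernsteinSimplex.biasTerm F J lam
                (BernsteinSimplex.boundaryPoint J lam y m) m) ^ 2 +
              E₁ y n m + (if J ≠ Finset.univ then E₂ y n m else 0) +
              E₃ y n m + (if J ≠ Finset.univ then E₄ y n m else 0)) ∧
        (∃ C : ℝ, ∀ (y : Fin d → ℝ) (n m : ℕ), 1 ≤ n →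
          BernsteinSimplex.Admissible J lam y m →
          |E₁ y n m| ≤ C * ((n : ℝ)⁻¹ * (m : ℝ) ^ (-2 : ℝ))) ∧
        (∀ y : Fin d → ℝ, ∀ ε > (0 : ℝ), ∃ M : ℕ, ∀ n m : ℕ, 1 ≤ n → M ≤ m →
          BernsteinSimplex.Admissible J lam y m →
          |E₂ y n m| ≤ ε * ((n : ℝ)⁻¹ * (m : ℝ) ^ (-1 / 2 : ℝ))) ∧
        (∃ C : ℝ, ∀ (y : Fin d → ℝ) (n m : ℕ), 1 ≤ n →
          BernsteinSimplex.Admissible J lam y m →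
          |E₃ y n m| ≤ C * (m : ℝ) ^ (-4 : ℝ)) ∧
        (∀ ε > (0 : ℝ), ∃ M : ℕ, ∀ (y : Fin d → ℝ) (n m : ℕ), 1 ≤ n → M ≤ m →
          BernsteinSimplex.Admissible J lam y m →
          |E₄ y n m| ≤ ε * (m : ℝ) ^ (-5 / 2 : ℝ))) ∧
    -- on the faces `x i = 0` with `i ∈ J` the estimator vanishes and the error is zero
    (∀ n m : ℕ, 1 ≤ n → 1 ≤ m → ∀ x ∈ BernsteinSimplex.simplex d, (∃ i ∈ J, x i = 0) →
      (∀ᵐ ω ∂P, BernsteinSimplex.bernsteinEstimator (fun i => X i ω) n m x = 0) ∧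
        BernsteinSimplex.mse P X F n m x = 0) ∧
    -- there is no optimal `m` when `J` is non-empty
    (∀ lam y : Fin d → ℝ, J.Nonempty → (∀ i ∈ J, 0 < lam i) →
      (∀ i, i ∉ J → y i ∈ Set.Ioo (0 : ℝ) 1) → ∑ i ∈ Jᶜ, y i < 1 →
      (∃ z ∈ BernsteinSimplex.simplex d, F z ≠ 0) →
      (∃ M : ℕ, ∀ n m : ℕ, 1 ≤ n → M ≤ m → ∃ m' : ℕ, m < m' ∧
        BernsteinSimplex.mse P X F n m' (BernsteinSimplex.boundaryPoint J lam y m') <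
          BernsteinSimplex.mse P X F n m (BernsteinSimplex.boundaryPoint J lam y m)) ∧
      (∀ m : ℕ → ℕ, Filter.Tendsto m Filter.atTop Filter.atTop →
        (∀ᶠ n in Filter.atTop,
          0 < BernsteinSimplex.mse P X F n (m n)
            (BernsteinSimplex.boundaryPoint J lam y (m n))) ∧
        ∃ m' : ℕ → ℕ, Filter.Tendsto m' Filter.atTop Filter.atTop ∧
          (fun n => BernsteinSimplex.mse P X F n (m' n)
              (BernsteinSimplex.boundaryPoint J lam y (m' n))) =o[Filter.atTop]
            (fun n => BernsteinSimplex.mse P X F n (m n)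
              (BernsteinSimplex.boundaryPoint J lam y (m n))))) := by
  subst hF
  have hF3 : ContDiffOn ℝ (3 : ℕ) (BernsteinSimplex.jointCDF μ) (BernsteinSimplex.simplex d) := by
    exact_mod_cast hC3
  have hF2 : ContDiffOn ℝ (2 : ℕ) (BernsteinSimplex.jointCDF μ) (BernsteinSimplex.simplex d) :=
    hF3.of_le (by norm_num)
  have hF1 : ContDiffOn ℝ (1 : ℕ) (BernsteinSimplex.jointCDF μ) (BernsteinSimplex.simplex d) :=
    hF3.of_le (by norm_num)
  refine ⟨fun lam hlam => ?_, fun n m _ hm x hx hi => ?_, fun lam y hJ hlam hy hsum hne => ?_⟩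
  · set vErr : (Fin d → ℝ) → ℕ → ℕ → ℝ := fun y n m =>
      (n : ℝ)⁻¹ * Var[BernsteinSimplex.coverProb (BernsteinSimplex.boundaryPoint J lam y m) m; μ] -
        BernsteinSimplex.varianceTerm (BernsteinSimplex.jointCDF μ) J lam
          (BernsteinSimplex.boundaryPoint J lam y m) n m with hvErr
    set bErr : (Fin d → ℝ) → ℕ → ℕ → ℝ := fun y _ m =>
      (BernsteinSimplex.bernsteinPoly (BernsteinSimplex.jointCDF μ) m
          (BernsteinSimplex.boundaryPoint J lam y m) -
        BernsteinSimplex.jointCDF μ (BernsteinSimplex.boundaryPoint J lam y m)) ^ 2 -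
        BernsteinSimplex.biasTerm (BernsteinSimplex.jointCDF μ) J lam
          (BernsteinSimplex.boundaryPoint J lam y m) m ^ 2 with hbErr
    refine ⟨fun y n m => if J = Finset.univ then vErr y n m else 0,
      fun y n m => if J = Finset.univ then 0 else vErr y n m,
      fun y n m => if J = Finset.univ then bErr y n m else 0,
      fun y n m => if J = Finset.univ then 0 else bErr y n m, ?_, ?_, ?_, ?_, ?_⟩
    · intro y n m hn ha
      rw [BernsteinSimplex.mse_eq hlaw hindep _ hn ha.2.2]
      by_cases hJ : J = Finset.univ
      · simp only [hJ, if_true, ne_eq, not_true_eq_false, if_false, hvErr, hbErr]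
        ring
      · simp only [hJ, if_false, ne_eq, not_false_eq_true, if_true, hvErr, hbErr]
        ring
    · by_cases hJ : J = Finset.univ
      · subst hJ
        obtain ⟨C, hC⟩ := BernsteinSimplex.variance_error_univ hF2 hface
          fun i => hlam i (Finset.mem_univ i)
        refine ⟨C, fun y n m _ ha => ?_⟩
        have hm : (0 : ℝ) ≤ m := Nat.cast_nonneg m
        beta_reduce
        rw [if_pos rfl, Real.rpow_neg hm, Real.rpow_ofNat]
        exact hC y n m ha.1 ha.2.2
      · exact ⟨0, fun y n m _ _ => by simp [hJ]⟩
    · intro y ε hε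
      by_cases hJ : J = Finset.univ
      · refine ⟨0, fun n m _ _ _ => ?_⟩
        beta_reduce
        rw [if_pos hJ, abs_zero]
        positivity
      · obtain ⟨M, hM⟩ : ∃ M : ℕ, ∀ n m : ℕ, M ≤ m → BernsteinSimplex.Admissible J lam y m →
            |vErr y n m| ≤ ε * ((n : ℝ)⁻¹ * (√(m : ℝ))⁻¹) := by
          rcases J.eq_empty_or_nonempty with rfl | hne
          · exact BernsteinSimplex.variance_error_empty hF2 y hε
          · obtain ⟨M, hM⟩ := BernsteinSimplex.variance_error_proper hF2 hne hface hlam hε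
            exact ⟨M, fun n m => hM y n m⟩
        refine ⟨M, fun n m _ hm ha => ?_⟩
        beta_reduce
        rw [if_neg hJ, neg_div, Real.rpow_neg (Nat.cast_nonneg m), ← Real.sqrt_eq_rpow]
        exact hM n m hm ha
    · by_cases hJ : J = Finset.univ
      · subst hJ
        obtain ⟨C, hC⟩ := BernsteinSimplex.bias_error_univ hF2 lam
        refine ⟨C, fun y n m _ ha => ?_⟩
        have hm : (0 : ℝ) ≤ m := Nat.cast_nonneg m
        beta_reduce
        rw [if_pos rfl, Real.rpow_neg hm, Real.rpow_ofNat]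
        exact hC y m ha.1 ha.2.2
      · exact ⟨0, fun y n m _ _ => by simp [hJ]⟩
    · intro ε hε
      by_cases hJ : J = Finset.univ
      · refine ⟨0, fun y n m _ _ _ => ?_⟩
        beta_reduce
        rw [if_pos hJ, abs_zero]
        positivity
      · obtain ⟨M, hM⟩ := BernsteinSimplex.bias_error hF3 J hlam hε
        refine ⟨M, fun y n m _ hm ha => ?_⟩
        have hm0 : (0 : ℝ) < m := by exact_mod_cast ha.1
        beta_reduce
        rw [if_neg hJ, neg_div, Real.rpow_neg hm0.le, show (5 / 2 : ℝ) = 2 + 1 / 2 by norm_num,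
          Real.rpow_add hm0, Real.rpow_ofNat, ← Real.sqrt_eq_rpow]
        exact hM y m ha.1 hm ha.2.2
  · have hzero := BernsteinSimplex.estimator_eq_zero_on_face hlaw hface n (m := m) hi
    refine ⟨hzero, ?_⟩
    rw [BernsteinSimplex.mse, hface x hx hi]
    rw [integral_congr_ae (g := fun _ => (0 : ℝ)) (hzero.mono fun ω hω => by simp [hω]),
      integral_zero]
  · have hpos := BernsteinSimplex.eventually_mse_pos hlaw hindep hF1 hJ hface hlam hy hsum hne
    have hlim {n : ℕ} (hn : 1 ≤ n) :=
      BernsteinSimplex.tendsto_mse_zero hlaw hindep hF2 hJ hface hlam hy hsum hn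
    refine ⟨?_, fun m hm => ?_⟩
    · obtain ⟨M, hM⟩ := eventually_atTop.1 hpos
      refine ⟨M, fun n m hn hm => ?_⟩
      obtain ⟨m', h1, h2⟩ := (((hlim hn).eventually_lt_const (hM m hm n hn)).and
        (eventually_gt_atTop m)).exists
      exact ⟨m', h2, h1⟩
    · have hposn : ∀ᶠ n in atTop, 0 < BernsteinSimplex.mse P X (BernsteinSimplex.jointCDF μ) n (m n)
          (BernsteinSimplex.boundaryPoint J lam y (m n)) := by
        filter_upwards [hm.eventually hpos, eventually_ge_atTop 1] with n h hn using h n hn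
      refine ⟨hposn, ?_⟩
      have hex (n : ℕ) : ∃ k : ℕ, n ≤ k ∧ (1 ≤ n →
          0 < BernsteinSimplex.mse P X (BernsteinSimplex.jointCDF μ) n (m n)
            (BernsteinSimplex.boundaryPoint J lam y (m n)) →
          BernsteinSimplex.mse P X (BernsteinSimplex.jointCDF μ) n k
            (BernsteinSimplex.boundaryPoint J lam y k) ≤
          (n : ℝ)⁻¹ * BernsteinSimplex.mse P X (BernsteinSimplex.jointCDF μ) n (m n)
            (BernsteinSimplex.boundaryPoint J lam y (m n))) := by
        by_cases h : 1 ≤ n ∧ 0 < BernsteinSimplex.mse P X (BernsteinSimplex.jointCDF μ) n (m n)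
            (BernsteinSimplex.boundaryPoint J lam y (m n))
        · have hn0 : (0 : ℝ) < (n : ℝ)⁻¹ := inv_pos.2 (by exact_mod_cast h.1)
          obtain ⟨k, h1, h2⟩ := (((hlim h.1).eventually_lt_const (mul_pos hn0 h.2)).and
            (eventually_ge_atTop n)).exists
          exact ⟨k, h2, fun _ _ => h1.le⟩
        · exact ⟨n, le_rfl, fun h1 h2 => absurd ⟨h1, h2⟩ h⟩
      choose m' hm'1 hm'2 using hex
      refine ⟨m', tendsto_atTop_mono hm'1 tendsto_id, ?_⟩
      rw [Asymptotics.isLittleO_iff]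
      intro c hc
      have hinv : Tendsto (fun n : ℕ => (n : ℝ)⁻¹) atTop (nhds 0) := tendsto_inv_atTop_nhds_zero_nat
      filter_upwards [hposn, eventually_ge_atTop 1, hinv.eventually_lt_const hc] with n h1 h2 h3
      have h0 : 0 ≤ BernsteinSimplex.mse P X (BernsteinSimplex.jointCDF μ) n (m' n)
          (BernsteinSimplex.boundaryPoint J lam y (m' n)) := integral_nonneg fun ω => sq_nonneg _
      rw [Real.norm_of_nonneg h0, Real.norm_of_nonneg h1.le]
      exact (hm'2 n h2 h1).trans (mul_le_mul_of_nonneg_right h3.le h1.le)
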